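/- Let $\sigma$ be the uniform probability distribution on $\mathbb{S}^{d-1}$, let $\mathbb{Y}_{k,d}$ be the space of degree-$k$ spherical harmonics (restrictions to $\mathbb{S}^{d-1}$ of harmonic homogeneous polynomials of degree $k$), $\mathbb{Y}_{\le k,d}$ the span of $\mathbb{Y}_{0,d},\dots,\mathbb{Y}_{k,d}$, $\Pi_k$ the orthogonal projection of $L^2(\sigma)$ onto $\mathbb{Y}_{k,d}$, and $N_{k,d}=\binom{d+k-1}{d-1}-\binom{d+k-3}{d-1}$. Let $P_{0,d}(t)=1$, $P_{1,d}(t)=t$, $P_{k,d}(t)=\frac{2k+d-4}{k+d-3}tP_{k-1,d}(t)-\frac{k-1}{k+d-3}P_{k-2,d}(t)$ for $k\ge2$, $\bar P_{k,d}=\sqrt{N_{k,d}}\,P_{k,d}$, and $\langle \kappa,\bar P_{k,d}\rangle_{\mu_d}=\int_{-1}^1\kappa(t)\bar P_{k,d}(t)\mu_d(t)\,dt$ with $\mu_d(t)=(1-t^2)^{\frac{d-3}{2}}\frac{\Gamma(d/2)}{\Gamma((d-1)/2)}\frac1{\sqrt\pi}$. **Algorithm 1** (parameters $\beta,c_1,c_2,\epsilon>0$;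 data $(x_i,y_i)_{i=1}^n$). Put $k=\inf\{l\ge0: 2c_1c_2(l+1)^{3/2}N_{l+1,d}^{-\beta/2}\le\epsilon/2\}$ and $\mathcal F_k=\{g\in\mathbb{Y}_{\le k,d}:\|\Pi_l g\|_{L^2(\sigma)}\le c_1\ \forall\, 0\le l\le k\}$, and return a minimizer $g$ over $h\in\mathcal F_k$ of $\sum_{i=1}^n(h(x_i)-y_i)^2$. **Theorem.** There are an absolute constant $A>0$ and an absolute polynomial $p$ in four variables (with coefficients in $\mathbb{N}$) such that the following holds. Let $\alpha,c,\epsilon>0$, $\delta\in(0,1)$, $\beta=\min(\alpha,1)$ (so $\beta=\alpha$ when $\alpha\le1$), and $d\ge 10\beta^{-1}2^{5/\beta}+2$. Let $f$ be a mean-zero isotropic Gaussian random field on $\mathbb{S}^{d-1}$ with covariance $K(x,x')=\kappa(x^\top x')$, jointly measurable in the point and the randomness, and suppose that $\langle\kappa,\bar P_{k,d}\rangle_{\mu_d}\le c^2N_{k,d}^{-1/2-\alpha}$ for all $k\ge0$. Let $n\ge p(c,1/\epsilon,d,\ln(1/\delta))^{1/\beta}$, let $x_1,\dots,x_n$ be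 i.i.d. from $\sigma$ and $y_i=f(x_i)+\xi_i$ with $\xi_i$ i.i.d. $\mathcal N(0,1)$, the field, the points and the noise being independent. Then with probability at least $1-\delta$ over $f$ and the data, Algorithm 1 with parameters $\beta$, $c_1=A\,c\sqrt{\ln(2/\delta)}$, $c_2=A\sqrt{d^2+\ln(2/\delta)}$ and $\epsilon$ has an output, and every output $g$ satisfies $\|g-f\|_{L^\infty(\sigma)}\le\epsilon$; if moreover the sample path $f$ is continuous, then $|g(x)-f(x)|\le\epsilon$ for every $x\in\mathbb{S}^{d-1}$. -/

import Mathlib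

open MeasureTheory ProbabilityTheory

noncomputable section

namespace SphereRecovery

/-- The unit sphere `S^{d-1}` of `ℝ^d`. -/
abbrev Sph (d : ℕ) : Type := Metric.sphere (0 : EuclideanSpace ℝ (Fin d)) 1

/-- The uniform probability distribution on `S^{d-1}`: normalized surface measure. -/
def unif (d : ℕ) : Measure (Sph d) :=
  ProbabilityTheory.cond (volume : Measure (EuclideanSpace ℝ (Fin d))).toSphere Set.univ

instance (d : ℕ) : IsZeroOrProbabilityMeasure (unif d) := by
  unfold unif; infer_instance

/-- The dimension `N_{k,d} = C(d+k-1, d-1) - C(d+k-3, d-1)` of the degree-`k` spherical harmonics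
(used for `d ≥ 2`). -/
def dimN (k d : ℕ) : ℕ := (d + k - 1).choose (d - 1) - (d + k - 3).choose (d - 1)

/-! ### Legendre polynomials -/

/-- The degree-`k` Legendre polynomial `P_{k,d}`, by the three-term recursion
`P_k = (2k+d-4)/(k+d-3) t P_{k-1} - (k-1)/(k+d-3) P_{k-2}` for `k ≥ 2`. -/
def legendreP (d : ℕ) : ℕ → ℝ → ℝ
  | 0, _ => 1
  | 1, t => t
  | k + 2, t =>
      (2 * ((k + 2 : ℕ) : ℝ) + d - 4) / (((k + 2 : ℕ) : ℝ) + d - 3) * t * legendreP d (k + 1) t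
        - (((k + 2 : ℕ) : ℝ) - 1) / (((k + 2 : ℕ) : ℝ) + d - 3) * legendreP d k t

/-- The normalized Legendre polynomial `√N_{k,d} P_{k,d}`. -/
def legendrePBar (d k : ℕ) (t : ℝ) : ℝ := √(dimN k d : ℝ) * legendreP d k t

/-- The density on `[-1,1]` of the first coordinate of a uniform point of `S^{d-1}`. -/
def muDensity (d : ℕ) (t : ℝ) : ℝ :=
  (1 - t ^ 2) ^ (((d : ℝ) - 3) / 2) * (Real.Gamma ((d : ℝ) / 2) / Real.Gamma (((d : ℝ) - 1) / 2))
    * (1 / √Real.pi)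

/-- The Legendre coefficient `⟨κ, P̄_{k,d}⟩_{μ_d}`. -/
def legendreCoeff (d k : ℕ) (κ : ℝ → ℝ) : ℝ :=
  ∫ t in (-1 : ℝ)..1, κ t * legendrePBar d k t * muDensity d t

/-! ### Spherical harmonics -/

/-- The Laplacian `∑ i, ∂²/∂x_i²` on real polynomials in `d` variables. -/
def polyLaplacian (d : ℕ) : MvPolynomial (Fin d) ℝ →ₗ[ℝ] MvPolynomial (Fin d) ℝ :=
  ∑ i : Fin d, (MvPolynomial.pderiv i).toLinearMap ∘ₗ (MvPolynomial.pderiv i).toLinearMap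

/-- Restriction of a polynomial to the sphere, as a continuous function. -/
def restrictSph (d : ℕ) : MvPolynomial (Fin d) ℝ →ₗ[ℝ] C(Sph d, ℝ) where
  toFun p := ⟨fun x => MvPolynomial.eval (fun i => x.1 i) p, by
    refine (MvPolynomial.continuous_eval p).comp ?_
    fun_prop⟩
  map_add' p q := by ext x; simp
  map_smul' a p := by ext x; simp [MvPolynomial.smul_eval]

/-- `𝕐_{k,d}`: restrictions to the sphere of the harmonic homogeneous polynomials of degree `k`. -/
def harm (d k : ℕ) : Submodule ℝ C(Sph d, ℝ) :=
  (MvPolynomial.homogeneousSubmodule (Fin d) ℝ k ⊓ LinearMap.ker (polyLaplacian d)).map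
    (restrictSph d)

/-- `𝕐_{≤k,d}`: the span of the spherical harmonics of degree at most `k`. -/
def harmLE (d k : ℕ) : Submodule ℝ C(Sph d, ℝ) := ⨆ l ∈ Finset.range (k + 1), harm d l

/-- The class in `L²` of the uniform distribution of a continuous function on the sphere. -/
def toL2 (d : ℕ) : C(Sph d, ℝ) →L[ℝ] Lp ℝ 2 (unif d) := ContinuousMap.toLp 2 (unif d) ℝ

/-- `𝕐_{k,d}` as a subspace of `L²`. -/
def harmL2 (d k : ℕ) : Submodule ℝ (Lp ℝ 2 (unif d)) := (harm d k).map (toL2 d).toLinearMap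

instance (d k : ℕ) : FiniteDimensional ℝ (harmL2 d k) := by
  have h : FiniteDimensional ℝ (MvPolynomial.homogeneousSubmodule (Fin d) ℝ k) :=
    Module.Finite.iff_fg.mpr (MvPolynomial.homogeneousSubmodule_fg (Fin d) ℝ k)
  have h' : FiniteDimensional ℝ
      (MvPolynomial.homogeneousSubmodule (Fin d) ℝ k ⊓ LinearMap.ker (polyLaplacian d) :
        Submodule ℝ (MvPolynomial (Fin d) ℝ)) := Submodule.finiteDimensional_inf_left _ _
  unfold harmL2 harm
  infer_instance

/-- `Π_k`: the orthogonal projection of `L²` onto the degree-`k` spherical harmonics. -/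
def projHarm (d k : ℕ) : Lp ℝ 2 (unif d) →L[ℝ] Lp ℝ 2 (unif d) := (harmL2 d k).starProjection

/-! ### The learning algorithm -/

/-- The truncation threshold
`k = inf {l ≥ 0 : 2 c₁ c₂ (l+1)^{3/2} N_{l+1,d}^{-α/2} ≤ ε/2}`. -/
def threshold (d : ℕ) (α c₁ c₂ ε : ℝ) : ℕ :=
  sInf {l : ℕ | 2 * c₁ * c₂ * ((l : ℝ) + 1) ^ (3 / 2 : ℝ) * (dimN (l + 1) d : ℝ) ^ (-α / 2) ≤ ε / 2}

/-- The function class `F_k = {g ∈ 𝕐_{≤k,d} : ‖Π_l g‖₂ ≤ c₁ for all l ∈ [0,k]}`. -/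
def funClass (d k : ℕ) (c₁ : ℝ) : Set C(Sph d, ℝ) :=
  {g | g ∈ harmLE d k ∧ ∀ l ≤ k, ‖projHarm d l (toL2 d g)‖ ≤ c₁}

/-- `g` is an output of the algorithm with parameters `α, c₁, c₂, ε` on the dataset
`(x₁, y₁), …, (xₙ, yₙ)`: a minimizer of the empirical squared loss over the function class `F_k`,
with `k` the truncation threshold. -/
def IsOutput (d : ℕ) (α c₁ c₂ ε : ℝ) {n : ℕ} (x : Fin n → Sph d) (y : Fin n → ℝ)
    (g : C(Sph d, ℝ)) : Prop :=
  g ∈ funClass d (threshold d α c₁ c₂ ε) c₁ ∧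
    ∀ h ∈ funClass d (threshold d α c₁ c₂ ε) c₁,
      ∑ i, (g (x i) - y i) ^ 2 ≤ ∑ i, (h (x i) - y i) ^ 2

/-! ### Random data -/

/-- `f` is a (measurable version of a) mean-zero isotropic Gaussian random field on `S^{d-1}`,
on the probability space `(Ω, P)`, with covariance `K(x, x') = κ(xᵀx')`. -/
structure IsIsotropicGRF {Ω : Type*} [MeasurableSpace Ω] (P : Measure Ω) (d : ℕ) (κ : ℝ → ℝ)
    (f : Ω → Sph d → ℝ) : Prop where
  measurable : Measurable (Function.uncurry f)
  gaussian : IsGaussianProcess (fun x ω => f ω x) P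
  mean : ∀ x, ∫ ω, f ω x ∂P = 0
  cov : ∀ x x', covariance (fun ω => f ω x) (fun ω => f ω x') P = κ (inner ℝ x.1 x'.1)

/-- The joint law of the field, `n` i.i.d. uniform sample points and `n` i.i.d. `N(0,1)` noise
variables, all independent of each other. -/
def jointLaw {Ω : Type*} [MeasurableSpace Ω] (P : Measure Ω) (d n : ℕ) :
    Measure (Ω × (Fin n → Sph d) × (Fin n → ℝ)) :=
  P.prod ((Measure.pi fun _ => unif d).prod (Measure.pi fun _ => gaussianReal 0 1))

/-- The labels `y_i = f(x_i) + ξ_i`. -/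
def labels {d n : ℕ} (f : Sph d → ℝ) (x : Fin n → Sph d) (ξ : Fin n → ℝ) : Fin n → ℝ :=
  fun i => f (x i) + ξ i

/-- The algorithm succeeds on the sample points `x` and the noise `ξ`: it has an output, and every
output `g` satisfies `‖g - f‖_∞ ≤ ε`. The norm is that of `L^∞` of the uniform distribution; where
`f` is continuous the bound is also asserted at every point. -/
def Succeeds (d : ℕ) (α c₁ c₂ ε : ℝ) {n : ℕ} (f : Sph d → ℝ) (x : Fin n → Sph d)
    (ξ : Fin n → ℝ) : Prop :=
  (∃ g, IsOutput d α c₁ c₂ ε x (labels f x ξ) g) ∧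
    ∀ g, IsOutput d α c₁ c₂ ε x (labels f x ξ) g →
      eLpNorm (fun z => g z - f z) ⊤ (unif d) ≤ ENNReal.ofReal ε ∧
        (Continuous f → ∀ z, |g z - f z| ≤ ε)

end SphereRecovery

end

noncomputable section

namespace SphereRecovery

/-! Write `f_l` for the degree-`l` part of the field. At each point its variance is `legendreCoeff d
l κ * √N_l ≤ c² N_l^(-β)`, and in dimensions this large `N_l^β` is at least `l^5`. So with high
probability the `f_l` decay, uniformly on the sphere, fast enough that cutting at the threshold
degree `k` costs at most `ε/2`, while the truncation lies in the function class. What is left is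
linear regression in a space of dimension `D`, at most a constant times a `1/β`-th power of a
polynomial in the parameters. With enough samples every empirical minimizer is uniformly `ε/2`-close
to the truncation.

Harmonic analysis. Orthogonality of different degrees follows from Gaussian integration by parts
(`gaussInt_harmonic_mul_eq_zero`), completeness from harmonic decomposition and Stone-Weierstrass
(`ae_eq_zero_of_forall_harm`). The Legendre recursion produces harmonic zonal functions of squared
norm `1/N_k`. The Funk-Hecke formula (`integral_comp_inner_mul_harm`) is obtained by comparing
moments on `[-1, 1]`, without rotations. It gives the eigenvalues of the covariance operator, the
addition formula, the dimension `N_k`, and `sup g² ≤ dim * ∫ g²` (`harmLE_sq_le`).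

The field. Its integrals against harmonics obey Gaussian moment bounds, being almost sure limits of
finite averages (`lintegral_fieldInt_pow_le`). For the supremum of `f_l` no chaining is used:
`f_l^p` has degree at most `l p`, and for `p ≥ d² + l` the `p`-th root of the dimension of that
space is bounded by an absolute constant, so the `L^{2p}` norm controls the supremum
(`sq_le_of_integral_pow_le`). Markov's inequality and a union bound over `l` give
`measure_fieldPart_large_le`, and the choice of threshold gives `measure_not_isApproximable_le`.

The regression. The truncation residual is bounded and orthogonal to the basis, hence behaves like
centred noise. Once the empirical Gram matrix is near the identity and residual and noise are almost
uncorrelated with the basis (`SampleGood`), the conclusion is deterministic (`sum_sq_le_of_isMin`).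
Hoeffding-type bounds give the probability of that event (`measure_not_sampleGood_le`), and Fubini
combines it with the event for the field. -/

/-! ### Polynomials against the Gaussian weight -/

/-- The value of a polynomial at a point of Euclidean space. -/
def polyEval {d : ℕ} (p : MvPolynomial (Fin d) ℝ) (v : EuclideanSpace ℝ (Fin d)) : ℝ :=
  MvPolynomial.eval (fun i => v i) p

section
variable {d : ℕ}

@[simp] lemma polyEval_add (p q : MvPolynomial (Fin d) ℝ) (v) :
    polyEval (p + q) v = polyEval p v + polyEval q v := by simp [polyEval]

@[simp] lemma polyEval_sub (p q : MvPolynomial (Fin d) ℝ) (v) :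
    polyEval (p - q) v = polyEval p v - polyEval q v := by simp [polyEval]

@[simp] lemma polyEval_mul (p q : MvPolynomial (Fin d) ℝ) (v) :
    polyEval (p * q) v = polyEval p v * polyEval q v := by simp [polyEval]

@[simp] lemma polyEval_pow (p : MvPolynomial (Fin d) ℝ) (n : ℕ) (v) :
    polyEval (p ^ n) v = polyEval p v ^ n := by simp [polyEval]

@[simp] lemma polyEval_C (a : ℝ) (v : EuclideanSpace ℝ (Fin d)) :
    polyEval (MvPolynomial.C a) v = a := by simp [polyEval]

@[simp] lemma polyEval_zero (v : EuclideanSpace ℝ (Fin d)) :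
    polyEval (0 : MvPolynomial (Fin d) ℝ) v = 0 := by simp [polyEval]

@[simp] lemma polyEval_one (v : EuclideanSpace ℝ (Fin d)) :
    polyEval (1 : MvPolynomial (Fin d) ℝ) v = 1 := by simp [polyEval]

@[simp] lemma polyEval_X (i : Fin d) (v : EuclideanSpace ℝ (Fin d)) :
    polyEval (MvPolynomial.X i) v = v i := by simp [polyEval]

@[simp] lemma polyEval_smul (a : ℝ) (p : MvPolynomial (Fin d) ℝ) (v) :
    polyEval (a • p) v = a * polyEval p v := by simp [polyEval, MvPolynomial.smul_eval]

@[simp] lemma polyEval_sum {ι : Type*} (s : Finset ι) (p : ι → MvPolynomial (Fin d) ℝ) (v) :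
    polyEval (∑ i ∈ s, p i) v = ∑ i ∈ s, polyEval (p i) v := by simp [polyEval]

lemma continuous_polyEval (p : MvPolynomial (Fin d) ℝ) : Continuous (polyEval p) := by
  refine (MvPolynomial.continuous_eval p).comp ?_
  fun_prop

lemma restrictSph_apply (p : MvPolynomial (Fin d) ℝ) (x : Sph d) :
    restrictSph d p x = polyEval p x.1 := rfl

lemma polyEval_bound (p : MvPolynomial (Fin d) ℝ) :
    ∃ (C : ℝ) (m : ℕ), 0 ≤ C ∧ ∀ v, |polyEval p v| ≤ C * (1 + ‖v‖) ^ m := by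
  induction p using MvPolynomial.induction_on with
  | C a => exact ⟨|a|, 0, abs_nonneg a, fun v => by simp⟩
  | add p q hp hq =>
    obtain ⟨C, m, hC, h⟩ := hp
    obtain ⟨C', m', hC', h'⟩ := hq
    refine ⟨C + C', m + m', by positivity, fun v => ?_⟩
    have h1 : (1 : ℝ) ≤ 1 + ‖v‖ := by linarith [norm_nonneg v]
    have e1 : (1 + ‖v‖) ^ m ≤ (1 + ‖v‖) ^ (m + m') := pow_le_pow_right₀ h1 (by omega)
    have e2 : (1 + ‖v‖) ^ m' ≤ (1 + ‖v‖) ^ (m + m') := pow_le_pow_right₀ h1 (by omega)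
    rw [polyEval_add, add_mul]
    refine (abs_add_le _ _).trans (add_le_add ?_ ?_)
    · exact (h v).trans (by gcongr)
    · exact (h' v).trans (by gcongr)
  | mul_X p i hp =>
    obtain ⟨C, m, hC, h⟩ := hp
    refine ⟨C, m + 1, hC, fun v => ?_⟩
    have h1 : |v i| ≤ 1 + ‖v‖ := by
      have := PiLp.norm_apply_le v i
      rw [Real.norm_eq_abs] at this
      linarith
    rw [polyEval_mul, abs_mul, polyEval_X, pow_succ, ← mul_assoc]
    exact mul_le_mul (h v) h1 (abs_nonneg _) (by positivity)

lemma integrable_mul_exp_of_growth {g : EuclideanSpace ℝ (Fin d) → ℝ} (hg : Continuous g)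
    {C : ℝ} {m : ℕ} (hC : 0 ≤ C) (h : ∀ v, |g v| ≤ C * (1 + ‖v‖) ^ m) :
    Integrable (fun v => g v * Real.exp (-‖v‖ ^ 2 / 2)) := by
  have h0 : Integrable (fun v : EuclideanSpace ℝ (Fin d) => Real.exp (-(1 / 4) * ‖v‖ ^ 2)) := by
    have := (GaussianFourier.integrable_cexp_neg_mul_sq_norm_add (V := EuclideanSpace ℝ (Fin d))
      (b := (1 / 4 : ℂ)) (by norm_num) 0 0).norm
    refine this.congr (Filter.Eventually.of_forall fun v => ?_)
    simp [Complex.norm_exp, ← Complex.ofReal_pow]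
  refine (h0.const_mul (C * m.factorial * Real.exp 2)).mono' ?_ ?_
  · exact (hg.mul (by fun_prop)).aestronglyMeasurable
  · refine Filter.Eventually.of_forall fun v => ?_
    have hr := norm_nonneg v
    rw [Real.norm_eq_abs, abs_mul, abs_of_pos (Real.exp_pos _)]
    -- The polynomial growth is absorbed into `exp (1 + r)`, and `1 + r - r²/2 ≤ 2 - r²/4` because
    -- the difference is the square `(r/2 - 1)²`.
    have e1 : (1 + ‖v‖) ^ m ≤ m.factorial * Real.exp (1 + ‖v‖) := by
      have := Real.pow_div_factorial_le_exp (1 + ‖v‖) (by positivity) m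
      rw [div_le_iff₀ (by positivity)] at this
      linarith
    calc |g v| * Real.exp (-‖v‖ ^ 2 / 2)
        ≤ (C * (m.factorial * Real.exp (1 + ‖v‖))) * Real.exp (-‖v‖ ^ 2 / 2) := by
          gcongr; exact (h v).trans (by gcongr)
      _ = (C * m.factorial) * Real.exp (1 + ‖v‖ + -‖v‖ ^ 2 / 2) := by
          rw [Real.exp_add (1 + ‖v‖)]; ring
      _ ≤ (C * m.factorial) * Real.exp (2 + -(1 / 4) * ‖v‖ ^ 2) := by
          refine mul_le_mul_of_nonneg_left (Real.exp_le_exp.mpr ?_) (by positivity)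
          nlinarith [sq_nonneg (‖v‖ / 2 - 1)]
      _ = _ := by rw [Real.exp_add 2]; ring

lemma integrable_polyEval_mul_exp (p : MvPolynomial (Fin d) ℝ) :
    Integrable (fun v => polyEval p v * Real.exp (-‖v‖ ^ 2 / 2)) := by
  obtain ⟨C, m, hC, h⟩ := polyEval_bound p
  exact integrable_mul_exp_of_growth (continuous_polyEval p) hC h

lemma hasFDerivAt_polyEval (p : MvPolynomial (Fin d) ℝ) (v : EuclideanSpace ℝ (Fin d)) :
    HasFDerivAt (polyEval p) (∑ i, polyEval (MvPolynomial.pderiv i p) v •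
      (EuclideanSpace.proj i : EuclideanSpace ℝ (Fin d) →L[ℝ] ℝ)) v := by
  induction p using MvPolynomial.induction_on with
  | C a =>
    have : polyEval (MvPolynomial.C a) = fun _ : EuclideanSpace ℝ (Fin d) => a := by
      ext v; simp
    rw [this]
    simpa using hasFDerivAt_const a v
  | add p q hp hq =>
    have : polyEval (p + q) = fun v => polyEval p v + polyEval q v := by ext v; simp
    rw [this]
    convert! hp.add hq using 1
    simp [add_smul, Finset.sum_add_distrib]
  | mul_X p i hp =>
    have : polyEval (p * MvPolynomial.X i) = fun v => polyEval p v *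
        (EuclideanSpace.proj i : EuclideanSpace ℝ (Fin d) →L[ℝ] ℝ) v := by ext v; simp
    rw [this]
    convert! hp.mul (ContinuousLinearMap.hasFDerivAt (EuclideanSpace.proj i)) using 1
    ext w
    simp [Derivation.leibniz, MvPolynomial.pderiv_X, Pi.single_apply, add_mul,
      Finset.sum_add_distrib, Finset.mul_sum, apply_ite (fun q => polyEval q v), mul_assoc]

/-- The integral of a polynomial against the (unnormalized) Gaussian weight. -/
def gaussInt (p : MvPolynomial (Fin d) ℝ) : ℝ :=
  ∫ v, polyEval p v * Real.exp (-‖v‖ ^ 2 / 2)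

lemma gaussInt_add (p q : MvPolynomial (Fin d) ℝ) :
    gaussInt (p + q) = gaussInt p + gaussInt q := by
  unfold gaussInt
  rw [← integral_add (integrable_polyEval_mul_exp p) (integrable_polyEval_mul_exp q)]
  simp [add_mul]

lemma gaussInt_smul (a : ℝ) (p : MvPolynomial (Fin d) ℝ) :
    gaussInt (a • p) = a * gaussInt p := by
  unfold gaussInt
  rw [← integral_const_mul]
  simp [mul_assoc]

/-- `gaussInt` as a linear functional. -/
def gaussIntLin : MvPolynomial (Fin d) ℝ →ₗ[ℝ] ℝ where
  toFun := gaussInt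
  map_add' := gaussInt_add
  map_smul' := gaussInt_smul

lemma gaussInt_sum {ι : Type*} (s : Finset ι) (p : ι → MvPolynomial (Fin d) ℝ) :
    gaussInt (∑ i ∈ s, p i) = ∑ i ∈ s, gaussInt (p i) := map_sum gaussIntLin p s

/-- Gaussian integration by parts. -/
lemma gaussInt_X_mul (i : Fin d) (p : MvPolynomial (Fin d) ℝ) :
    gaussInt (MvPolynomial.X i * p) = gaussInt (MvPolynomial.pderiv i p) := by
  set e : EuclideanSpace ℝ (Fin d) := EuclideanSpace.single i 1
  have hp : ∀ v, fderiv ℝ (polyEval p) v e = polyEval (MvPolynomial.pderiv i p) v := fun v => by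
    rw [(hasFDerivAt_polyEval p v).fderiv]
    simp [e]
  have hg : ∀ v : EuclideanSpace ℝ (Fin d),
      HasFDerivAt (fun v : EuclideanSpace ℝ (Fin d) => Real.exp (-‖v‖ ^ 2 / 2))
        (Real.exp (-‖v‖ ^ 2 / 2) • (-(innerSL ℝ v))) v := fun v => by
    have h1 := (hasStrictFDerivAt_norm_sq v).hasFDerivAt
    have h2 := (h1.const_mul (-(1 / 2 : ℝ))).exp
    convert! h2 using 1
    · ext v; ring_nf
    · ext w; simp; left; ring
  have hg' : ∀ v, fderiv ℝ (fun v : EuclideanSpace ℝ (Fin d) => Real.exp (-‖v‖ ^ 2 / 2)) v e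
      = - (v i * Real.exp (-‖v‖ ^ 2 / 2)) := fun v => by
    rw [(hg v).fderiv]
    simp [e, EuclideanSpace.inner_single_right, mul_comm]
  have key := integral_mul_fderiv_eq_neg_fderiv_mul_of_integrable (μ := volume) (v := e)
    (f := polyEval p) (g := fun v : EuclideanSpace ℝ (Fin d) => Real.exp (-‖v‖ ^ 2 / 2))
    (by simpa [hp] using integrable_polyEval_mul_exp (MvPolynomial.pderiv i p))
    (by
      refine (integrable_polyEval_mul_exp (MvPolynomial.X i * p)).neg.congr
        (Filter.Eventually.of_forall fun v => ?_)
      simp only [hg', Pi.neg_apply, polyEval_mul, polyEval_X]; ring)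
    (integrable_polyEval_mul_exp p)
    (fun v _ => (hasFDerivAt_polyEval p v).differentiableAt)
    (fun v _ => (hg v).differentiableAt)
  simp only [hp, hg'] at key
  unfold gaussInt
  rw [← neg_inj, ← key, ← integral_neg]
  congr 1; ext v
  simp only [polyEval_mul, polyEval_X]; ring

lemma polyEval_smul_of_isHomogeneous {p : MvPolynomial (Fin d) ℝ} {m : ℕ}
    (hp : p.IsHomogeneous m) (r : ℝ) (v : EuclideanSpace ℝ (Fin d)) :
    polyEval p (r • v) = r ^ m * polyEval p v := by
  unfold polyEval
  rw [MvPolynomial.eval_eq, MvPolynomial.eval_eq, Finset.mul_sum]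
  refine Finset.sum_congr rfl fun s hs => ?_
  rw [hp.degree_eq_sum_deg_support hs, ← Finset.prod_pow_eq_pow_sum]
  simp only [PiLp.smul_apply, smul_eq_mul, mul_pow, Finset.prod_mul_distrib]
  ring

lemma nontrivial_euclidean (hd : 1 ≤ d) : Nontrivial (EuclideanSpace ℝ (Fin d)) := by
  have : NeZero d := ⟨by omega⟩
  refine ⟨0, EuclideanSpace.single 0 1, fun h => ?_⟩
  simpa using congrArg (fun v => v 0) h

lemma volume_toSphere_ne_zero (hd : 1 ≤ d) :
    (volume : Measure (EuclideanSpace ℝ (Fin d))).toSphere Set.univ ≠ 0 := by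
  have := nontrivial_euclidean hd
  rw [Ne, Measure.measure_univ_eq_zero]
  exact Measure.toSphere_ne_zero (volume : Measure (EuclideanSpace ℝ (Fin d)))

lemma unif_eq : unif d = ((volume : Measure (EuclideanSpace ℝ (Fin d))).toSphere Set.univ)⁻¹ •
    (volume : Measure (EuclideanSpace ℝ (Fin d))).toSphere := by
  simp [unif, ProbabilityTheory.cond]

lemma isProbabilityMeasure_unif (hd : 1 ≤ d) : IsProbabilityMeasure (unif d) := by
  unfold unif
  exact cond_isProbabilityMeasure (volume_toSphere_ne_zero hd)

lemma isOpenPosMeasure_unif : (unif d).IsOpenPosMeasure := by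
  rw [unif_eq]
  exact Measure.isOpenPosMeasure_smul _ (ENNReal.inv_ne_zero.mpr (measure_ne_top _ _))

lemma integral_norm_pow_mul_exp_pos (hd : 1 ≤ d) (m : ℕ) :
    0 < ∫ v : EuclideanSpace ℝ (Fin d), ‖v‖ ^ m * Real.exp (-‖v‖ ^ 2 / 2) := by
  have := nontrivial_euclidean hd
  have hint : Integrable
      (fun v : EuclideanSpace ℝ (Fin d) => ‖v‖ ^ m * Real.exp (-‖v‖ ^ 2 / 2)) := by
    refine integrable_mul_exp_of_growth (C := 1) (m := m) (by fun_prop) zero_le_one fun v => ?_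
    rw [abs_of_nonneg (by positivity), one_mul]
    exact pow_le_pow_left₀ (norm_nonneg v) (by linarith) m
  obtain ⟨v, hv⟩ := exists_ne (0 : EuclideanSpace ℝ (Fin d))
  refine integral_pos_of_integrable_nonneg_nonzero (x := v) (by fun_prop) hint
    (fun v => by positivity) ?_
  have : 0 < ‖v‖ := norm_pos_iff.mpr hv
  positivity

/-- Polar coordinates split an angular factor from a radial one. The origin is a null set, so
nothing is asked of `F` there, and no integrability is needed since the product formula for
integrals holds unconditionally. -/
lemma integral_polar (hd : 1 ≤ d) (g : Sph d → ℝ) (h : ℝ → ℝ)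
    (F : EuclideanSpace ℝ (Fin d) → ℝ) (hF : ∀ (x : Sph d) (r : ℝ), 0 < r →
      F (r • x.1) = g x * h r) :
    ∫ v, F v = (∫ x, g x ∂(volume : Measure (EuclideanSpace ℝ (Fin d))).toSphere) *
      ∫ r : Set.Ioi (0 : ℝ), h r ∂.volumeIoiPow (d - 1) := by
  have := nontrivial_euclidean hd
  calc
    ∫ v, F v = ∫ x : ({(0)}ᶜ : Set (EuclideanSpace ℝ (Fin d))), F x.1 ∂(volume.comap Subtype.val) := by
      rw [integral_subtype_comap (measurableSet_singleton _).compl F, restrict_compl_singleton]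
    _ = ∫ x, g x.1 * h x.2 ∂volume.toSphere.prod (.volumeIoiPow (d - 1)) := by
      have := (Measure.measurePreserving_homeomorphUnitSphereProd
        (volume : Measure (EuclideanSpace ℝ (Fin d)))).integral_comp
        (Homeomorph.measurableEmbedding _)
        (fun x : Sph d × Set.Ioi (0 : ℝ) => g x.1 * h x.2)
      rw [finrank_euclideanSpace, Fintype.card_fin] at this
      rw [← this]
      refine integral_congr_ae (Filter.Eventually.of_forall fun v => ?_)
      dsimp only
      rw [← hF _ _ (homeomorphUnitSphereProd _ v).2.2]
      congr 1
      conv_lhs => rw [← (homeomorphUnitSphereProd _).symm_apply_apply v]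
      have : ‖v.1‖ ≠ 0 := norm_ne_zero_iff.mpr v.2
      simp [smul_smul, this]
    _ = _ := integral_prod_mul (fun x => g x) (fun r : Set.Ioi (0 : ℝ) => h r)

/-- Up to a positive constant depending on the degree, the Gaussian integral of a homogeneous
polynomial is its mean on the sphere. -/
lemma exists_gaussInt_eq (hd : 1 ≤ d) (m : ℕ) : ∃ C : ℝ, 0 < C ∧
    ∀ p : MvPolynomial (Fin d) ℝ, p.IsHomogeneous m →
      gaussInt p = C * ∫ x, polyEval p x.1 ∂(unif d) := by
  -- The constant is the Gaussian integral of `‖v‖ ^ m`: surface area times radial factor, so the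
  -- normalization of `unif` cancels.
  refine ⟨_, integral_norm_pow_mul_exp_pos hd m, fun p hp => ?_⟩
  have hn : ∀ (x : Sph d) (r : ℝ), 0 < r → ‖r • x.1‖ = r := fun x r hr => by
    rw [norm_smul, Real.norm_eq_abs, abs_of_pos hr, norm_eq_of_mem_sphere, mul_one]
  rw [gaussInt, integral_polar hd (fun x => polyEval p x.1) (fun r => r ^ m * Real.exp (-r ^ 2 / 2)),
    integral_polar hd (fun _ => 1) (fun r => r ^ m * Real.exp (-r ^ 2 / 2)), unif_eq,
    integral_smul_measure]
  · have h0 := volume_toSphere_ne_zero hd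
    have h1 : (volume : Measure (EuclideanSpace ℝ (Fin d))).toSphere Set.univ ≠ ⊤ :=
      measure_ne_top _ _
    have := ENNReal.toReal_ne_zero.mpr ⟨h0, h1⟩
    simp only [integral_const, Measure.real, ENNReal.toReal_inv, smul_eq_mul]
    field_simp
  · intro x r hr
    rw [hn x r hr, one_mul]
  · intro x r hr
    rw [hn x r hr, polyEval_smul_of_isHomogeneous hp]
    ring
end

/-! ### Orthogonality and completeness of spherical harmonics -/

section
variable {d : ℕ}
open MvPolynomial

lemma polyLaplacian_apply (p : MvPolynomial (Fin d) ℝ) :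
    polyLaplacian d p = ∑ i, pderiv i (pderiv i p) := by
  simp [polyLaplacian]

/-- The commutator of two derivations is a derivation, and this one kills every variable. -/
lemma pderiv_pderiv_comm (i j : Fin d) (p : MvPolynomial (Fin d) ℝ) :
    pderiv i (pderiv j p) = pderiv j (pderiv i p) := by
  have h : ⁅(pderiv i : Derivation ℝ (MvPolynomial (Fin d) ℝ) (MvPolynomial (Fin d) ℝ)),
      pderiv j⁆ = 0 := derivation_ext fun k => by
    rw [Derivation.commutator_apply]
    simp [pderiv_X, Pi.single_apply, apply_ite]
  have := DFunLike.congr_fun h p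
  rw [Derivation.commutator_apply] at this
  exact sub_eq_zero.mp this

lemma polyLaplacian_pderiv (i : Fin d) (p : MvPolynomial (Fin d) ℝ) :
    polyLaplacian d (pderiv i p) = pderiv i (polyLaplacian d p) := by
  simp only [polyLaplacian_apply, map_sum]
  refine Finset.sum_congr rfl fun j _ => ?_
  rw [pderiv_pderiv_comm j i p, pderiv_pderiv_comm j i]

lemma isHomogeneous_polyLaplacian {p : MvPolynomial (Fin d) ℝ} {m : ℕ}
    (hp : p.IsHomogeneous (m + 2)) : (polyLaplacian d p).IsHomogeneous m := by
  rw [polyLaplacian_apply]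
  exact IsHomogeneous.sum _ _ _ fun i _ => (hp.pderiv).pderiv

/-- Euler's identity writes `k p` as `∑ X_i ∂_i p`, and Gaussian integration by parts removes each
factor `X_i`. -/
lemma gaussInt_euler {p : MvPolynomial (Fin d) ℝ} {k : ℕ} (hp : p.IsHomogeneous k)
    (q : MvPolynomial (Fin d) ℝ) :
    k * gaussInt (p * q) =
      gaussInt (polyLaplacian d p * q) + ∑ i, gaussInt (pderiv i p * pderiv i q) := by
  have h1 : (k : ℝ) • (p * q) = ∑ i, X i * (pderiv i p * q) := by
    rw [← smul_mul_assoc, Nat.cast_smul_eq_nsmul, ← hp.sum_X_mul_pderiv, Finset.sum_mul]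
    simp only [mul_assoc]
  rw [← gaussInt_smul, h1, gaussInt_sum]
  simp only [gaussInt_X_mul, Derivation.leibniz, smul_eq_mul]
  simp only [gaussInt_add, Finset.sum_add_distrib]
  rw [add_comm, polyLaplacian_apply, Finset.sum_mul, gaussInt_sum]
  simp only [mul_comm]

/-- When `p` is harmonic, `gaussInt_euler` reduces the pairing to pairings of first derivatives.
These are again harmonic and homogeneous, with both degrees lowered by one, and the descent stops at
a constant `q`. -/
lemma gaussInt_harmonic_mul_eq_zero (l : ℕ) : ∀ {k : ℕ} {p q : MvPolynomial (Fin d) ℝ},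
    l < k → p.IsHomogeneous k → polyLaplacian d p = 0 → q.IsHomogeneous l →
      gaussInt (p * q) = 0 := by
  induction l with
  | zero =>
    intro k p q hk hp hL hq
    rw [← totalDegree_zero_iff_isHomogeneous, totalDegree_eq_zero_iff_eq_C] at hq
    have h := gaussInt_euler hp q
    rw [hL, hq] at h
    have h0 : gaussInt (0 : MvPolynomial (Fin d) ℝ) = 0 := by simp [gaussInt]
    simp only [pderiv_C, mul_zero, zero_mul, h0, Finset.sum_const_zero, add_zero] at h
    rw [← hq] at h
    have : (k : ℝ) ≠ 0 := Nat.cast_ne_zero.mpr (by omega)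
    exact (mul_eq_zero.mp h).resolve_left this
  | succ l ih =>
    intro k p q hk hp hL hq
    have h := gaussInt_euler hp q
    have h0 : gaussInt (0 : MvPolynomial (Fin d) ℝ) = 0 := by simp [gaussInt]
    rw [hL, zero_mul, h0, zero_add, Finset.sum_eq_zero] at h
    · have : (k : ℝ) ≠ 0 := Nat.cast_ne_zero.mpr (by omega)
      exact (mul_eq_zero.mp h).resolve_left this
    · intro i _
      exact ih (by omega) hp.pderiv (by rw [polyLaplacian_pderiv, hL, map_zero]) hq.pderiv

lemma integral_harmonic_mul_eq_zero (hd : 1 ≤ d) {k l : ℕ} {p q : MvPolynomial (Fin d) ℝ}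
    (hkl : l < k) (hp : p.IsHomogeneous k) (hL : polyLaplacian d p = 0) (hq : q.IsHomogeneous l) :
    ∫ x, polyEval p x.1 * polyEval q x.1 ∂(unif d) = 0 := by
  obtain ⟨C, hC, h⟩ := exists_gaussInt_eq hd (k + l)
  have h1 := h _ (hp.mul hq)
  rw [gaussInt_harmonic_mul_eq_zero l hkl hp hL hq] at h1
  simp only [polyEval_mul] at h1
  exact (mul_eq_zero.mp h1.symm).resolve_left hC.ne'

/-- The squared norm as a polynomial. -/
def normSqPoly (d : ℕ) : MvPolynomial (Fin d) ℝ := ∑ i, X i ^ 2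

lemma isHomogeneous_normSqPoly : (normSqPoly d).IsHomogeneous 2 :=
  IsHomogeneous.sum _ _ _ fun i _ => isHomogeneous_X_pow i 2

lemma polyEval_normSqPoly (v : EuclideanSpace ℝ (Fin d)) :
    polyEval (normSqPoly d) v = ‖v‖ ^ 2 := by
  simp [normSqPoly, EuclideanSpace.norm_sq_eq]

lemma eq_zero_of_polyEval_sphere {p : MvPolynomial (Fin d) ℝ} {m : ℕ} (hd : 1 ≤ d)
    (hp : p.IsHomogeneous m) (h : ∀ x : Sph d, polyEval p x.1 = 0) : p = 0 := by
  refine hp.eq_zero_of_forall_eval_eq_zero fun r => ?_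
  have key : ∀ v : EuclideanSpace ℝ (Fin d), v ≠ 0 → polyEval p v = 0 := fun v hv => by
    have hn : ‖v‖ ≠ 0 := norm_ne_zero_iff.mpr hv
    have := polyEval_smul_of_isHomogeneous hp ‖v‖ (‖v‖⁻¹ • v)
    rw [smul_smul, mul_inv_cancel₀ hn, one_smul] at this
    rw [this, h ⟨‖v‖⁻¹ • v, by simp [norm_smul, hn]⟩, mul_zero]
  have hz : polyEval p = 0 := by
    have := nontrivial_euclidean hd
    refine (continuous_polyEval p).ext_on (dense_compl_singleton 0) continuous_zero fun v hv => ?_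
    exact key v hv
  exact congrFun hz (WithLp.toLp 2 r)

/-- A harmonic `‖x‖² q` of degree `m + 2` is orthogonal to `q`, of degree `m`. On the sphere the
factor `‖x‖²` is 1, so `∫ q² = 0`. -/
lemma eq_zero_of_polyLaplacian_normSq_mul {q : MvPolynomial (Fin d) ℝ} {m : ℕ} (hd : 1 ≤ d)
    (hq : q.IsHomogeneous m) (h : polyLaplacian d (normSqPoly d * q) = 0) : q = 0 := by
  have := isProbabilityMeasure_unif hd
  have := isOpenPosMeasure_unif (d := d)
  have h0 := integral_harmonic_mul_eq_zero hd (by omega) (isHomogeneous_normSqPoly.mul hq) h hq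
  simp only [polyEval_mul, polyEval_normSqPoly, norm_eq_of_mem_sphere, one_pow, one_mul] at h0
  refine eq_zero_of_polyEval_sphere hd hq fun x => ?_
  by_contra hx
  have hc : Continuous fun x : Sph d => polyEval q x.1 :=
    (continuous_polyEval q).comp continuous_subtype_val
  refine (integral_pos_of_integrable_nonneg_nonzero (μ := unif d) (x := x) (hc.mul hc)
    ?_ (fun y => mul_self_nonneg _) (mul_self_ne_zero.mpr hx)).ne' h0
  exact (hc.mul hc).integrable_of_hasCompactSupport (HasCompactSupport.of_compactSpace _)

/-- Every homogeneous polynomial is harmonic up to a multiple of the squared norm. -/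
lemma exists_harmonic_decomposition {p : MvPolynomial (Fin d) ℝ} {m : ℕ} (hd : 1 ≤ d)
    (hp : p.IsHomogeneous (m + 2)) : ∃ q : MvPolynomial (Fin d) ℝ, q.IsHomogeneous m ∧
      polyLaplacian d (p - normSqPoly d * q) = 0 := by
  have hfin : FiniteDimensional ℝ (homogeneousSubmodule (Fin d) ℝ m) :=
    Module.Finite.iff_fg.mpr (homogeneousSubmodule_fg (Fin d) ℝ m)
  -- `q ↦ Δ(‖x‖² q)` is an injective endomorphism of a finite-dimensional space, hence onto; the
  -- preimage of `Δp` is the required `q`.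
  let T : homogeneousSubmodule (Fin d) ℝ m →ₗ[ℝ] homogeneousSubmodule (Fin d) ℝ m :=
    LinearMap.restrict (polyLaplacian d ∘ₗ LinearMap.mulLeft ℝ (normSqPoly d)) fun q hq => by
      rw [mem_homogeneousSubmodule] at hq ⊢
      refine isHomogeneous_polyLaplacian ?_
      rw [add_comm]
      exact isHomogeneous_normSqPoly.mul hq
  have hinj : Function.Injective T := by
    rw [← LinearMap.ker_eq_bot, LinearMap.ker_eq_bot']
    rintro ⟨q, hq⟩ h
    exact Subtype.ext (eq_zero_of_polyLaplacian_normSq_mul hd hq (congrArg Subtype.val h))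
  obtain ⟨⟨q, hq⟩, h⟩ := LinearMap.injective_iff_surjective.mp hinj
    ⟨polyLaplacian d p, isHomogeneous_polyLaplacian hp⟩
  refine ⟨q, hq, ?_⟩
  have h1 : polyLaplacian d (normSqPoly d * q) = polyLaplacian d p := congrArg Subtype.val h
  rw [map_sub, h1, sub_self]

lemma mem_harm_iff {k : ℕ} {g : C(Sph d, ℝ)} : g ∈ harm d k ↔
    ∃ p : MvPolynomial (Fin d) ℝ, p.IsHomogeneous k ∧ polyLaplacian d p = 0 ∧
      restrictSph d p = g := by
  simp [harm, and_assoc]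

lemma harm_le_harmLE {l k : ℕ} (h : l ≤ k) : harm d l ≤ harmLE d k :=
  le_iSup₂_of_le l (Finset.mem_range.mpr (by omega)) le_rfl

lemma harmLE_mono {l k : ℕ} (h : l ≤ k) : harmLE d l ≤ harmLE d k :=
  iSup₂_le fun j hj => harm_le_harmLE (by have := Finset.mem_range.mp hj; omega)

/-- Splitting off the harmonic part leaves `‖x‖² q`, which restricts to the same function as `q`,
two degrees lower. Degrees 0 and 1 are harmonic outright. -/
lemma restrictSph_mem_harmLE (hd : 1 ≤ d) (m : ℕ) : ∀ {p : MvPolynomial (Fin d) ℝ},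
    p.IsHomogeneous m → restrictSph d p ∈ harmLE d m := by
  induction m using Nat.strong_induction_on with
  | _ m ih =>
    intro p hp
    rcases Nat.lt_or_ge m 2 with hm | hm
    · refine harm_le_harmLE le_rfl (mem_harm_iff.mpr ⟨p, hp, ?_, rfl⟩)
      rw [polyLaplacian_apply]
      refine Finset.sum_eq_zero fun i _ => ?_
      have h1 : (pderiv i p).IsHomogeneous 0 := by
        have := hp.pderiv (i := i)
        rwa [show m - 1 = 0 by omega] at this
      rw [← totalDegree_zero_iff_isHomogeneous, totalDegree_eq_zero_iff_eq_C] at h1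
      rw [h1, pderiv_C]
    · obtain ⟨n, rfl⟩ := Nat.exists_eq_add_of_le' hm
      obtain ⟨q, hq, h⟩ := exists_harmonic_decomposition hd hp
      have e : restrictSph d p = restrictSph d (p - normSqPoly d * q) + restrictSph d q := by
        ext x
        simp [restrictSph_apply, polyEval_normSqPoly]
      rw [e]
      refine add_mem (harm_le_harmLE le_rfl (mem_harm_iff.mpr ⟨_, ?_, h, rfl⟩))
        (harmLE_mono (by omega) (ih n (by omega) hq))
      refine hp.sub ?_
      rw [add_comm]
      exact isHomogeneous_normSqPoly.mul hq

lemma integral_harm_mul_eq_zero (hd : 1 ≤ d) {k l : ℕ} (hkl : k ≠ l) {g h : C(Sph d, ℝ)}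
    (hg : g ∈ harm d k) (hh : h ∈ harm d l) : ∫ x, g x * h x ∂(unif d) = 0 := by
  obtain ⟨p, hp, hpL, rfl⟩ := mem_harm_iff.mp hg
  obtain ⟨q, hq, hqL, rfl⟩ := mem_harm_iff.mp hh
  rcases lt_or_gt_of_ne hkl with h | h
  · simpa only [restrictSph_apply, mul_comm] using integral_harmonic_mul_eq_zero hd h hq hqL hp
  · exact integral_harmonic_mul_eq_zero hd h hp hpL hq

lemma continuous_integrable_unif (g : C(Sph d, ℝ)) : Integrable g (unif d) :=
  g.continuous.integrable_of_hasCompactSupport (HasCompactSupport.of_compactSpace _)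

/-- Restrictions of polynomials are dense in the continuous functions on the sphere. -/
lemma dense_range_restrictSph (g : C(Sph d, ℝ)) {ε : ℝ} (hε : 0 < ε) :
    ∃ p : MvPolynomial (Fin d) ℝ, ∀ x, |restrictSph d p x - g x| < ε := by
  let A : Subalgebra ℝ C(Sph d, ℝ) :=
    { (LinearMap.range (restrictSph d)) with
      mul_mem' := by
        rintro _ _ ⟨p, rfl⟩ ⟨q, rfl⟩
        exact ⟨p * q, by ext x; simp [restrictSph_apply]⟩
      algebraMap_mem' := fun r => ⟨C r, by ext x; simp [restrictSph_apply]⟩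
      one_mem' := ⟨1, by ext x; simp [restrictSph_apply]⟩ }
  have hA : A.SeparatesPoints := by
    intro x y hxy
    obtain ⟨i, hi⟩ : ∃ i, x.1 i ≠ y.1 i := by
      by_contra! hcon
      exact hxy (Subtype.ext (PiLp.ext hcon))
    exact ⟨_, ⟨_, ⟨X i, rfl⟩, rfl⟩, by simpa [restrictSph_apply] using hi⟩
  obtain ⟨⟨_, p, rfl⟩, hp⟩ := ContinuousMap.exists_mem_subalgebra_near_continuousMap_of_separatesPoints
    A hA g ε hε
  refine ⟨p, fun x => ?_⟩
  exact (ContinuousMap.norm_coe_le_norm (restrictSph d p - g) x).trans_lt hp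

/-- A square integrable function orthogonal to all spherical harmonics vanishes. -/
lemma ae_eq_zero_of_forall_harm (hd : 1 ≤ d) {u : Sph d → ℝ} (hu : MemLp u 2 (unif d))
    (h : ∀ k, ∀ g ∈ harm d k, ∫ x, u x * g x ∂(unif d) = 0) : u =ᵐ[unif d] 0 := by
  have := isProbabilityMeasure_unif hd
  have hu1 : Integrable u (unif d) := hu.integrable (by norm_num)
  have hmul : ∀ g : C(Sph d, ℝ), Integrable (fun x => u x * g x) (unif d) := fun g => by
    refine hu1.mul_bdd (c := ‖g‖) g.continuous.aestronglyMeasurable ?_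
    exact Filter.Eventually.of_forall fun x => ContinuousMap.norm_coe_le_norm g x
  have h1 : ∀ k, ∀ g ∈ harmLE d k, ∫ x, u x * g x ∂(unif d) = 0 := by
    intro k g hg
    have hle : harmLE d k ≤
        { carrier := {g : C(Sph d, ℝ) | ∫ x, u x * g x ∂(unif d) = 0}
          add_mem' := fun {a b} ha hb => by
            simp only [Set.mem_ofPred_eq, ContinuousMap.add_apply, mul_add] at *
            rw [integral_add (hmul a) (hmul b), ha, hb, add_zero]
          zero_mem' := by simp
          smul_mem' := fun c a ha => by
            simp only [Set.mem_ofPred_eq, ContinuousMap.smul_apply, smul_eq_mul,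
              mul_left_comm _ c] at *
            rw [integral_const_mul, ha, mul_zero] : Submodule ℝ C(Sph d, ℝ)} :=
      iSup₂_le fun l _ g hg => h l g hg
    exact hle hg
  have h2 : ∀ p : MvPolynomial (Fin d) ℝ, ∫ x, u x * restrictSph d p x ∂(unif d) = 0 := by
    intro p
    have e : (fun x => u x * restrictSph d p x) = fun x => ∑ i ∈ Finset.range (p.totalDegree + 1),
        u x * restrictSph d (homogeneousComponent i p) x := by
      ext x
      rw [← Finset.mul_sum, restrictSph_apply]
      conv_lhs => rw [← sum_homogeneousComponent p]
      simp [restrictSph_apply]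
    rw [e, integral_finsetSum _ fun i _ => hmul _]
    exact Finset.sum_eq_zero fun i _ =>
      h1 i _ (restrictSph_mem_harmLE hd i (homogeneousComponent_isHomogeneous i p))
  have h3 : ∀ g : C(Sph d, ℝ), ∫ x, u x * g x ∂(unif d) = 0 := by
    intro g
    refine abs_eq_zero.mp (le_antisymm (le_of_forall_pos_le_add fun ε hε => ?_) (abs_nonneg _))
    set K := ∫ x, |u x| ∂(unif d)
    have hK : 0 ≤ K := integral_nonneg fun x => abs_nonneg _
    obtain ⟨p, hp⟩ := dense_range_restrictSph g (ε := ε / (K + 1)) (by positivity)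
    have e : ∫ x, u x * g x ∂(unif d) = ∫ x, u x * (g - restrictSph d p) x ∂(unif d) := by
      have : (fun x => u x * (g - restrictSph d p) x) =
          fun x => u x * g x - u x * restrictSph d p x := by
        ext x; simp [mul_sub]
      rw [this, integral_sub (hmul _) (hmul _), h2, sub_zero]
    rw [e, zero_add]
    calc |∫ x, u x * (g - restrictSph d p) x ∂(unif d)|
        ≤ ∫ x, |u x * (g - restrictSph d p) x| ∂(unif d) := abs_integral_le_integral_abs
      _ ≤ ∫ x, |u x| * (ε / (K + 1)) ∂(unif d) := by
          refine integral_mono (hmul _).abs (hu1.abs.mul_const _) fun x => ?_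
          simp only [abs_mul]
          refine mul_le_mul_of_nonneg_left ?_ (abs_nonneg _)
          rw [← abs_neg]
          simpa using (hp x).le
      _ = K * (ε / (K + 1)) := integral_mul_const _ _
      _ ≤ ε := by
          rw [mul_div_assoc', div_le_iff₀ (by positivity)]
          nlinarith
  have hU : hu.toLp u = 0 := by
    refine (ContinuousMap.toLp_denseRange ℝ (unif d) ℝ (p := 2)
      (by norm_num)).eq_zero_of_inner_left ℝ fun g => ?_
    rw [L2.inner_def, ← h3 g]
    refine integral_congr_ae ?_
    filter_upwards [hu.coeFn_toLp, ContinuousMap.coeFn_toLp (p := 2) (𝕜 := ℝ) (unif d) g]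
      with x h1 h2
    rw [h1, h2]
    simp [mul_comm]
  have h4 := hu.coeFn_toLp
  rw [hU] at h4
  exact h4.symm.trans (Lp.coeFn_zero _ _ _)
end

/-! ### Zonal harmonics -/

section
variable {d : ℕ}
open MvPolynomial

/-- The linear form `y ↦ ⟨x, y⟩` as a polynomial. -/
def linForm (x : EuclideanSpace ℝ (Fin d)) : MvPolynomial (Fin d) ℝ := ∑ i, x i • X i

/-- The homogeneous polynomial `‖y‖ ^ k P_k(⟨x, y⟩ / ‖y‖)`. -/
def zonalPoly (x : EuclideanSpace ℝ (Fin d)) : ℕ → MvPolynomial (Fin d) ℝ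
  | 0 => 1
  | 1 => linForm x
  | k + 2 =>
      ((2 * ((k + 2 : ℕ) : ℝ) + d - 4) / (((k + 2 : ℕ) : ℝ) + d - 3)) •
          (linForm x * zonalPoly x (k + 1))
        - ((((k + 2 : ℕ) : ℝ) - 1) / (((k + 2 : ℕ) : ℝ) + d - 3)) •
          (normSqPoly d * zonalPoly x k)

/-- The derivative of a polynomial in the direction `x`. -/
def dirDeriv (x : EuclideanSpace ℝ (Fin d)) :
    Derivation ℝ (MvPolynomial (Fin d) ℝ) (MvPolynomial (Fin d) ℝ) := ∑ i, x i • pderiv i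

lemma dirDeriv_apply (x : EuclideanSpace ℝ (Fin d)) (p : MvPolynomial (Fin d) ℝ) :
    dirDeriv x p = ∑ i, x i • pderiv i p := by
  rw [dirDeriv, ← Derivation.coeFnAddMonoidHom_apply, map_sum, Finset.sum_apply]
  simp [Derivation.coeFnAddMonoidHom_apply]

lemma two_eq_C : (2 : MvPolynomial (Fin d) ℝ) = C 2 := (map_ofNat C 2).symm

lemma pderiv_linForm (x : EuclideanSpace ℝ (Fin d)) (i : Fin d) :
    pderiv i (linForm x) = C (x i) := by
  simp [linForm, pderiv_X, Pi.single_apply, smul_eq_C_mul]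

lemma pderiv_normSqPoly (i : Fin d) : pderiv i (normSqPoly d) = 2 * X i := by
  simp [normSqPoly, Derivation.leibniz_pow, pderiv_X, Pi.single_apply]

lemma isHomogeneous_linForm (x : EuclideanSpace ℝ (Fin d)) : (linForm x).IsHomogeneous 1 := by
  refine IsHomogeneous.sum _ _ _ fun i _ => ?_
  rw [smul_eq_C_mul]
  exact isHomogeneous_C_mul_X _ _

lemma isHomogeneous_smul {p : MvPolynomial (Fin d) ℝ} {m : ℕ} (hp : p.IsHomogeneous m) (a : ℝ) :
    (a • p).IsHomogeneous m := by
  rw [smul_eq_C_mul]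
  exact hp.C_mul a

lemma isHomogeneous_zonalPoly (x : EuclideanSpace ℝ (Fin d)) : ∀ k : ℕ,
    (zonalPoly x k).IsHomogeneous k
  | 0 => isHomogeneous_one _ _
  | 1 => isHomogeneous_linForm x
  | k + 2 => by
    rw [zonalPoly]
    refine (isHomogeneous_smul ?_ _).sub (isHomogeneous_smul ?_ _)
    · have := (isHomogeneous_linForm x).mul (isHomogeneous_zonalPoly x (k + 1))
      rwa [show 1 + (k + 1) = k + 2 by ring] at this
    · have := (isHomogeneous_normSqPoly (d := d)).mul (isHomogeneous_zonalPoly x k)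
      rwa [add_comm] at this

lemma dirDeriv_linForm {x : EuclideanSpace ℝ (Fin d)} (hx : ‖x‖ = 1) :
    dirDeriv x (linForm x) = 1 := by
  have h : ∑ i, x i * x i = 1 := by
    have := EuclideanSpace.real_norm_sq_eq x
    rw [hx, one_pow] at this
    rw [this]; simp [sq]
  rw [dirDeriv_apply]
  simp only [pderiv_linForm, smul_eq_C_mul, ← C_mul]
  rw [← map_sum, h, C_1]

lemma dirDeriv_normSqPoly (x : EuclideanSpace ℝ (Fin d)) :
    dirDeriv x (normSqPoly d) = 2 * linForm x := by
  simp only [dirDeriv_apply, pderiv_normSqPoly, linForm, Finset.mul_sum, mul_smul_comm]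

lemma polyLaplacian_mul (p q : MvPolynomial (Fin d) ℝ) :
    polyLaplacian d (p * q) = polyLaplacian d p * q + 2 * ∑ i, pderiv i p * pderiv i q
      + p * polyLaplacian d q := by
  simp only [polyLaplacian_apply, Derivation.leibniz, smul_eq_mul, map_add, Finset.sum_add_distrib,
    Finset.sum_mul, Finset.mul_sum, two_mul]
  simp only [mul_comm]
  ring

lemma polyLaplacian_linForm_mul (x : EuclideanSpace ℝ (Fin d)) (p : MvPolynomial (Fin d) ℝ) :
    polyLaplacian d (linForm x * p) = 2 * dirDeriv x p + linForm x * polyLaplacian d p := by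
  rw [polyLaplacian_mul, polyLaplacian_apply (linForm x)]
  simp only [pderiv_linForm, pderiv_C, Finset.sum_const_zero, zero_mul, zero_add, dirDeriv_apply,
    smul_eq_C_mul]

lemma polyLaplacian_normSqPoly_mul {p : MvPolynomial (Fin d) ℝ} {k : ℕ} (hp : p.IsHomogeneous k) :
    polyLaplacian d (normSqPoly d * p) =
      (2 * d + 4 * k : ℝ) • p + normSqPoly d * polyLaplacian d p := by
  rw [polyLaplacian_mul, polyLaplacian_apply (normSqPoly d)]
  have h1 : ∑ i : Fin d, pderiv i (pderiv i (normSqPoly d)) =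
      C (2 * d : ℝ) := by
    simp [pderiv_normSqPoly, two_eq_C, mul_comm]
  have h3 : ∑ i, pderiv i (normSqPoly d) * pderiv i p = C (2 * k : ℝ) * p := by
    simp only [pderiv_normSqPoly, mul_assoc, ← Finset.mul_sum, hp.sum_X_mul_pderiv]
    rw [C_mul, nsmul_eq_mul, ← mul_assoc, two_eq_C, map_natCast]
  rw [h1, h3, smul_eq_C_mul, C_add, show (4 * k : ℝ) = 2 * (2 * k) by ring, C_mul (a := 2) (a' := 2 * (k : ℝ))]
  rw [← two_eq_C]
  ring

lemma zonalPoly_add_two (x : EuclideanSpace ℝ (Fin d)) (k : ℕ) :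
    zonalPoly x (k + 2) =
      ((2 * k + d : ℝ) / (k + d - 1)) • (linForm x * zonalPoly x (k + 1))
        - ((k + 1 : ℝ) / (k + d - 1)) • (normSqPoly d * zonalPoly x k) := by
  rw [zonalPoly]
  congr 2 <;> push_cast <;> ring

lemma legendreP_add_two (k : ℕ) (t : ℝ) :
    legendreP d (k + 2) t = (2 * k + d : ℝ) / (k + d - 1) * t * legendreP d (k + 1) t
        - (k + 1 : ℝ) / (k + d - 1) * legendreP d k t := by
  rw [legendreP]
  push_cast
  ring_nf

/-- This evaluates the cross term `2 ∂_x Z` that appears in the Laplacian of `⟨x, y⟩ Z`. -/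
lemma dirDeriv_zonalPoly (hd : 3 ≤ d) {x : EuclideanSpace ℝ (Fin d)} (hx : ‖x‖ = 1) : ∀ k : ℕ,
    dirDeriv x (zonalPoly x (k + 1)) = ((k : ℝ) + 1) • zonalPoly x k
  | 0 => by simp [zonalPoly, dirDeriv_linForm hx]
  | 1 => by
    have hd' : (3 : ℝ) ≤ d := by exact_mod_cast hd
    have h1 : (d : ℝ) - 1 ≠ 0 := by linarith
    rw [zonalPoly_add_two, map_sub, Derivation.map_smul, Derivation.map_smul]
    simp only [zonalPoly, Derivation.leibniz, smul_eq_mul, zero_add, mul_one,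
      dirDeriv_linForm hx, dirDeriv_normSqPoly, Nat.cast_zero, Nat.cast_one, mul_zero]
    refine MvPolynomial.funext fun v => ?_
    simp only [map_add, map_sub, smul_eval, map_mul, two_eq_C, eval_C]
    field_simp
    ring
  | k + 2 => by
    have ih1 := dirDeriv_zonalPoly hd hx (k + 1)
    have ih0 := dirDeriv_zonalPoly hd hx k
    have hd' : (3 : ℝ) ≤ d := by exact_mod_cast hd
    have hk : (0 : ℝ) ≤ k := Nat.cast_nonneg k
    have h1 : (k : ℝ) + d ≠ 0 := by linarith
    have h2 : (k : ℝ) + d - 1 ≠ 0 := by linarith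
    rw [zonalPoly_add_two x (k + 1), map_sub, Derivation.map_smul, Derivation.map_smul]
    simp only [Derivation.leibniz, smul_eq_mul, dirDeriv_linForm hx, dirDeriv_normSqPoly, ih1, ih0,
      mul_one]
    rw [show k + 1 + 1 = k + 2 from rfl, zonalPoly_add_two x k]
    refine MvPolynomial.funext fun v => ?_
    simp only [map_add, map_sub, smul_eval, map_mul, two_eq_C, eval_C]
    push_cast
    rw [show (k : ℝ) + 1 + d - 1 = k + d by ring]
    field_simp
    ring

/-- In the recursion the first product contributes `2 (2k + d)(k + 1) Z_k` and the second `(k +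
1)(2d + 4k) Z_k`, over the same denominator, and these cancel. -/
lemma polyLaplacian_zonalPoly (hd : 3 ≤ d) {x : EuclideanSpace ℝ (Fin d)} (hx : ‖x‖ = 1) :
    ∀ k : ℕ, polyLaplacian d (zonalPoly x k) = 0
  | 0 => by simp [zonalPoly, polyLaplacian_apply]
  | 1 => by simp [zonalPoly, polyLaplacian_apply, pderiv_linForm]
  | k + 2 => by
    have hd' : (3 : ℝ) ≤ d := by exact_mod_cast hd
    have hk : (0 : ℝ) ≤ k := Nat.cast_nonneg k
    have h2 : (k : ℝ) + d - 1 ≠ 0 := by linarith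
    rw [zonalPoly_add_two, map_sub, map_smul, map_smul, polyLaplacian_linForm_mul,
      polyLaplacian_normSqPoly_mul (isHomogeneous_zonalPoly x k), polyLaplacian_zonalPoly hd hx k,
      polyLaplacian_zonalPoly hd hx (k + 1), dirDeriv_zonalPoly hd hx]
    refine MvPolynomial.funext fun v => ?_
    simp only [map_add, map_sub, smul_eval, map_mul, two_eq_C, eval_C, map_zero]
    field_simp
    ring

lemma polyEval_linForm (x y : EuclideanSpace ℝ (Fin d)) :
    polyEval (linForm x) y = inner ℝ x y := by
  simp [linForm, PiLp.inner_apply, mul_comm]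

lemma polyEval_zonalPoly (x : EuclideanSpace ℝ (Fin d)) (y : Sph d) : ∀ k : ℕ,
    polyEval (zonalPoly x k) y.1 = legendreP d k (inner ℝ x y.1)
  | 0 => by simp [zonalPoly, legendreP]
  | 1 => by simp [zonalPoly, legendreP, polyEval_linForm]
  | k + 2 => by
    rw [zonalPoly_add_two, legendreP_add_two]
    simp only [polyEval_sub, polyEval_smul, polyEval_mul, polyEval_linForm, polyEval_normSqPoly,
      polyEval_zonalPoly x y k, polyEval_zonalPoly x y (k + 1), norm_eq_of_mem_sphere]
    ring

lemma continuous_legendreP : ∀ k : ℕ, Continuous (legendreP d k)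
  | 0 => by
    have : legendreP d 0 = fun _ => 1 := by ext t; simp [legendreP]
    rw [this]; exact continuous_const
  | 1 => by
    have : legendreP d 1 = fun t => t := by ext t; simp [legendreP]
    rw [this]; exact continuous_id
  | k + 2 => by
    have h0 := continuous_legendreP k
    have h1 := continuous_legendreP (k + 1)
    have : legendreP d (k + 2) = fun t => (2 * k + d : ℝ) / (k + d - 1) * t * legendreP d (k + 1) t
        - (k + 1 : ℝ) / (k + d - 1) * legendreP d k t := by
      ext t; exact legendreP_add_two k t
    rw [this]
    fun_prop

lemma legendreP_one (hd : 3 ≤ d) : ∀ k : ℕ, legendreP d k 1 = 1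
  | 0 => by simp [legendreP]
  | 1 => by simp [legendreP]
  | k + 2 => by
    have hd' : (3 : ℝ) ≤ d := by exact_mod_cast hd
    have hk : (0 : ℝ) ≤ k := Nat.cast_nonneg k
    have h2 : (k : ℝ) + d - 1 ≠ 0 := by linarith
    rw [legendreP_add_two, legendreP_one hd k, legendreP_one hd (k + 1)]
    field_simp
    ring

/-- The zonal function `y ↦ P_k(⟨x, y⟩)`. -/
def zonal (d k : ℕ) (x : Sph d) : C(Sph d, ℝ) :=
  ⟨fun y => legendreP d k (inner ℝ x.1 y.1), (continuous_legendreP k).comp (by fun_prop)⟩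

lemma zonal_apply (k : ℕ) (x y : Sph d) : zonal d k x y = legendreP d k (inner ℝ x.1 y.1) := rfl

lemma zonal_self (hd : 3 ≤ d) (k : ℕ) (x : Sph d) : zonal d k x x = 1 := by
  rw [zonal_apply, real_inner_self_eq_norm_sq, norm_eq_of_mem_sphere, one_pow, legendreP_one hd]

lemma zonal_mem_harm (hd : 3 ≤ d) (k : ℕ) (x : Sph d) : zonal d k x ∈ harm d k := by
  refine mem_harm_iff.mpr ⟨zonalPoly x.1 k, isHomogeneous_zonalPoly _ k,
    polyLaplacian_zonalPoly hd (norm_eq_of_mem_sphere x) k, ?_⟩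
  ext y
  exact polyEval_zonalPoly x.1 y k

lemma abs_inner_sphere_le (x y : Sph d) : |inner ℝ x.1 y.1| ≤ 1 := by
  have := abs_real_inner_le_norm x.1 y.1
  rwa [norm_eq_of_mem_sphere, norm_eq_of_mem_sphere, one_mul] at this

end

/-! ### The dimensions `N_{k,d}` -/

lemma dimN_add_three (e k : ℕ) : dimN k (e + 3) = (e + 1 + k).choose (e + 1) + (e + k).choose (e + 1) := by
  unfold dimN
  rw [show e + 3 + k - 1 = (e + 1 + k) + 1 by omega, show e + 3 - 1 = (e + 1) + 1 by omega,
    show e + 3 + k - 3 = e + k by omega, Nat.choose_succ_succ, show e + 1 + k = (e + k) + 1 by omega,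
    Nat.choose_succ_succ (e + k) (e + 1)]
  simp only [Nat.succ_eq_add_one]
  omega

lemma succ_mul_dimN (e k : ℕ) : (e + 1) * dimN k (e + 3) = (2 * k + e + 1) * (e + k).choose e := by
  have h1 := Nat.add_one_mul_choose_eq (e + k) e
  have h2 := Nat.choose_succ_right_eq (e + k) e
  rw [show e + k - e = k by omega] at h2
  rw [dimN_add_three, mul_add, show e + 1 + k = e + k + 1 by omega, mul_comm (e + 1), ← h1,
    mul_comm (e + 1), h2]
  ring

lemma dimN_zero {d : ℕ} (hd : 3 ≤ d) : dimN 0 d = 1 := by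
  obtain ⟨e, rfl⟩ := Nat.exists_eq_add_of_le' hd
  rw [dimN_add_three]
  simp

lemma dimN_pos {d : ℕ} (hd : 3 ≤ d) (k : ℕ) : 0 < dimN k d := by
  obtain ⟨e, rfl⟩ := Nat.exists_eq_add_of_le' hd
  rw [dimN_add_three]
  have := Nat.choose_pos (show e + 1 ≤ e + 1 + k by omega)
  omega

/-- The ratio is the reciprocal of the one for squared norms of zonal functions in
`integral_zonal_succ_sq`. This is how `N_k` enters the analysis, with no count of the dimension of
the harmonics. -/
lemma dimN_succ {d : ℕ} (hd : 3 ≤ d) (k : ℕ) :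
    ((k : ℝ) + 1) * (2 * k + d - 2) * dimN (k + 1) d = (2 * k + d) * (k + d - 2) * dimN k d := by
  obtain ⟨e, rfl⟩ := Nat.exists_eq_add_of_le' hd
  have h1 : ((e : ℝ) + 1) * dimN k (e + 3) = (2 * k + e + 1) * (e + k).choose e := by
    exact_mod_cast succ_mul_dimN e k
  have h2 : ((e : ℝ) + 1) * dimN (k + 1) (e + 3) = (2 * (k + 1) + e + 1) * (e + (k + 1)).choose e := by
    exact_mod_cast succ_mul_dimN e (k + 1)
  have h3 : ((e + (k + 1)).choose e : ℝ) * (k + 1) = (e + k).choose e * (e + k + 1) := by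
    have := Nat.choose_mul_succ_eq (e + k) e
    rw [show e + k + 1 - e = k + 1 by omega] at this
    rw [← add_assoc]
    exact_mod_cast this.symm
  have he : (e : ℝ) + 1 ≠ 0 := by positivity
  refine mul_left_cancel₀ he ?_
  push_cast
  linear_combination (↑k + 1) * (2 * ↑k + ↑e + 1) * h2 - (2 * k + e + 3) * (k + e + 1) * h1 +
    (2 * k + e + 1) * (2 * k + e + 3) * h3

/-! ### Zonal harmonics as reproducing kernels -/

section
variable {d : ℕ}

lemma integrable_coe_mul (f g : C(Sph d, ℝ)) : Integrable (fun y => f y * g y) (unif d) :=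
  continuous_integrable_unif (f * g)

/-- The function `y ↦ ⟨x, y⟩` on the sphere. -/
def innerMap (x : Sph d) : C(Sph d, ℝ) := ⟨fun y => inner ℝ x.1 y.1, by fun_prop⟩

lemma innerMap_apply (x y : Sph d) : innerMap x y = inner ℝ x.1 y.1 := rfl

lemma innerMap_mem_Icc (x y : Sph d) : innerMap x y ∈ Set.Icc (-1 : ℝ) 1 :=
  abs_le.mp (abs_inner_sphere_le x y)

lemma zonal_zero_apply (x y : Sph d) : zonal d 0 x y = 1 := by simp [zonal_apply, legendreP]

lemma innerMap_mul_zonal_zero (x : Sph d) : innerMap x * zonal d 0 x = zonal d 1 x := by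
  ext y; simp [zonal_apply, legendreP, innerMap_apply]

lemma innerMap_mul_zonal_succ (hd : 3 ≤ d) (x : Sph d) (k : ℕ) :
    innerMap x * zonal d (k + 1) x = ((k + d - 1 : ℝ) / (2 * k + d)) • zonal d (k + 2) x +
      ((k + 1 : ℝ) / (2 * k + d)) • zonal d k x := by
  have hd' : (3 : ℝ) ≤ d := by exact_mod_cast hd
  have hk : (0 : ℝ) ≤ k := Nat.cast_nonneg k
  have h2 : (k : ℝ) + d - 1 ≠ 0 := by linarith
  have h1 : 2 * (k : ℝ) + d ≠ 0 := by linarith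
  ext y
  simp only [ContinuousMap.mul_apply, ContinuousMap.add_apply, ContinuousMap.smul_apply,
    smul_eq_mul, zonal_apply, innerMap_apply, legendreP_add_two]
  field_simp
  ring

lemma integral_innerMap_mul_zonal (hd : 3 ≤ d) (x : Sph d) (k : ℕ) :
    ∫ y, innerMap x y * (zonal d k x y * zonal d (k + 1) x y) ∂(unif d) =
      (k + 1 : ℝ) / (2 * k + d) * ∫ y, zonal d k x y * zonal d k x y ∂(unif d) := by
  have e : ∀ y, innerMap x y * (zonal d k x y * zonal d (k + 1) x y) =
      (k + d - 1 : ℝ) / (2 * k + d) * (zonal d (k + 2) x y * zonal d k x y) +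
      (k + 1 : ℝ) / (2 * k + d) * (zonal d k x y * zonal d k x y) := fun y => by
    have := DFunLike.congr_fun (innerMap_mul_zonal_succ hd x k) y
    simp only [ContinuousMap.mul_apply, ContinuousMap.add_apply, ContinuousMap.smul_apply,
      smul_eq_mul] at this
    linear_combination zonal d k x y * this
  simp only [e]
  rw [integral_add ((integrable_coe_mul _ _).const_mul _) ((integrable_coe_mul _ _).const_mul _),
    integral_const_mul, integral_const_mul, integral_harm_mul_eq_zero (by omega) (by omega)
      (zonal_mem_harm hd (k + 2) x) (zonal_mem_harm hd k x)]
  ring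

/-- Compute `∫ t Z_k Z_{k+1}` in two ways: the recursion applied to `t Z_{k+1}` leaves a multiple of
`∫ Z_k²`, and applied to `t Z_k` a multiple of `∫ Z_{k+1}²`. -/
lemma integral_zonal_succ_sq (hd : 3 ≤ d) (x : Sph d) (k : ℕ) :
    (2 * k + d) * (k + d - 2) * ∫ y, zonal d (k + 1) x y * zonal d (k + 1) x y ∂(unif d) =
      (k + 1) * (2 * k + d - 2) * ∫ y, zonal d k x y * zonal d k x y ∂(unif d) := by
  have hd' : (3 : ℝ) ≤ d := by exact_mod_cast hd
  have h := integral_innerMap_mul_zonal hd x k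
  rcases k with _ | k
  · have e : ∀ y, innerMap x y * (zonal d 0 x y * zonal d (0 + 1) x y) =
        zonal d (0 + 1) x y * zonal d (0 + 1) x y := fun y => by
      rw [← mul_assoc]
      exact congrArg (· * _) (DFunLike.congr_fun (innerMap_mul_zonal_zero x) y)
    simp only [e] at h
    rw [h]
    have h1 : (d : ℝ) ≠ 0 := by linarith
    push_cast
    simp only [mul_zero, zero_add]
    field_simp
  · have hk : (0 : ℝ) ≤ k := Nat.cast_nonneg k
    have h1 : 2 * (k : ℝ) + d ≠ 0 := by linarith
    have h3 : 2 * (k + 1 : ℝ) + d ≠ 0 := by linarith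
    have h2 : (k : ℝ) + d - 1 ≠ 0 := by linarith
    have e : ∀ y, innerMap x y * (zonal d (k + 1) x y * zonal d (k + 1 + 1) x y) =
      (k + d - 1 : ℝ) / (2 * k + d) * (zonal d (k + 2) x y * zonal d (k + 2) x y) +
      (k + 1 : ℝ) / (2 * k + d) * (zonal d k x y * zonal d (k + 2) x y) := fun y => by
      have := DFunLike.congr_fun (innerMap_mul_zonal_succ hd x k) y
      simp only [ContinuousMap.mul_apply, ContinuousMap.add_apply, ContinuousMap.smul_apply,
        smul_eq_mul] at this
      linear_combination zonal d (k + 2) x y * this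
    simp only [e] at h
    rw [integral_add ((integrable_coe_mul _ _).const_mul _) ((integrable_coe_mul _ _).const_mul _),
      integral_const_mul, integral_const_mul, integral_harm_mul_eq_zero (by omega) (by omega)
      (zonal_mem_harm hd k x) (zonal_mem_harm hd (k + 2) x)] at h
    rw [show k + 1 + 1 = k + 2 from rfl]
    push_cast at h ⊢
    generalize ∫ y, zonal d (k + 2) x y * zonal d (k + 2) x y ∂(unif d) = I₂ at h ⊢
    generalize ∫ y, zonal d (k + 1) x y * zonal d (k + 1) x y ∂(unif d) = I₁ at h ⊢
    field_simp at h
    linear_combination h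

lemma integral_zonal_sq (hd : 3 ≤ d) (x : Sph d) (k : ℕ) :
    ∫ y, zonal d k x y * zonal d k x y ∂(unif d) = 1 / dimN k d := by
  have := isProbabilityMeasure_unif (d := d) (by omega)
  have hd' : (3 : ℝ) ≤ d := by exact_mod_cast hd
  induction k with
  | zero => simp [zonal_zero_apply, dimN_zero hd]
  | succ k ih =>
    have hk : (0 : ℝ) ≤ k := Nat.cast_nonneg k
    have h1 := integral_zonal_succ_sq hd x k
    have h2 := dimN_succ hd k
    have p1 : (0 : ℝ) < dimN k d := by exact_mod_cast dimN_pos hd k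
    have p2 : (0 : ℝ) < dimN (k + 1) d := by exact_mod_cast dimN_pos hd (k + 1)
    rw [ih] at h1
    have h3 : (2 * (k : ℝ) + d) * (k + d - 2) ≠ 0 := by
      refine mul_ne_zero ?_ ?_ <;> linarith
    refine mul_left_cancel₀ h3 (h1.trans ?_)
    rw [mul_one_div, mul_one_div, div_eq_div_iff p1.ne' p2.ne']
    exact h2

/-- Two finite measures on `[-1, 1]` with the same moments are equal. -/
lemma measure_eq_of_moments {ρ₁ ρ₂ : Measure ℝ} [IsFiniteMeasure ρ₁] [IsFiniteMeasure ρ₂]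
    (h₁ : ∀ᵐ t ∂ρ₁, t ∈ Set.Icc (-1 : ℝ) 1) (h₂ : ∀ᵐ t ∂ρ₂, t ∈ Set.Icc (-1 : ℝ) 1)
    (h : ∀ m : ℕ, ∫ t, t ^ m ∂ρ₁ = ∫ t, t ^ m ∂ρ₂) : ρ₁ = ρ₂ := by
  have hint : ∀ (ρ : Measure ℝ) [IsFiniteMeasure ρ], (∀ᵐ t ∂ρ, t ∈ Set.Icc (-1 : ℝ) 1) →
      ∀ g : ℝ → ℝ, Continuous g → Integrable g ρ := by
    intro ρ _ hρ g hg
    obtain ⟨C, hC⟩ := isCompact_Icc.exists_bound_of_continuousOn (hg.continuousOn (s := Set.Icc (-1 : ℝ) 1))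
    refine Integrable.of_bound hg.aestronglyMeasurable C ?_
    filter_upwards [hρ] with t ht using hC t ht
  have hpoly : ∀ p : Polynomial ℝ, ∫ t, p.eval t ∂ρ₁ = ∫ t, p.eval t ∂ρ₂ := by
    intro p
    simp only [Polynomial.eval_eq_sum_range]
    rw [integral_finsetSum _ fun i _ => hint ρ₁ h₁ _ (by fun_prop),
      integral_finsetSum _ fun i _ => hint ρ₂ h₂ _ (by fun_prop)]
    simp only [integral_const_mul, h]
  refine ext_of_forall_integral_eq_of_IsFiniteMeasure fun f => ?_
  refine sub_eq_zero.mp (abs_eq_zero.mp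
    (le_antisymm (le_of_forall_pos_le_add fun ε hε => ?_) (abs_nonneg _)))
  set K := ρ₁.real Set.univ + ρ₂.real Set.univ
  have hK : 0 ≤ K := by positivity
  obtain ⟨p, hp⟩ := exists_polynomial_near_of_continuousOn (-1) 1 f f.continuous.continuousOn
    (ε / (K + 1)) (by positivity)
  have hb : ∀ (ρ : Measure ℝ) [IsFiniteMeasure ρ], (∀ᵐ t ∂ρ, t ∈ Set.Icc (-1 : ℝ) 1) →
      |∫ t, f t ∂ρ - ∫ t, p.eval t ∂ρ| ≤ ε / (K + 1) * ρ.real Set.univ := by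
    intro ρ _ hρ
    rw [← integral_sub (hint ρ hρ _ f.continuous) (hint ρ hρ _ p.continuous), ← Real.norm_eq_abs]
    refine norm_integral_le_of_norm_le_const ?_
    filter_upwards [hρ] with t ht
    rw [Real.norm_eq_abs, abs_sub_comm]
    exact (hp t ht).le
  have b1 := hb ρ₁ h₁
  have b2 := hb ρ₂ h₂
  rw [hpoly] at b1
  rw [zero_add]
  calc |∫ t, f t ∂ρ₁ - ∫ t, f t ∂ρ₂|
      ≤ |∫ t, f t ∂ρ₁ - ∫ t, p.eval t ∂ρ₂| + |∫ t, f t ∂ρ₂ - ∫ t, p.eval t ∂ρ₂| := by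
        rw [abs_sub_comm (∫ t, f t ∂ρ₂)]
        exact abs_sub_le _ _ _
    _ ≤ ε / (K + 1) * K := by
        rw [mul_add]; exact add_le_add b1 b2
    _ ≤ ε := by
        rw [div_mul_eq_mul_div, div_le_iff₀ (by positivity)]
        nlinarith

/-- Multiplication by `t = ⟨x, y⟩` sends a zonal function to a combination of its neighbours in
degree, so orthogonality to all of them survives any power of `t`. -/
lemma integral_innerMap_pow_mul_eq_zero (hd : 3 ≤ d) (x : Sph d) {u : C(Sph d, ℝ)}
    (hu : ∀ j, ∫ y, zonal d j x y * u y ∂(unif d) = 0) (m : ℕ) :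
    ∀ j, ∫ y, innerMap x y ^ m * (zonal d j x y * u y) ∂(unif d) = 0 := by
  induction m with
  | zero => simpa using hu
  | succ m ih =>
    intro j
    have hI : ∀ j, Integrable (fun y => innerMap x y ^ m * (zonal d j x y * u y)) (unif d) :=
      fun j => continuous_integrable_unif (innerMap x ^ m * (zonal d j x * u))
    rcases j with _ | j
    · rw [← ih 1]
      congr 1
      ext y
      rw [← innerMap_mul_zonal_zero]
      simp only [ContinuousMap.mul_apply]
      ring
    · have e : ∀ y, innerMap x y ^ (m + 1) * (zonal d (j + 1) x y * u y) =
          (j + d - 1 : ℝ) / (2 * j + d) * (innerMap x y ^ m * (zonal d (j + 2) x y * u y)) +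
          (j + 1 : ℝ) / (2 * j + d) * (innerMap x y ^ m * (zonal d j x y * u y)) := fun y => by
        have := DFunLike.congr_fun (innerMap_mul_zonal_succ hd x j) y
        simp only [ContinuousMap.mul_apply, ContinuousMap.add_apply, ContinuousMap.smul_apply,
          smul_eq_mul] at this
        linear_combination innerMap x y ^ m * u y * this
      simp only [e]
      rw [integral_add ((hI _).const_mul _) ((hI _).const_mul _), integral_const_mul,
        integral_const_mul, ih, ih, mul_zero, mul_zero, add_zero]

/-- A function orthogonal to all zonal harmonics with pole `x` is orthogonal to all functions of
the inner product with `x`. -/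
lemma integral_comp_inner_mul_eq_zero (hd : 3 ≤ d) (x : Sph d) {u : C(Sph d, ℝ)}
    (hu : ∀ j, ∫ y, zonal d j x y * u y ∂(unif d) = 0) {F : ℝ → ℝ} (hF : Measurable F) {B : ℝ}
    (hB : ∀ t ∈ Set.Icc (-1 : ℝ) 1, |F t| ≤ B) :
    ∫ y, F (inner ℝ x.1 y.1) * u y ∂(unif d) = 0 := by
  have := isProbabilityMeasure_unif (d := d) (by omega)
  -- `ρ w` is the image under `y ↦ ⟨x, y⟩` of the positive part of `w`. All moments of `ρ u` and `ρ
  -- (-u)` agree, so the two measures coincide and `u` integrates to zero against every bounded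
  -- measurable function of `⟨x, y⟩`.
  let ρ : (C(Sph d, ℝ)) → Measure ℝ := fun w =>
    ((unif d).withDensity fun y => ((w y).toNNReal : ENNReal)).map (innerMap x)
  have hm : ∀ w : C(Sph d, ℝ), Measurable fun y => (w y).toNNReal := fun w =>
    w.continuous.measurable.real_toNNReal
  have hρint : ∀ (w : C(Sph d, ℝ)) {G : ℝ → ℝ}, Measurable G →
      ∫ t, G t ∂(ρ w) = ∫ y, max (w y) 0 * G (innerMap x y) ∂(unif d) := by
    intro w G hG
    rw [integral_map (innerMap x).continuous.aemeasurable hG.aestronglyMeasurable,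
      integral_withDensity_eq_integral_smul (hm w)]
    simp [NNReal.smul_def]
  have hfin : ∀ w, IsFiniteMeasure (ρ w) := by
    intro w
    have : IsFiniteMeasure ((unif d).withDensity fun y => ((w y).toNNReal : ENNReal)) := by
      refine isFiniteMeasure_withDensity ?_
      have h1 := (continuous_integrable_unif (w ⊔ 0)).lintegral_lt_top
      refine (lt_of_le_of_lt (lintegral_mono fun y => ?_) h1).ne
      rw [ENNReal.ofReal]
      exact ENNReal.coe_le_coe.mpr (Real.toNNReal_le_toNNReal (by simp))
    exact Measure.isFiniteMeasure_map _ _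
  have hsupp : ∀ w, ∀ᵐ t ∂(ρ w), t ∈ Set.Icc (-1 : ℝ) 1 := by
    intro w
    refine (ae_map_iff (innerMap x).continuous.aemeasurable measurableSet_Icc).mpr ?_
    exact Filter.Eventually.of_forall fun y => innerMap_mem_Icc x y
  have hsplit : ∀ G : ℝ → ℝ, Measurable G → (∃ B, ∀ t ∈ Set.Icc (-1 : ℝ) 1, |G t| ≤ B) →
      ∫ y, G (innerMap x y) * u y ∂(unif d) = ∫ t, G t ∂(ρ u) - ∫ t, G t ∂(ρ (-u)) := by
    rintro G hG ⟨B, hB⟩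
    have hI : ∀ w : C(Sph d, ℝ), Integrable (fun y => max (w y) 0 * G (innerMap x y)) (unif d) := by
      intro w
      refine (continuous_integrable_unif (w ⊔ 0)).mul_bdd (c := B)
        (hG.comp (innerMap x).continuous.measurable).aestronglyMeasurable ?_
      exact Filter.Eventually.of_forall fun y => hB _ (innerMap_mem_Icc x y)
    rw [hρint u hG, hρint (-u) hG, ← integral_sub (hI u) (hI (-u))]
    congr 1
    ext y
    have : u y = max (u y) 0 - max ((-u) y) 0 := by
      rw [ContinuousMap.neg_apply]
      rcases le_total (u y) 0 with h | h
      · rw [max_eq_right h, max_eq_left (by linarith)]; ring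
      · rw [max_eq_left h, max_eq_right (by linarith)]; ring
    conv_lhs => rw [this]
    ring
  have heq : ρ u = ρ (-u) := by
    have := hfin u
    have := hfin (-u)
    refine measure_eq_of_moments (hsupp u) (hsupp (-u)) fun m => ?_
    refine sub_eq_zero.mp ?_
    rw [← hsplit (fun t => t ^ m) (by fun_prop) ⟨1, fun t ht => ?_⟩]
    · have := integral_innerMap_pow_mul_eq_zero hd x hu m 0
      simpa only [zonal_zero_apply, one_mul] using this
    · rw [abs_pow]
      exact pow_le_one₀ (abs_nonneg _) (abs_le.mpr ht)
  have := hsplit F hF ⟨B, hB⟩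
  rw [heq, sub_self] at this
  exact this

/-- The Funk-Hecke formula. -/
lemma integral_comp_inner_mul_harm (hd : 3 ≤ d) (x : Sph d) {k : ℕ} {h : C(Sph d, ℝ)}
    (hh : h ∈ harm d k) {F : ℝ → ℝ} (hF : Measurable F) {B : ℝ}
    (hB : ∀ t ∈ Set.Icc (-1 : ℝ) 1, |F t| ≤ B) :
    ∫ y, F (inner ℝ x.1 y.1) * h y ∂(unif d) =
      h x * ∫ y, F (inner ℝ x.1 y.1) * zonal d k x y ∂(unif d) := by
  have := isProbabilityMeasure_unif (d := d) (by omega)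
  have := isOpenPosMeasure_unif (d := d)
  have hN : (0 : ℝ) < dimN k d := by exact_mod_cast dimN_pos hd k
  -- This coefficient makes `h - C • zonal` orthogonal to the zonal function of degree `k`; the
  -- other degrees are orthogonal already. It turns out to be `h x`.
  set C := dimN k d * ∫ y, zonal d k x y * h y ∂(unif d) with hC
  have hu : ∀ j, ∫ y, zonal d j x y * (h - C • zonal d k x) y ∂(unif d) = 0 := by
    intro j
    have e : ∀ y, zonal d j x y * (h - C • zonal d k x) y =
        zonal d j x y * h y - C * (zonal d j x y * zonal d k x y) := fun y => by
      simp only [ContinuousMap.sub_apply, ContinuousMap.smul_apply, smul_eq_mul]; ring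
    simp only [e]
    rw [integral_sub (integrable_coe_mul _ _) ((integrable_coe_mul _ _).const_mul _),
      integral_const_mul]
    by_cases hj : j = k
    · rw [hj, integral_zonal_sq hd, hC]
      field_simp
      ring
    · rw [integral_harm_mul_eq_zero (by omega) hj (zonal_mem_harm hd j x) hh,
        integral_harm_mul_eq_zero (by omega) hj (zonal_mem_harm hd j x) (zonal_mem_harm hd k x)]
      ring
  -- If `u x > 0` then `u` is positive on a cap around `x`, and a bump in `⟨x, y⟩` supported on that
  -- cap has a positive integral against `u`.
  have hpos : ∀ u : C(Sph d, ℝ), (∀ j, ∫ y, zonal d j x y * u y ∂(unif d) = 0) → ¬ 0 < u x := by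
    intro u hu hux
    obtain ⟨η, hη, hηu⟩ : ∃ η > 0, ∀ y, 1 - η < inner ℝ x.1 y.1 → 0 < u y := by
      obtain ⟨r, hr, hball⟩ := Metric.continuousAt_iff.mp u.continuous.continuousAt _ hux
      refine ⟨r ^ 2 / 2, by positivity, fun y hy => ?_⟩
      have h1 : dist y x < r := by
        rw [Subtype.dist_eq, dist_eq_norm]
        have := norm_sub_sq_real x.1 y.1
        rw [norm_eq_of_mem_sphere, norm_eq_of_mem_sphere] at this
        rw [norm_sub_rev]
        exact lt_of_pow_lt_pow_left₀ 2 hr.le (by rw [this]; linarith)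
      have := hball h1
      rw [Real.dist_eq, abs_lt] at this
      linarith
    have h0 := integral_comp_inner_mul_eq_zero hd x hu (F := fun t => max 0 (t - (1 - η)))
      (by fun_prop) (B := η) (fun t ht => by
        rw [abs_of_nonneg (le_max_left _ _)]
        exact max_le hη.le (by linarith [ht.2]))
    let v : C(Sph d, ℝ) := ⟨fun y => max 0 (inner ℝ x.1 y.1 - (1 - η)) * u y, by fun_prop⟩
    refine (integral_pos_of_integrable_nonneg_nonzero (μ := unif d) (x := x) (f := v) v.continuous
      (continuous_integrable_unif v) (fun y => ?_) ?_).ne' h0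
    · change 0 ≤ max 0 (inner ℝ x.1 y.1 - (1 - η)) * u y
      by_cases hy : 1 - η < inner ℝ x.1 y.1
      · exact mul_nonneg (le_max_left _ _) (hηu y hy).le
      · rw [max_eq_left (by linarith), zero_mul]
    · change max 0 (inner ℝ x.1 x.1 - (1 - η)) * u x ≠ 0
      rw [real_inner_self_eq_norm_sq, norm_eq_of_mem_sphere, max_eq_right (by linarith)]
      refine mul_ne_zero ?_ hux.ne'
      linarith
  have hux : (h - C • zonal d k x) x = 0 := by
    refine le_antisymm (not_lt.mp (hpos _ hu)) ?_
    have := hpos (-(h - C • zonal d k x)) fun j => by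
      have := hu j
      simp only [ContinuousMap.neg_apply, mul_neg, integral_neg, this, neg_zero]
    rw [ContinuousMap.neg_apply] at this
    linarith
  have hCx : C = h x := by
    simp only [ContinuousMap.sub_apply, ContinuousMap.smul_apply, smul_eq_mul, zonal_self hd] at hux
    linarith
  have key := integral_comp_inner_mul_eq_zero hd x hu hF hB
  have hI : ∀ w : C(Sph d, ℝ), Integrable (fun y => F (inner ℝ x.1 y.1) * w y) (unif d) := by
    intro w
    refine (continuous_integrable_unif w).bdd_mul (c := B)
      (hF.comp (innerMap x).continuous.measurable).aestronglyMeasurable ?_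
    exact Filter.Eventually.of_forall fun y => hB _ (innerMap_mem_Icc x y)
  have e : ∀ y, F (inner ℝ x.1 y.1) * (h - C • zonal d k x) y =
      F (inner ℝ x.1 y.1) * h y - C * (F (inner ℝ x.1 y.1) * zonal d k x y) := fun y => by
    simp only [ContinuousMap.sub_apply, ContinuousMap.smul_apply, smul_eq_mul]; ring
  simp only [e] at key
  rw [integral_sub (hI _) ((hI _).const_mul _), integral_const_mul, hCx] at key
  linarith

/-- The reproducing property of the zonal harmonics. -/
lemma integral_zonal_mul_harm (hd : 3 ≤ d) (x : Sph d) {k : ℕ} {h : C(Sph d, ℝ)}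
    (hh : h ∈ harm d k) : ∫ y, zonal d k x y * h y ∂(unif d) = h x / dimN k d := by
  obtain ⟨B, hB⟩ := isCompact_Icc.exists_bound_of_continuousOn
    ((continuous_legendreP (d := d) k).continuousOn (s := Set.Icc (-1 : ℝ) 1))
  have h1 := integral_comp_inner_mul_harm hd x hh (continuous_legendreP (d := d) k).measurable hB
  have h2 := integral_zonal_sq hd x k
  simp only [zonal_apply] at h2 ⊢
  simp only [zonal_apply] at h1
  rw [h1, h2]
  ring
end

/-! ### The law of the inner product with a fixed point -/

section
variable {d : ℕ}
open MvPolynomial in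
lemma gaussInt_linForm_mul (x : EuclideanSpace ℝ (Fin d)) (p : MvPolynomial (Fin d) ℝ) :
    gaussInt (linForm x * p) = gaussInt (dirDeriv x p) := by
  rw [linForm, Finset.sum_mul, gaussInt_sum, dirDeriv_apply, gaussInt_sum]
  refine Finset.sum_congr rfl fun i _ => ?_
  rw [smul_mul_assoc, gaussInt_smul, gaussInt_X_mul, gaussInt_smul]

open MvPolynomial in
lemma gaussInt_normSqPoly_mul {p : MvPolynomial (Fin d) ℝ} {m : ℕ} (hp : p.IsHomogeneous m) :
    gaussInt (normSqPoly d * p) = (d + m) * gaussInt p := by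
  have e : normSqPoly d * p = ∑ i, X i * (X i * p) := by
    rw [normSqPoly, Finset.sum_mul]
    simp only [sq, mul_assoc]
  have e2 : ∀ i : Fin d, gaussInt (X i * (X i * p)) = gaussInt (X i * pderiv i p) + gaussInt p := by
    intro i
    rw [gaussInt_X_mul, Derivation.leibniz, smul_eq_mul, smul_eq_mul, pderiv_X_self, mul_one,
      gaussInt_add]
  rw [e, gaussInt_sum]
  simp only [e2]
  rw [Finset.sum_add_distrib, ← gaussInt_sum, hp.sum_X_mul_pderiv, ← Nat.cast_smul_eq_nsmul ℝ,
    gaussInt_smul]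
  simp
  ring

/-- Compare the Gaussian integrals of `⟨x, y⟩^(m+2)` and `‖y‖² ⟨x, y⟩^m`. They have the same degree,
so the constant relating them to sphere averages is the same and drops out. -/
lemma integral_innerMap_pow_succ_succ (hd : 1 ≤ d) (x : Sph d) (m : ℕ) :
    (m + d) * ∫ y, innerMap x y ^ (m + 2) ∂(unif d) =
      (m + 1) * ∫ y, innerMap x y ^ m ∂(unif d) := by
  obtain ⟨C, hC, h⟩ := exists_gaussInt_eq hd (m + 2)
  have hx := norm_eq_of_mem_sphere x
  have hl : ∀ n, (linForm x.1 ^ n).IsHomogeneous n := fun n => by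
    simpa using (isHomogeneous_linForm x.1).pow n
  have e : ∀ n (y : Sph d), polyEval (linForm x.1 ^ n) y.1 = innerMap x y ^ n := fun n y => by
    rw [polyEval_pow, polyEval_linForm, innerMap_apply]
  have h1 := h _ (hl (m + 2))
  have h2 := h (normSqPoly d * linForm x.1 ^ m) (by
    have := isHomogeneous_normSqPoly.mul (hl m)
    rwa [add_comm] at this)
  have h3 : gaussInt (linForm x.1 ^ (m + 2)) = (m + 1) * gaussInt (linForm x.1 ^ m) := by
    rw [pow_succ', gaussInt_linForm_mul, Derivation.leibniz_pow, dirDeriv_linForm hx,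
      show m + 1 - 1 = m by omega, smul_eq_mul, mul_one, ← Nat.cast_smul_eq_nsmul ℝ, gaussInt_smul]
    push_cast
    ring
  rw [gaussInt_normSqPoly_mul (hl m)] at h2
  simp only [polyEval_mul, polyEval_normSqPoly, norm_eq_of_mem_sphere, one_pow, one_mul, e] at h1 h2
  refine mul_left_cancel₀ hC.ne' ?_
  rw [mul_left_comm, ← h1, h3, mul_left_comm C, ← h2]
  ring

lemma integral_innerMap (hd : 1 ≤ d) (x : Sph d) : ∫ y, innerMap x y ∂(unif d) = 0 := by
  obtain ⟨C, hC, h⟩ := exists_gaussInt_eq hd 1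
  have h1 := h _ (isHomogeneous_linForm x.1)
  have h2 := gaussInt_linForm_mul x.1 1
  rw [mul_one, Derivation.map_one_eq_zero] at h2
  rw [h2] at h1
  simp only [polyEval_linForm] at h1
  have h3 : gaussInt (0 : MvPolynomial (Fin d) ℝ) = 0 := by simp [gaussInt]
  rw [h3] at h1
  exact (mul_eq_zero.mp h1.symm).resolve_left hC.ne'

lemma continuous_muDensity (hd : 3 ≤ d) : Continuous (muDensity d) := by
  have hd' : (3 : ℝ) ≤ d := by exact_mod_cast hd
  unfold muDensity
  refine ((Continuous.rpow_const (by fun_prop) fun t => Or.inr ?_).mul_const _).mul_const _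
  linarith

lemma muDensity_nonneg (hd : 3 ≤ d) {t : ℝ} (ht : t ∈ Set.Icc (-1 : ℝ) 1) : 0 ≤ muDensity d t := by
  have hd' : (3 : ℝ) ≤ d := by exact_mod_cast hd
  unfold muDensity
  have h1 : 0 ≤ 1 - t ^ 2 := by nlinarith [ht.1, ht.2]
  have h2 := Real.Gamma_pos_of_pos (show (0 : ℝ) < d / 2 by linarith)
  have h3 := Real.Gamma_pos_of_pos (show (0 : ℝ) < (d - 1) / 2 by linarith)
  positivity

/-- Integrate the derivative of `t^(m+1) (1 - t²)^((d-1)/2)`, which vanishes at both ends. The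
sphere moments satisfy the same recursion, so agreement in degrees 0 and 1 identifies the laws. -/
lemma integral_pow_mul_muDensity_succ_succ (hd : 3 ≤ d) (m : ℕ) :
    (m + d) * ∫ t in (-1 : ℝ)..1, t ^ (m + 2) * muDensity d t =
      (m + 1) * ∫ t in (-1 : ℝ)..1, t ^ m * muDensity d t := by
  have hd' : (3 : ℝ) ≤ d := by exact_mod_cast hd
  have hc := continuous_muDensity hd
  set c := Real.Gamma ((d : ℝ) / 2) / Real.Gamma (((d : ℝ) - 1) / 2) * (1 / √Real.pi) with hc0
  have hder : ∀ t ∈ Set.uIcc (-1 : ℝ) 1, HasDerivAt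
      (fun t : ℝ => t ^ (m + 1) * ((1 - t ^ 2) ^ (((d : ℝ) - 1) / 2) * c))
      ((m + 1) * (t ^ m * muDensity d t) - (m + d) * (t ^ (m + 2) * muDensity d t)) t := by
    intro t ht
    rw [Set.uIcc_of_le (by norm_num)] at ht
    have h1 : HasDerivAt (fun t : ℝ => 1 - t ^ 2) (-(2 * t)) t := by
      simpa using (hasDerivAt_pow 2 t).const_sub 1
    have h2 := (h1.rpow_const (p := ((d : ℝ) - 1) / 2) (Or.inr (by linarith))).mul_const c
    have h3 := (hasDerivAt_pow (m + 1) t).mul h2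
    convert! h3 using 1
    have e : (1 - t ^ 2) ^ (((d : ℝ) - 1) / 2) = (1 - t ^ 2) * (1 - t ^ 2) ^ (((d : ℝ) - 3) / 2) := by
      have h0 : 0 ≤ 1 - t ^ 2 := by nlinarith [ht.1, ht.2]
      rw [show ((d : ℝ) - 1) / 2 = 1 + (d - 3) / 2 by ring, Real.rpow_add_of_nonneg h0 (by norm_num)
        (by linarith), Real.rpow_one]
    rw [e, show ((d : ℝ) - 1) / 2 - 1 = (d - 3) / 2 by ring, muDensity, mul_assoc _ (_ / _), ← hc0]
    push_cast
    ring
  have hint := intervalIntegral.integral_eq_sub_of_hasDerivAt hder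
    (Continuous.intervalIntegrable (by fun_prop) _ _)
  rw [intervalIntegral.integral_sub (Continuous.intervalIntegrable (by fun_prop) _ _)
    (Continuous.intervalIntegrable (by fun_prop) _ _), intervalIntegral.integral_const_mul,
    intervalIntegral.integral_const_mul] at hint
  have h0 : (0 : ℝ) ^ (((d : ℝ) - 1) / 2) = 0 := Real.zero_rpow (by linarith)
  norm_num [h0] at hint
  linarith

lemma integral_mul_muDensity_eq_zero : ∫ t in (-1 : ℝ)..1, t * muDensity d t = 0 := by
  have h := intervalIntegral.integral_comp_neg (a := (-1 : ℝ)) (b := 1) (fun t => t * muDensity d t)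
  have e : ∀ t : ℝ, -t * muDensity d (-t) = -(t * muDensity d t) := fun t => by
    simp [muDensity]
  simp only [e, intervalIntegral.integral_neg, neg_neg] at h
  linarith

/-- The substitution `t = 2x - 1` gives the Beta integral at `(s, s)`, and Legendre's duplication
formula simplifies the Gamma quotient. -/
lemma integral_one_sub_sq_rpow {s : ℝ} (hs : 1 ≤ s) :
    ∫ t in (-1 : ℝ)..1, (1 - t ^ 2) ^ (s - 1) = √Real.pi * Real.Gamma s / Real.Gamma (s + 1 / 2) := by
  have h0 : 0 < s := by linarith
  have h1 := intervalIntegral.integral_comp_mul_sub (a := 0) (b := 1)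
    (fun t : ℝ => (1 - t ^ 2) ^ (s - 1)) (c := 2) (by norm_num) 1
  have e1 : Set.EqOn (fun x : ℝ => (1 - (2 * x - 1) ^ 2) ^ (s - 1))
      (fun x => 4 ^ (s - 1) * (x ^ (s - 1) * (1 - x) ^ (s - 1))) (Set.uIcc 0 1) := by
    intro x hx
    rw [Set.uIcc_of_le (by norm_num)] at hx
    have h2 : 0 ≤ 1 - x := by linarith [hx.2]
    simp only
    rw [← Real.mul_rpow hx.1 h2, ← Real.mul_rpow (by norm_num) (mul_nonneg hx.1 h2)]
    congr 1; ring
  rw [intervalIntegral.integral_congr e1, intervalIntegral.integral_const_mul] at h1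
  have h2 : ∫ x in (0 : ℝ)..1, x ^ (s - 1) * (1 - x) ^ (s - 1) =
      Real.Gamma s * Real.Gamma s / Real.Gamma (s + s) := by
    rw [← ProbabilityTheory.beta, ProbabilityTheory.beta_eq_betaIntegralReal s s h0 h0,
      Complex.betaIntegral]
    rw [← Complex.ofReal_re (∫ x in (0 : ℝ)..1, x ^ (s - 1) * (1 - x) ^ (s - 1)),
      ← intervalIntegral.integral_ofReal]
    congr 1
    refine intervalIntegral.integral_congr fun x hx => ?_
    rw [Set.uIcc_of_le (by norm_num)] at hx
    have h2 : 0 ≤ 1 - x := by linarith [hx.2]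
    push_cast
    rw [Complex.ofReal_cpow hx.1, Complex.ofReal_cpow h2]
    push_cast
    rfl
  rw [h2] at h1
  have h3 := Real.Gamma_mul_Gamma_add_half s
  have g1 := (Real.Gamma_pos_of_pos h0).ne'
  have g2 := (Real.Gamma_pos_of_pos (show 0 < s + 1 / 2 by linarith)).ne'
  have g3 := (Real.Gamma_pos_of_pos (show 0 < 2 * s by linarith)).ne'
  have h4 : (4 : ℝ) ^ (s - 1) * 2 ^ (1 - 2 * s) = 1 / 2 := by
    rw [show (4 : ℝ) = 2 ^ (2 : ℝ) by norm_num, ← Real.rpow_mul (by norm_num),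
      ← Real.rpow_add (by norm_num), show 2 * (s - 1) + (1 - 2 * s) = -1 by ring,
      Real.rpow_neg_one]
    norm_num
  norm_num at h1
  rw [← two_mul s] at h1
  rw [eq_div_iff g2]
  have h5 : ∫ t in (-1 : ℝ)..1, (1 - t ^ 2) ^ (s - 1) =
      2 * (4 ^ (s - 1) * (Real.Gamma s * Real.Gamma s / Real.Gamma (2 * s))) := by linarith
  rw [h5]
  generalize Real.Gamma (s + 1 / 2) = G at g2 h3 ⊢
  field_simp
  linear_combination 2 * 4 ^ (s - 1) * h3 + 2 * (Real.Gamma (2 * s) * √Real.pi) * h4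

lemma integral_muDensity (hd : 3 ≤ d) : ∫ t in (-1 : ℝ)..1, muDensity d t = 1 := by
  have hd' : (3 : ℝ) ≤ d := by exact_mod_cast hd
  unfold muDensity
  have h := integral_one_sub_sq_rpow (s := ((d : ℝ) - 1) / 2) (by linarith)
  rw [show ((d : ℝ) - 1) / 2 - 1 = (d - 3) / 2 by ring,
    show ((d : ℝ) - 1) / 2 + 1 / 2 = d / 2 by ring] at h
  rw [intervalIntegral.integral_mul_const, intervalIntegral.integral_mul_const, h]
  have g1 := (Real.Gamma_pos_of_pos (show (0 : ℝ) < (d - 1) / 2 by linarith)).ne'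
  have g2 := (Real.Gamma_pos_of_pos (show (0 : ℝ) < d / 2 by linarith)).ne'
  have g3 : √Real.pi ≠ 0 := by positivity
  generalize Real.Gamma (((d : ℝ) - 1) / 2) = G₁ at g1 ⊢
  generalize Real.Gamma ((d : ℝ) / 2) = G₂ at g2 ⊢
  field_simp

/-- The law of the inner product of a uniform point with a fixed point of the sphere. -/
lemma map_innerMap_unif (hd : 3 ≤ d) (x : Sph d) : (unif d).map (innerMap x) =
    (volume.restrict (Set.Ioc (-1 : ℝ) 1)).withDensity fun t => ((muDensity d t).toNNReal : ENNReal) := by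
  have := isProbabilityMeasure_unif (d := d) (by omega)
  have hc := continuous_muDensity hd
  have hm : Measurable fun t => (muDensity d t).toNNReal := hc.measurable.real_toNNReal
  have hint : ∀ G : ℝ → ℝ, ∫ t, G t ∂((volume.restrict (Set.Ioc (-1 : ℝ) 1)).withDensity
      fun t => ((muDensity d t).toNNReal : ENNReal)) = ∫ t in (-1 : ℝ)..1, G t * muDensity d t := by
    intro G
    rw [integral_withDensity_eq_integral_smul hm, intervalIntegral.integral_of_le (by norm_num)]
    refine setIntegral_congr_fun measurableSet_Ioc fun t ht => ?_
    have := muDensity_nonneg hd (Set.Ioc_subset_Icc_self ht)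
    simp [NNReal.smul_def, this, mul_comm]
  have : IsFiniteMeasure ((volume.restrict (Set.Ioc (-1 : ℝ) 1)).withDensity
      fun t => ((muDensity d t).toNNReal : ENNReal)) :=
    isFiniteMeasure_withDensity_ofReal
      (hc.integrableOn_Icc.mono_set Set.Ioc_subset_Icc_self).hasFiniteIntegral
  have : IsFiniteMeasure ((unif d).map (innerMap x)) := Measure.isFiniteMeasure_map _ _
  have key : ∀ m : ℕ, ∫ y, innerMap x y ^ m ∂(unif d) =
      ∫ t in (-1 : ℝ)..1, t ^ m * muDensity d t := by
    intro m
    induction m using Nat.strong_induction_on with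
    | _ m ih =>
      match m, ih with
      | 0, _ => simp [integral_muDensity hd]
      | 1, _ => simp [integral_mul_muDensity_eq_zero, integral_innerMap (d := d) (by omega)]
      | m + 2, ih =>
        have h1 := integral_innerMap_pow_succ_succ (d := d) (by omega) x m
        have h2 := integral_pow_mul_muDensity_succ_succ hd m
        rw [ih m (by omega), ← h2] at h1
        refine mul_left_cancel₀ ?_ h1
        have : 0 < m + d := by omega
        exact_mod_cast this.ne'
  refine measure_eq_of_moments ?_ ?_ fun m => ?_
  · refine (ae_map_iff (innerMap x).continuous.aemeasurable measurableSet_Icc).mpr ?_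
    exact Filter.Eventually.of_forall fun y => innerMap_mem_Icc x y
  · refine (withDensity_absolutelyContinuous _ _).ae_le ?_
    filter_upwards [ae_restrict_mem measurableSet_Ioc] with t ht using Set.Ioc_subset_Icc_self ht
  · rw [hint, integral_map (innerMap x).continuous.aemeasurable (by fun_prop), key]

lemma integral_comp_inner (hd : 3 ≤ d) (x : Sph d) {F : ℝ → ℝ} (hF : Measurable F) :
    ∫ y, F (inner ℝ x.1 y.1) ∂(unif d) = ∫ t in (-1 : ℝ)..1, F t * muDensity d t := by
  have h := integral_map (μ := unif d) (innerMap x).continuous.aemeasurable hF.aestronglyMeasurable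
  rw [map_innerMap_unif hd, integral_withDensity_eq_integral_smul
    (continuous_muDensity hd).measurable.real_toNNReal] at h
  refine h.symm.trans ?_
  rw [intervalIntegral.integral_of_le (by norm_num)]
  refine setIntegral_congr_fun measurableSet_Ioc fun t ht => ?_
  have := muDensity_nonneg hd (Set.Ioc_subset_Icc_self ht)
  simp [NNReal.smul_def, this, mul_comm]
end

/-! ### Orthonormal bases of spherical harmonics -/

section
variable {d : ℕ}

lemma toL2_injective : Function.Injective (toL2 d) := by
  have := isOpenPosMeasure_unif (d := d)
  exact ContinuousMap.toLp_injective (unif d)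

lemma inner_toL2 (f g : C(Sph d, ℝ)) : inner ℝ (toL2 d f) (toL2 d g) = ∫ x, f x * g x ∂(unif d) := by
  rw [toL2, ContinuousMap.inner_toLp]
  simp [mul_comm]

/-- Start from an orthonormal basis of unknown size `m`. The reproducing property gives `∑ e_i(x)² =
N_k` at every point, and integrating over the sphere gives `m = N_k`. -/
lemma exists_orthonormal_harm (hd : 3 ≤ d) (k : ℕ) : ∃ e : Fin (dimN k d) → C(Sph d, ℝ),
    (∀ i, e i ∈ harm d k) ∧
    (∀ i j, ∫ x, e i x * e j x ∂(unif d) = if i = j then 1 else 0) ∧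
    ∀ h ∈ harm d k, h = ∑ i, (∫ x, e i x * h x ∂(unif d)) • e i := by
  have := isProbabilityMeasure_unif (d := d) (by omega)
  have key : ∃ (m : ℕ) (e : Fin m → C(Sph d, ℝ)), (∀ i, e i ∈ harm d k) ∧
    (∀ i j, ∫ x, e i x * e j x ∂(unif d) = if i = j then 1 else 0) ∧
    ∀ h ∈ harm d k, h = ∑ i, (∫ x, e i x * h x ∂(unif d)) • e i := by
    let b := stdOrthonormalBasis ℝ (harmL2 d k)
    have hb : ∀ i, ∃ g ∈ harm d k, toL2 d g = b i := fun i => (b i).2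
    choose e he heb using hb
    refine ⟨_, e, he, fun i j => ?_, fun h hh => toL2_injective ?_⟩
    · rw [← inner_toL2, heb, heb, ← Submodule.coe_inner]
      exact orthonormal_iff_ite.mp b.orthonormal i j
    · have h1 := b.sum_repr' ⟨toL2 d h, Submodule.mem_map_of_mem hh⟩
      have h2 := congrArg Subtype.val h1
      simp only [Submodule.coe_sum, Submodule.coe_smul, Submodule.coe_inner, ← heb, inner_toL2] at h2
      rw [map_sum, ← h2]
      simp only [map_smul]
  obtain ⟨m, e, he, ho, hs⟩ := key
  have hN : (0 : ℝ) < dimN k d := by exact_mod_cast dimN_pos hd k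
  have hx : ∀ x, ∑ i, e i x * e i x = dimN k d := by
    intro x
    have h1 := DFunLike.congr_fun (hs _ (zonal_mem_harm hd k x)) x
    simp only [mul_comm (e _ _) (zonal d k x _), integral_zonal_mul_harm hd x (he _)] at h1
    rw [zonal_self hd] at h1
    simp only [ContinuousMap.coe_sum, Finset.sum_apply, ContinuousMap.smul_apply, smul_eq_mul,
      div_mul_eq_mul_div, ← Finset.sum_div] at h1
    rw [eq_div_iff hN.ne'] at h1
    linarith
  have hm : m = dimN k d := by
    have h1 : ∫ x, ∑ i, e i x * e i x ∂(unif d) = m := by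
      rw [integral_finsetSum _ fun i _ => integrable_coe_mul _ _]
      simp [ho]
    simp only [hx, integral_const, probReal_univ, one_smul] at h1
    exact_mod_cast h1.symm
  subst hm
  exact ⟨e, he, ho, hs⟩

/-- An orthonormal basis of the spherical harmonics of degree `k`. -/
def harmBasis (d k : ℕ) : Fin (dimN k d) → C(Sph d, ℝ) :=
  if hd : 3 ≤ d then (exists_orthonormal_harm hd k).choose else 0

lemma harmBasis_spec (hd : 3 ≤ d) (k : ℕ) : (∀ i, harmBasis d k i ∈ harm d k) ∧
    (∀ i j, ∫ x, harmBasis d k i x * harmBasis d k j x ∂(unif d) = if i = j then 1 else 0) ∧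
    ∀ h ∈ harm d k, h = ∑ i, (∫ x, harmBasis d k i x * h x ∂(unif d)) • harmBasis d k i := by
  rw [harmBasis, dif_pos hd]
  exact (exists_orthonormal_harm hd k).choose_spec

lemma sum_harmBasis_mul (hd : 3 ≤ d) (k : ℕ) (x y : Sph d) :
    ∑ i, harmBasis d k i x * harmBasis d k i y = dimN k d * zonal d k x y := by
  have hN : (0 : ℝ) < dimN k d := by exact_mod_cast dimN_pos hd k
  obtain ⟨he, -, hs⟩ := harmBasis_spec hd k
  have h1 := DFunLike.congr_fun (hs _ (zonal_mem_harm hd k x)) y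
  simp only [mul_comm (harmBasis d k _ _) (zonal d k x _), integral_zonal_mul_harm hd x (he _)] at h1
  simp only [ContinuousMap.coe_sum, Finset.sum_apply, ContinuousMap.smul_apply, smul_eq_mul,
    div_mul_eq_mul_div, ← Finset.sum_div] at h1
  rw [h1]
  field_simp

/-- Indices of the basis of `harmLE d k`. -/
abbrev HarmIdx (d k : ℕ) : Type := Σ l : Fin (k + 1), Fin (dimN l d)

/-- The orthonormal basis of `harmLE d k` obtained from those of the `harm d l`, `l ≤ k`. -/
def harmLEBasis (d k : ℕ) (j : HarmIdx d k) : C(Sph d, ℝ) := harmBasis d j.1 j.2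

/-- The element of `harmLE d k` with given coefficients. -/
def harmExpand {k : ℕ} (a : HarmIdx d k → ℝ) : C(Sph d, ℝ) := ∑ j, a j • harmLEBasis d k j

lemma harmExpand_apply {k : ℕ} (a : HarmIdx d k → ℝ) (x : Sph d) :
    harmExpand a x = ∑ j, a j * harmLEBasis d k j x := by
  simp [harmExpand]

lemma integral_harmLEBasis_mul (hd : 3 ≤ d) (k : ℕ) (i j : HarmIdx d k) :
    ∫ x, harmLEBasis d k i x * harmLEBasis d k j x ∂(unif d) = if i = j then 1 else 0 := by
  obtain ⟨l, i⟩ := i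
  obtain ⟨m, j⟩ := j
  by_cases h : l = m
  · subst h
    simpa [harmLEBasis] using (harmBasis_spec hd l).2.1 i j
  · rw [if_neg (by simp [h])]
    exact integral_harm_mul_eq_zero (by omega) (by omega) ((harmBasis_spec hd l).1 i)
      ((harmBasis_spec hd m).1 j)

lemma integral_harmLEBasis_mul_harmExpand (hd : 3 ≤ d) {k : ℕ} (a : HarmIdx d k → ℝ)
    (i : HarmIdx d k) : ∫ x, harmLEBasis d k i x * harmExpand a x ∂(unif d) = a i := by
  simp only [harmExpand_apply, Finset.mul_sum, mul_left_comm]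
  rw [integral_finsetSum _ fun j _ => (integrable_coe_mul _ _).const_mul _]
  simp [integral_const_mul, integral_harmLEBasis_mul hd]

lemma integral_harmExpand_sq (hd : 3 ≤ d) {k : ℕ} (a : HarmIdx d k → ℝ) :
    ∫ x, harmExpand a x ^ 2 ∂(unif d) = ∑ j, a j ^ 2 := by
  have e : ∀ x, harmExpand a x ^ 2 = ∑ j, a j * (harmLEBasis d k j x * harmExpand a x) := fun x => by
    rw [sq]
    conv_lhs => rw [harmExpand_apply, Finset.sum_mul]
    simp only [harmExpand_apply, mul_assoc]
  simp only [e]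
  rw [integral_finsetSum _ fun j _ => (integrable_coe_mul _ _).const_mul _]
  simp [integral_const_mul, integral_harmLEBasis_mul_harmExpand hd, sq]

lemma mem_harmLE_iff (hd : 3 ≤ d) {k : ℕ} {g : C(Sph d, ℝ)} :
    g ∈ harmLE d k ↔ ∃ a : HarmIdx d k → ℝ, g = harmExpand a := by
  constructor
  · intro hg
    let W : Submodule ℝ C(Sph d, ℝ) := LinearMap.range
      (Fintype.linearCombination ℝ (harmLEBasis d k))
    have hle : harmLE d k ≤ W := by
      refine iSup₂_le fun l hl h hh => ?_
      rw [(harmBasis_spec hd l).2.2 h hh]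
      refine Submodule.sum_mem _ fun i _ => Submodule.smul_mem _ _ ?_
      refine ⟨Pi.single ⟨⟨l, Finset.mem_range.mp hl⟩, i⟩ 1, ?_⟩
      rw [Fintype.linearCombination_apply_single, one_smul]
      rfl
    obtain ⟨a, ha⟩ := hle hg
    exact ⟨a, by rw [← ha, Fintype.linearCombination_apply]; rfl⟩
  · rintro ⟨a, rfl⟩
    refine Submodule.sum_mem _ fun j _ => Submodule.smul_mem _ _ ?_
    exact harm_le_harmLE (by omega) ((harmBasis_spec hd _).1 j.2)

lemma sum_harmLEBasis_sq (hd : 3 ≤ d) (k : ℕ) (x : Sph d) :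
    ∑ j, harmLEBasis d k j x ^ 2 = ∑ l ∈ Finset.range (k + 1), (dimN l d : ℝ) := by
  rw [Fintype.sum_sigma, ← Fin.sum_univ_eq_sum_range (fun l => (dimN l d : ℝ))]
  refine Finset.sum_congr rfl fun l _ => ?_
  have := sum_harmBasis_mul hd l x x
  rw [zonal_self hd, mul_one] at this
  simpa [harmLEBasis, sq] using this

lemma card_harmIdx (k : ℕ) :
    (Fintype.card (HarmIdx d k) : ℝ) = ∑ l ∈ Finset.range (k + 1), (dimN l d : ℝ) := by
  rw [← Fin.sum_univ_eq_sum_range (fun l => (dimN l d : ℝ))]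
  simp [HarmIdx]

/-- Cauchy-Schwarz, with the squares of the basis summing to the dimension at every point. Both
passages from mean squares to suprema, for powers of the field's parts and for the regression error,
rest on it. -/
lemma harmExpand_sq_le (hd : 3 ≤ d) {k : ℕ} (a : HarmIdx d k → ℝ) (x : Sph d) :
    harmExpand a x ^ 2 ≤ (∑ j, a j ^ 2) * Fintype.card (HarmIdx d k) := by
  rw [harmExpand_apply, card_harmIdx, ← sum_harmLEBasis_sq hd k x]
  exact Finset.sum_mul_sq_le_sq_mul_sq _ _ _

lemma harmLE_sq_le (hd : 3 ≤ d) {k : ℕ} {g : C(Sph d, ℝ)} (hg : g ∈ harmLE d k) (x : Sph d) :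
    g x ^ 2 ≤ (∑ l ∈ Finset.range (k + 1), (dimN l d : ℝ)) * ∫ y, g y ^ 2 ∂(unif d) := by
  obtain ⟨a, rfl⟩ := (mem_harmLE_iff hd).mp hg
  rw [integral_harmExpand_sq hd, ← card_harmIdx, mul_comm]
  exact harmExpand_sq_le hd a x

/-- The degree `l` part of `harmExpand a`. -/
def harmPart {k : ℕ} (a : HarmIdx d k → ℝ) (l : Fin (k + 1)) : C(Sph d, ℝ) :=
  ∑ i, a ⟨l, i⟩ • harmBasis d l i

lemma harmExpand_eq_sum {k : ℕ} (a : HarmIdx d k → ℝ) : harmExpand a = ∑ l, harmPart a l := by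
  rw [harmExpand, Fintype.sum_sigma]
  rfl

lemma harmPart_mem (hd : 3 ≤ d) {k : ℕ} (a : HarmIdx d k → ℝ) (l : Fin (k + 1)) :
    harmPart a l ∈ harm d l :=
  Submodule.sum_mem _ fun i _ => Submodule.smul_mem _ _ ((harmBasis_spec hd l).1 i)

lemma integral_sum_harmBasis_sq (hd : 3 ≤ d) (l : ℕ) (a : Fin (dimN l d) → ℝ) :
    ∫ x, (∑ i, a i • harmBasis d l i) x * (∑ i, a i • harmBasis d l i) x ∂(unif d)
      = ∑ i, a i ^ 2 := by
  have e : ∀ x, (∑ i, a i • harmBasis d l i) x * (∑ i, a i • harmBasis d l i) x =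
      ∑ i, ∑ j, a i * a j * (harmBasis d l i x * harmBasis d l j x) := fun x => by
    simp only [ContinuousMap.coe_sum, Finset.sum_apply, ContinuousMap.smul_apply, smul_eq_mul]
    rw [Finset.sum_mul_sum]
    refine Finset.sum_congr rfl fun i _ => Finset.sum_congr rfl fun j _ => by ring
  simp only [e]
  rw [integral_finsetSum _ fun i _ => integrable_finsetSum _ fun j _ =>
    (integrable_coe_mul _ _).const_mul _]
  refine Finset.sum_congr rfl fun i _ => ?_
  rw [integral_finsetSum _ fun j _ => (integrable_coe_mul _ _).const_mul _]
  simp [integral_const_mul, (harmBasis_spec hd l).2.1, sq]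

lemma norm_projHarm_harmExpand_sq (hd : 3 ≤ d) {k : ℕ} (a : HarmIdx d k → ℝ) (l : Fin (k + 1)) :
    ‖projHarm d l (toL2 d (harmExpand a))‖ ^ 2 = ∑ i, a ⟨l, i⟩ ^ 2 := by
  have h1 : projHarm d l (toL2 d (harmExpand a)) = toL2 d (harmPart a l) := by
    have hmem : toL2 d (harmPart a l) ∈ harmL2 d l :=
      Submodule.mem_map_of_mem (f := (toL2 d).toLinearMap) (harmPart_mem hd a l)
    refine Submodule.eq_starProjection_of_mem_of_inner_eq_zero hmem ?_
    rintro _ ⟨h, hh, rfl⟩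
    change inner ℝ (_ - toL2 d (harmPart a l)) (toL2 d h) = 0
    rw [← map_sub, inner_toL2, harmExpand_eq_sum, ← Finset.add_sum_erase _ _ (Finset.mem_univ l),
      add_sub_cancel_left]
    simp only [ContinuousMap.coe_sum, Finset.sum_apply, Finset.sum_mul]
    rw [integral_finsetSum _ fun m _ => integrable_coe_mul _ _]
    refine Finset.sum_eq_zero fun m hm => ?_
    exact integral_harm_mul_eq_zero (by omega)
      (fun h => Finset.ne_of_mem_erase hm (Fin.ext h)) (harmPart_mem hd a m) hh
  rw [h1, ← real_inner_self_eq_norm_sq, inner_toL2]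
  exact integral_sum_harmBasis_sq hd l fun i => a ⟨l, i⟩

lemma mem_funClass_iff (hd : 3 ≤ d) {k : ℕ} {c₁ : ℝ} (hc : 0 ≤ c₁) {g : C(Sph d, ℝ)} :
    g ∈ funClass d k c₁ ↔ ∃ a : HarmIdx d k → ℝ, g = harmExpand a ∧
      ∀ l : Fin (k + 1), ∑ i, a ⟨l, i⟩ ^ 2 ≤ c₁ ^ 2 := by
  constructor
  · rintro ⟨hg, h⟩
    obtain ⟨a, rfl⟩ := (mem_harmLE_iff hd).mp hg
    refine ⟨a, rfl, fun l => ?_⟩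
    rw [← norm_projHarm_harmExpand_sq hd]
    exact pow_le_pow_left₀ (norm_nonneg _) (h l (by omega)) 2
  · rintro ⟨a, rfl, h⟩
    refine ⟨(mem_harmLE_iff hd).mpr ⟨a, rfl⟩, fun l hl => ?_⟩
    refine le_of_sq_le_sq ?_ hc
    have := norm_projHarm_harmExpand_sq hd a ⟨l, by omega⟩
    simp only at this
    rw [this]
    exact h _

end

/-! ### Growth of `N_{k,d}` -/

section
variable {d : ℕ}

lemma choose_add_le_pow (n j : ℕ) : (n + j).choose n ≤ (j + 1) ^ n := by
  induction n with
  | zero => simp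
  | succ n ih =>
    have h1 := Nat.add_one_mul_choose_eq (n + j) n
    refine Nat.le_of_mul_le_mul_right (c := n + 1) ?_ (by omega)
    rw [show n + 1 + j = n + j + 1 by omega, ← h1, pow_succ]
    calc (n + j + 1) * (n + j).choose n ≤ ((j + 1) * (n + 1)) * (j + 1) ^ n := by
          refine Nat.mul_le_mul ?_ ih
          nlinarith [Nat.zero_le (j * n)]
      _ = _ := by ring

lemma dimN_le_pow (j : ℕ) : dimN j d ≤ (j + 1) ^ (d - 1) := by
  refine (Nat.sub_le _ _).trans ?_
  rcases Nat.eq_zero_or_pos d with rfl | hd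
  · simp
  · have := choose_add_le_pow (d - 1) j
    rwa [show d - 1 + j = d + j - 1 by omega] at this

lemma sum_dimN_le (hd : 1 ≤ d) (m : ℕ) :
    ∑ l ∈ Finset.range (m + 1), (dimN l d : ℝ) ≤ ((m : ℝ) + 1) ^ d := by
  calc ∑ l ∈ Finset.range (m + 1), (dimN l d : ℝ)
      ≤ ∑ l ∈ Finset.range (m + 1), ((m : ℝ) + 1) ^ (d - 1) := by
        refine Finset.sum_le_sum fun l hl => ?_
        have h1 : (dimN l d : ℝ) ≤ ((l : ℝ) + 1) ^ (d - 1) := by exact_mod_cast dimN_le_pow l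
        have h2 : (l : ℝ) ≤ m := by
          have := Finset.mem_range.mp hl
          exact_mod_cast Nat.le_of_lt_succ this
        exact h1.trans (pow_le_pow_left₀ (by positivity) (by linarith) _)
    _ = ((m : ℝ) + 1) ^ d := by
        obtain ⟨e, rfl⟩ := Nat.exists_eq_add_of_le' hd
        simp [pow_succ, mul_comm]

/-- From the exact ratio in `dimN_succ`, discard the factor `(2l + d)/(2l + d - 2) ≥ 1`; what
remains is `(l + d - 2)/(l + 1)`. -/
lemma dimN_ratio (hd : 3 ≤ d) (l : ℕ) :
    (1 + (d - 3 : ℝ) / (l + 1)) * dimN l d ≤ dimN (l + 1) d := by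
  have hd' : (3 : ℝ) ≤ d := by exact_mod_cast hd
  have hl : (0 : ℝ) ≤ l := Nat.cast_nonneg l
  have hN : (0 : ℝ) < dimN l d := by exact_mod_cast dimN_pos hd l
  have h := dimN_succ hd l
  have h1 : 0 < ((l : ℝ) + 1) * (2 * l + d - 2) := mul_pos (by linarith) (by linarith)
  refine le_of_mul_le_mul_left ?_ h1
  rw [h, ← mul_assoc]
  refine mul_le_mul_of_nonneg_right ?_ hN.le
  have : ((l : ℝ) + 1) * (2 * l + d - 2) * (1 + (d - 3) / (l + 1)) = (2 * l + d - 2) * (l + d - 2) := by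
    field_simp
    ring
  rw [this]
  exact mul_le_mul_of_nonneg_right (by linarith) (by linarith)

/-- The hypothesis relating the dimension and the decay exponent. -/
def LargeDim (d : ℕ) (β : ℝ) : Prop := 10 * β⁻¹ * (2 : ℝ) ^ (5 / β) + 2 ≤ (d : ℝ)

variable {β : ℝ}

lemma LargeDim.two_pow_le (h : LargeDim d β) (hβ : 0 < β) (hβ1 : β ≤ 1) :
    10 * (2 : ℝ) ^ (5 / β) + 2 ≤ d := by
  have h1 : 1 ≤ β⁻¹ := (one_le_inv₀ hβ).mpr hβ1
  have h2 : (0 : ℝ) < (2 : ℝ) ^ (5 / β) := by positivity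
  unfold LargeDim at h
  nlinarith

lemma LargeDim.three_le (h : LargeDim d β) (hβ : 0 < β) (hβ1 : β ≤ 1) : 3 ≤ d := by
  have h1 := h.two_pow_le hβ hβ1
  have h2 : (1 : ℝ) ≤ (2 : ℝ) ^ (5 / β) := Real.one_le_rpow (by norm_num) (by positivity)
  have : (3 : ℝ) ≤ d := by linarith
  exact_mod_cast this

/-- On `[1, 2]` the convex function `t ↦ t^s` lies below its chord. -/
lemma one_add_rpow_le {x s : ℝ} (hx : 0 ≤ x) (hx1 : x ≤ 1) (hs : 1 ≤ s) :
    (1 + x) ^ s ≤ 1 + x * 2 ^ s := by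
  have h := (convexOn_rpow hs).2 (Set.mem_Ici.mpr (zero_le_one' ℝ)) (Set.mem_Ici.mpr (zero_le_two (α := ℝ)))
    (sub_nonneg.mpr hx1) hx (by ring)
  simp only [smul_eq_mul, mul_one, Real.one_rpow] at h
  rw [show 1 - x + x * 2 = 1 + x by ring] at h
  linarith

/-- Here the size of `d` does its work: `(1 + 1/l)^(5/β) ≤ 1 + 2^(5/β)/l`, and `d - 3` exceeds
`2^(5/β)` by more than the factor `(l + 1)/l ≤ 2` lost in `dimN_ratio`. -/
lemma LargeDim.rpow_mul_dimN_le (h : LargeDim d β) (hβ : 0 < β) (hβ1 : β ≤ 1) {l : ℕ} (hl : 1 ≤ l) :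
    (((l : ℝ) + 1) / l) ^ (5 / β) * dimN l d ≤ dimN (l + 1) d := by
  have hd := h.three_le hβ hβ1
  have hl' : (1 : ℝ) ≤ l := by exact_mod_cast hl
  refine le_trans (mul_le_mul_of_nonneg_right ?_ (Nat.cast_nonneg _)) (dimN_ratio hd l)
  have h1 : ((l : ℝ) + 1) / l = 1 + 1 / l := by field_simp
  have h5 : 1 ≤ 5 / β := by rw [le_div_iff₀ hβ]; linarith
  rw [h1]
  refine (one_add_rpow_le (by positivity) ((div_le_one (by linarith)).mpr hl') h5).trans ?_
  have h2 := h.two_pow_le hβ hβ1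
  have h3 : (1 : ℝ) ≤ (2 : ℝ) ^ (5 / β) := Real.one_le_rpow (by norm_num) (by positivity)
  rw [add_le_add_iff_left, one_div_mul_eq_div, div_le_div_iff₀ (by linarith) (by linarith)]
  nlinarith

/-- `l ^ (5/2) N_{l,d} ^ (-β/2)` is decreasing. -/
lemma LargeDim.antitone (h : LargeDim d β) (hβ : 0 < β) (hβ1 : β ≤ 1) {m l : ℕ} (hm : 1 ≤ m)
    (hml : m ≤ l) : (l : ℝ) ^ (5 / 2 : ℝ) * (dimN l d : ℝ) ^ (-β / 2) ≤
      (m : ℝ) ^ (5 / 2 : ℝ) * (dimN m d : ℝ) ^ (-β / 2) := by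
  have hd := h.three_le hβ hβ1
  induction l, hml using Nat.le_induction with
  | base => exact le_rfl
  | succ l hml ih =>
    refine le_trans ?_ ih
    have hl : (0 : ℝ) < l := by exact_mod_cast (by omega : 0 < l)
    have hN : (0 : ℝ) < dimN l d := by exact_mod_cast dimN_pos hd l
    have hN' : (0 : ℝ) < dimN (l + 1) d := by exact_mod_cast dimN_pos hd (l + 1)
    have h1 := h.rpow_mul_dimN_le hβ hβ1 (show 1 ≤ l by omega)
    have h2 := Real.rpow_le_rpow_of_nonpos (z := -β / 2) (by positivity) h1 (by linarith)
    rw [Real.mul_rpow (by positivity) hN.le, ← Real.rpow_mul (by positivity),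
      show 5 / β * (-β / 2) = -(5 / 2) by field_simp, Real.rpow_neg (by positivity),
      Real.div_rpow (by positivity) hl.le, inv_div] at h2
    push_cast
    calc ((l : ℝ) + 1) ^ (5 / 2 : ℝ) * (dimN (l + 1) d : ℝ) ^ (-β / 2)
        ≤ ((l : ℝ) + 1) ^ (5 / 2 : ℝ) * ((l : ℝ) ^ (5 / 2 : ℝ) / ((l : ℝ) + 1) ^ (5 / 2 : ℝ) *
            (dimN l d : ℝ) ^ (-β / 2)) := by gcongr
      _ = _ := by field_simp

lemma one_le_dimN (hd : 3 ≤ d) (l : ℕ) : (1 : ℝ) ≤ dimN l d := by exact_mod_cast dimN_pos hd l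

lemma LargeDim.pow_five_le (h : LargeDim d β) (hβ : 0 < β) (hβ1 : β ≤ 1) {l : ℕ} (hl : 1 ≤ l) :
    (l : ℝ) ^ 5 ≤ (dimN l d : ℝ) ^ β := by
  have hd := h.three_le hβ hβ1
  have hl' : (0 : ℝ) < l := by exact_mod_cast (by omega : 0 < l)
  have hN : (0 : ℝ) < dimN l d := by exact_mod_cast dimN_pos hd l
  have h1 := h.antitone hβ hβ1 le_rfl hl
  have h2 : (dimN 1 d : ℝ) ^ (-β / 2) ≤ 1 :=
    Real.rpow_le_one_of_one_le_of_nonpos (one_le_dimN hd 1) (by linarith)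
  rw [Nat.cast_one, Real.one_rpow, one_mul] at h1
  have h3 := h1.trans h2
  rw [neg_div, Real.rpow_neg hN.le, ← div_eq_mul_inv, div_le_one (by positivity)] at h3
  have h4 := pow_le_pow_left₀ (by positivity) h3 2
  rw [← Real.rpow_mul_natCast hl'.le, ← Real.rpow_mul_natCast hN.le] at h4
  norm_num at h4
  rw [← Real.rpow_natCast]
  exact_mod_cast h4

lemma dimN_mono (hd : 3 ≤ d) : Monotone fun l => dimN l d := by
  refine monotone_nat_of_le_succ fun l => ?_
  have h := dimN_ratio hd l
  have hd' : (3 : ℝ) ≤ d := by exact_mod_cast hd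
  have h1 : 0 ≤ (d - 3 : ℝ) / (l + 1) := div_nonneg (by linarith) (by positivity)
  have h2 := one_le_dimN hd l
  have : (dimN l d : ℝ) ≤ dimN (l + 1) d := by nlinarith
  exact_mod_cast this

lemma sum_inv_sq_le {m : ℕ} (n : ℕ) (hm : 1 ≤ m) :
    ∑ l ∈ Finset.Ico m n, 1 / (l : ℝ) ^ 2 ≤ 2 / (m : ℝ) := by
  have hm' : (1 : ℝ) ≤ m := by exact_mod_cast hm
  have key : ∀ n, m ≤ n → ∑ l ∈ Finset.Ico m n, 1 / (l : ℝ) ^ 2 ≤ 2 / (m : ℝ) - 2 / n := by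
    intro n hn
    induction n, hn using Nat.le_induction with
    | base => simp
    | succ n hn ih =>
      have hn' : (1 : ℝ) ≤ n := hm'.trans (by exact_mod_cast hn)
      rw [Finset.sum_Ico_succ_top hn]
      have : 1 / (n : ℝ) ^ 2 ≤ 2 / (n : ℝ) - 2 / ((n + 1 : ℕ) : ℝ) := by
        push_cast
        rw [div_sub_div _ _ (by positivity) (by positivity), div_le_div_iff₀ (by positivity)
          (by positivity)]
        nlinarith [mul_nonneg (by linarith : (0 : ℝ) ≤ n) (by linarith : (0 : ℝ) ≤ n - 1)]
      linarith
  rcases le_or_gt m n with h | h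
  · have := key n h
    have : (0 : ℝ) ≤ 2 / n := by positivity
    linarith
  · rw [Finset.Ico_eq_empty (by omega), Finset.sum_empty]
    positivity
end

/-! ### Moments of integrals of a Gaussian field -/

section
variable {Ω : Type*} [MeasurableSpace Ω] {P : Measure Ω}

lemma pow_le_factorial_mul_exp_add_exp (p : ℕ) {lam : ℝ} (hl : 0 < lam) (x : ℝ) :
    x ^ (2 * p) ≤ (2 * p).factorial / lam ^ (2 * p) * (Real.exp (lam * x) + Real.exp (-lam * x)) := by
  have h1 := Real.pow_div_factorial_le_exp |lam * x| (abs_nonneg _) (2 * p)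
  have h2 : Real.exp |lam * x| ≤ Real.exp (lam * x) + Real.exp (-lam * x) := by
    rcases abs_cases (lam * x) with ⟨h, _⟩ | ⟨h, _⟩
    · rw [h]; linarith [Real.exp_pos (-lam * x)]
    · rw [h, neg_mul]; linarith [Real.exp_pos (lam * x)]
  rw [(even_two_mul p).pow_abs, div_le_iff₀ (by positivity), mul_pow] at h1
  rw [div_mul_eq_mul_div, le_div_iff₀ (by positivity), mul_comm]
  refine h1.trans ?_
  rw [mul_comm]
  gcongr

lemma lintegral_pow_le_of_hasGaussianLaw {X : Ω → ℝ} (hX : HasGaussianLaw X P)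
    (h0 : ∫ ω, X ω ∂P = 0) {w : ℝ} (hw : 0 < w)
    (hv : ∫⁻ ω, ENNReal.ofReal (X ω ^ 2) ∂P ≤ ENNReal.ofReal w) {p : ℕ} (hp : 1 ≤ p) :
    ∫⁻ ω, ENNReal.ofReal (X ω ^ (2 * p)) ∂P ≤ ENNReal.ofReal ((12 * p * w) ^ p) := by
  have hp' : (1 : ℝ) ≤ p := by exact_mod_cast hp
  have hvar : Var[X; P] ≤ w := by
    have h1 := evariance_eq_lintegral_ofReal X P
    rw [h0] at h1
    simp only [sub_zero] at h1
    rw [variance, h1]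
    exact ENNReal.toReal_le_of_le_ofReal hw.le hv
  have hlaw := hX.map_eq_gaussianReal
  rw [h0] at hlaw
  -- With this `lam` each exponential moment is at most `exp p`, and `(2p)!/lam^(2p)` is at most `(2
  -- p w)^p`.
  set lam := √(2 * p / w)
  have hlam : 0 < lam := by positivity
  have hlam2 : lam ^ 2 = 2 * p / w := Real.sq_sqrt (by positivity)
  have hint : ∀ t : ℝ, Integrable (fun ω => Real.exp (t * X ω)) P := by
    intro t
    have := integrable_exp_mul_gaussianReal (μ := 0) (v := Var[X; P].toNNReal) t
    rw [← hlaw] at this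
    exact (integrable_map_measure (by fun_prop) hX.aemeasurable).mp this
  have hmgf : ∀ t : ℝ, t ^ 2 = 2 * p / w → ∫ ω, Real.exp (t * X ω) ∂P ≤ Real.exp p := by
    intro t ht
    have := mgf_gaussianReal hlaw t
    rw [mgf] at this
    rw [this, Real.exp_le_exp, ht, Real.coe_toNNReal _ (variance_nonneg _ _)]
    have : Var[X; P] * (2 * p / w) ≤ w * (2 * p / w) := by gcongr
    have e : w * (2 * p / w) = 2 * p := by field_simp
    linarith
  have hI : Integrable (fun ω => (2 * p).factorial / lam ^ (2 * p) *
      (Real.exp (lam * X ω) + Real.exp (-lam * X ω))) P := ((hint _).add (hint _)).const_mul _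
  calc ∫⁻ ω, ENNReal.ofReal (X ω ^ (2 * p)) ∂P
      ≤ ∫⁻ ω, ENNReal.ofReal ((2 * p).factorial / lam ^ (2 * p) *
          (Real.exp (lam * X ω) + Real.exp (-lam * X ω))) ∂P :=
        lintegral_mono fun ω => ENNReal.ofReal_le_ofReal
          (pow_le_factorial_mul_exp_add_exp p hlam (X ω))
    _ = ENNReal.ofReal (∫ ω, (2 * p).factorial / lam ^ (2 * p) *
          (Real.exp (lam * X ω) + Real.exp (-lam * X ω)) ∂P) :=
        (ofReal_integral_eq_lintegral_ofReal hI
          (Filter.Eventually.of_forall fun ω => by positivity)).symm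
    _ ≤ _ := by
        refine ENNReal.ofReal_le_ofReal ?_
        rw [integral_const_mul, integral_add (hint _) (hint _)]
        have hfac : ((2 * p).factorial : ℝ) ≤ (2 * p : ℝ) ^ (2 * p) := by
          exact_mod_cast Nat.factorial_le_pow (2 * p)
        have hexp : Real.exp p ≤ 3 ^ p := by
          rw [← Real.exp_one_pow]
          exact pow_le_pow_left₀ (Real.exp_pos _).le (by linarith [Real.exp_one_lt_d9]) _
        have h2 : (2 : ℝ) ≤ 2 ^ p := by
          simpa using pow_le_pow_right₀ (one_le_two (α := ℝ)) hp
        calc ((2 * p).factorial : ℝ) / lam ^ (2 * p) *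
              (∫ ω, Real.exp (lam * X ω) ∂P + ∫ ω, Real.exp (-lam * X ω) ∂P)
            ≤ (2 * p : ℝ) ^ (2 * p) / lam ^ (2 * p) * (3 ^ p + 3 ^ p) := by
              gcongr
              · exact (hmgf _ hlam2).trans hexp
              · exact (hmgf _ (by rw [neg_sq, hlam2])).trans hexp
          _ = 2 * (6 * p * w) ^ p := by
              rw [pow_mul, pow_mul, hlam2, ← div_pow]
              rw [show (2 * p : ℝ) ^ 2 / (2 * p / w) = 2 * p * w by field_simp]
              rw [← two_mul, mul_left_comm, ← mul_pow]
              ring_nf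
          _ ≤ 2 ^ p * (6 * p * w) ^ p := by gcongr
          _ = (12 * p * w) ^ p := by rw [← mul_pow]; ring_nf
end

/-! ### Monte Carlo approximation of integrals -/

lemma lintegral_sq_average_sub_le {S : Type*} [MeasurableSpace S] {s : Measure S}
    [IsProbabilityMeasure s] {g : S → ℝ} (hg : Measurable g) {m : ℕ} (hm : 0 < m) :
    ∫⁻ y : Fin m → S, ENNReal.ofReal (((m : ℝ)⁻¹ * ∑ i, g (y i) - ∫ z, g z ∂s) ^ 2)
      ∂(Measure.pi fun _ => s) ≤ ENNReal.ofReal (1 / m) * ∫⁻ z, ENNReal.ofReal (g z ^ 2) ∂s := by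
  by_cases hL : MemLp g 2 s
  swap
  · have : ∫⁻ z, ENNReal.ofReal (g z ^ 2) ∂s = ⊤ := by
      by_contra hne
      refine hL ((memLp_two_iff_integrable_sq hg.aestronglyMeasurable).mpr
        ⟨(hg.pow_const 2).aestronglyMeasurable, ?_⟩)
      rw [hasFiniteIntegral_iff_ofReal (Filter.Eventually.of_forall fun z => sq_nonneg _)]
      exact lt_top_iff_ne_top.mpr hne
    rw [this, ENNReal.mul_top (by simp [hm])]
    exact le_top
  set Z : (Fin m → S) → ℝ := fun y => (m : ℝ)⁻¹ * ∑ i, g (y i)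
  have hm' : (0 : ℝ) < m := by exact_mod_cast hm
  have hcomp : ∀ i : Fin m, MemLp (fun y : Fin m → S => g (y i)) 2 (Measure.pi fun _ => s) :=
    fun i => hL.comp_measurePreserving (measurePreserving_eval (fun _ => s) i)
  have hZ : MemLp Z 2 (Measure.pi fun _ => s) :=
    (memLp_finsetSum _ fun i _ => hcomp i).const_mul _
  have hmean : ∫ y, Z y ∂(Measure.pi fun _ => s) = ∫ z, g z ∂s := by
    simp only [Z]
    rw [integral_const_mul, integral_finsetSum _ fun i _ => (hcomp i).integrable (by norm_num)]
    have : ∀ i : Fin m, ∫ y : Fin m → S, g (y i) ∂(Measure.pi fun _ => s) = ∫ z, g z ∂s :=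
      fun i => integral_comp_eval (μ := fun _ => s) hg.aestronglyMeasurable
    simp only [this, Finset.sum_const, Finset.card_univ, Fintype.card_fin, nsmul_eq_mul]
    field_simp
  have hvar : Var[Z; Measure.pi fun _ => s] = (m : ℝ)⁻¹ * Var[g; s] := by
    have h1 := variance_sum_pi (μ := fun _ : Fin m => s) (X := fun _ => g) fun _ => hL
    have h2 : Z = fun y => (m : ℝ)⁻¹ * (∑ i, fun y : Fin m → S => g (y i)) y := by
      ext y; simp [Z]
    rw [h2, variance_const_mul, h1]
    simp only [Finset.sum_const, Finset.card_univ, Fintype.card_fin, nsmul_eq_mul]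
    field_simp
  rw [← hmean, ← evariance_eq_lintegral_ofReal, ← hZ.ofReal_variance_eq, hvar]
  have h3 : Var[g; s] ≤ ∫ z, g z ^ 2 ∂s := variance_le_expectation_sq hg.aestronglyMeasurable
  rw [← ofReal_integral_eq_lintegral_ofReal hL.integrable_sq
    (Filter.Eventually.of_forall fun z => sq_nonneg _), ← ENNReal.ofReal_mul (by positivity)]
  refine ENNReal.ofReal_le_ofReal ?_
  rw [one_div]
  gcongr

/-- Probabilistic method: average the `L²(P)` error over random sample points and exchange the
integrals. Some tuple does no worse than the mean, and this deterministic tuple serves all `ω` at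
once. -/
lemma exists_average_approx {Ω S : Type*} [MeasurableSpace Ω] [MeasurableSpace S]
    {P : Measure Ω} [IsProbabilityMeasure P] {s : Measure S}
    [IsProbabilityMeasure s] {g : Ω → S → ℝ} (hg : Measurable (Function.uncurry g)) {B : ENNReal}
    (hB : ∫⁻ ω, ∫⁻ z, ENNReal.ofReal (g ω z ^ 2) ∂s ∂P ≤ B) {m : ℕ} (hm : 0 < m) :
    ∃ y : Fin m → S, ∫⁻ ω, ENNReal.ofReal (((m : ℝ)⁻¹ * ∑ i, g ω (y i) - ∫ z, g ω z ∂s) ^ 2) ∂P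
      ≤ ENNReal.ofReal (1 / m) * B := by
  have hmean : Measurable fun ω => ∫ z, g ω z ∂s :=
    (hg.stronglyMeasurable.integral_prod_right (ν := s)).measurable
  have hmeas : Measurable fun q : (Fin m → S) × Ω =>
      ENNReal.ofReal (((m : ℝ)⁻¹ * ∑ i, g q.2 (q.1 i) - ∫ z, g q.2 z ∂s) ^ 2) := by
    refine (((Finset.measurable_fun_sum _ fun i _ => ?_).const_mul _).sub
      (hmean.comp measurable_snd)).pow_const 2 |>.ennreal_ofReal
    exact hg.comp (measurable_snd.prodMk ((measurable_pi_apply i).comp measurable_fst))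
  obtain ⟨y, hy⟩ := exists_le_lintegral (μ := Measure.pi fun _ : Fin m => s)
    (f := fun y => ∫⁻ ω, ENNReal.ofReal (((m : ℝ)⁻¹ * ∑ i, g ω (y i) - ∫ z, g ω z ∂s) ^ 2) ∂P)
    (hmeas.lintegral_prod_right').aemeasurable
  refine ⟨y, hy.trans ?_⟩
  rw [lintegral_lintegral_swap hmeas.aemeasurable]
  calc _ ≤ ∫⁻ ω, ENNReal.ofReal (1 / m) * ∫⁻ z, ENNReal.ofReal (g ω z ^ 2) ∂s ∂P :=
        lintegral_mono fun ω => lintegral_sq_average_sub_le (hg.comp measurable_prodMk_left) hm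
    _ ≤ _ := by
        rw [lintegral_const_mul' _ _ ENNReal.ofReal_ne_top]
        gcongr

/-! ### The degree `k` part of an isotropic Gaussian field -/

section
variable {d : ℕ} {Ω : Type*} [MeasurableSpace Ω] {P : Measure Ω}
  {κ : ℝ → ℝ} {f : Ω → Sph d → ℝ}

/-- The covariance function, made constant outside of `[-1, 1]`. -/
def clampedCov (κ : ℝ → ℝ) (t : ℝ) : ℝ := κ (max (-1) (min 1 t))

lemma clampedCov_eq (κ : ℝ → ℝ) {t : ℝ} (ht : t ∈ Set.Icc (-1 : ℝ) 1) : clampedCov κ t = κ t := by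
  rw [clampedCov, min_eq_right ht.2, max_eq_right ht.1]

/-- The integral of the field against a function on the sphere. -/
def fieldInt (f : Ω → Sph d → ℝ) (h : C(Sph d, ℝ)) (ω : Ω) : ℝ := ∫ y, f ω y * h y ∂(unif d)

namespace IsIsotropicGRF

lemma measurable_right (hf : IsIsotropicGRF P d κ f) (x : Sph d) : Measurable fun ω => f ω x :=
  hf.measurable.comp (measurable_id.prodMk measurable_const)

lemma measurable_left (hf : IsIsotropicGRF P d κ f) (ω : Ω) : Measurable (f ω) :=
  hf.measurable.comp measurable_prodMk_left

lemma memLp (hf : IsIsotropicGRF P d κ f) (x : Sph d) : MemLp (fun ω => f ω x) 2 P :=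
  (hf.gaussian.hasGaussianLaw_eval x).memLp_two

lemma measurable_fieldInt (hf : IsIsotropicGRF P d κ f) (h : C(Sph d, ℝ)) :
    Measurable (fieldInt f h) := by
  have hm : Measurable fun q : Ω × Sph d => f q.1 q.2 * h q.2 :=
    hf.measurable.mul (h.continuous.measurable.comp measurable_snd)
  have : SFinite (unif d) := by rw [unif_eq]; infer_instance
  exact hm.stronglyMeasurable.integral_prod_right.measurable

variable [IsProbabilityMeasure P]

lemma integral_mul (hf : IsIsotropicGRF P d κ f) (x y : Sph d) :
    ∫ ω, f ω x * f ω y ∂P = κ (inner ℝ x.1 y.1) := by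
  have h := covariance_eq_sub (hf.memLp x) (hf.memLp y)
  rw [hf.cov, hf.mean, zero_mul, sub_zero] at h
  exact h.symm

lemma integral_sq (hf : IsIsotropicGRF P d κ f) (x : Sph d) : ∫ ω, f ω x ^ 2 ∂P = κ 1 := by
  have := hf.integral_mul x x
  rw [real_inner_self_eq_norm_sq, norm_eq_of_mem_sphere, one_pow] at this
  simpa only [sq] using this

lemma abs_cov_le (hf : IsIsotropicGRF P d κ f) (x y : Sph d) : |κ (inner ℝ x.1 y.1)| ≤ κ 1 := by
  rw [← hf.integral_mul]
  calc |∫ ω, f ω x * f ω y ∂P| ≤ ∫ ω, |f ω x * f ω y| ∂P := abs_integral_le_integral_abs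
    _ ≤ ∫ ω, (f ω x ^ 2 + f ω y ^ 2) / 2 ∂P := by
        refine integral_mono ((hf.memLp x).integrable_mul (hf.memLp y)).abs
          (((hf.memLp x).integrable_sq.add (hf.memLp y).integrable_sq).div_const 2) fun ω => ?_
        simp only [abs_mul]
        nlinarith [sq_nonneg (|f ω x| - |f ω y|), sq_abs (f ω x), sq_abs (f ω y)]
    _ = κ 1 := by
        rw [integral_div, integral_add (hf.memLp x).integrable_sq (hf.memLp y).integrable_sq,
          hf.integral_sq, hf.integral_sq]
        ring

/-- Every number in `[-1, 1]` is an inner product of a fixed and a measurably chosen point. -/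
lemma _root_.SphereRecovery.exists_measurable_curve (hd : 3 ≤ d) : ∃ (x : Sph d) (γ : ℝ → Sph d),
    Measurable γ ∧ ∀ t, inner ℝ x.1 (γ t).1 = max (-1) (min 1 t) := by
  have h01 : (⟨0, by omega⟩ : Fin d) ≠ ⟨1, by omega⟩ := by simp
  set i : Fin d := ⟨0, by omega⟩
  set j : Fin d := ⟨1, by omega⟩
  let v : ℝ → EuclideanSpace ℝ (Fin d) := fun t =>
    EuclideanSpace.single i (max (-1) (min 1 t)) +
      EuclideanSpace.single j (√(1 - (max (-1) (min 1 t)) ^ 2))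
  have hin : ∀ a b : ℝ, inner ℝ (EuclideanSpace.single i a : EuclideanSpace ℝ (Fin d))
      (EuclideanSpace.single j b) = 0 := fun a b => by
    simp [EuclideanSpace.inner_single_left, h01]
  have hv : ∀ t, v t ∈ Metric.sphere (0 : EuclideanSpace ℝ (Fin d)) 1 := by
    intro t
    have hle : (max (-1) (min 1 t)) ^ 2 ≤ 1 := by
      rw [sq_le_one_iff_abs_le_one, abs_le]
      exact ⟨le_max_left _ _, max_le (by norm_num) (min_le_left _ _)⟩
    rw [mem_sphere_zero_iff_norm, ← pow_eq_one_iff_of_nonneg (norm_nonneg _) two_ne_zero,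
      norm_add_sq_real, hin, PiLp.norm_single, PiLp.norm_single,
      Real.norm_eq_abs, Real.norm_eq_abs, sq_abs, sq_abs, Real.sq_sqrt (by linarith)]
    ring
  have hc : Continuous v := by
    have hs : ∀ k : Fin d, Continuous fun a : ℝ => (EuclideanSpace.single k a : EuclideanSpace ℝ (Fin d)) := by
      intro k
      refine (PiLp.continuous_toLp 2 _).comp ?_
      exact continuous_single (A := fun _ : Fin d => ℝ) k
    exact ((hs i).comp (by fun_prop)).add ((hs j).comp (by fun_prop))
  refine ⟨⟨EuclideanSpace.single i 1, by simp⟩, fun t => ⟨v t, hv t⟩,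
    (hc.subtype_mk hv).measurable, fun t => ?_⟩
  simp only [v]
  rw [inner_add_right, hin]
  simp [EuclideanSpace.inner_single_left]

/-- No regularity of `κ` is assumed. Along a measurable curve with prescribed inner products `κ` is
an expectation of field values, so it inherits measurability from the field. -/
lemma measurable_clampedCov (hd : 3 ≤ d) (hf : IsIsotropicGRF P d κ f) :
    Measurable (clampedCov κ) := by
  obtain ⟨x, γ, hγ, h⟩ := exists_measurable_curve hd
  have e : clampedCov κ = fun t => ∫ ω, f ω x * f ω (γ t) ∂P := by
    ext t
    rw [hf.integral_mul, h, clampedCov]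
  rw [e]
  have hm : Measurable fun q : ℝ × Ω => f q.2 x * f q.2 (γ q.1) :=
    ((hf.measurable_right x).comp measurable_snd).mul
      (hf.measurable.comp (measurable_snd.prodMk (hγ.comp measurable_fst)))
  exact hm.stronglyMeasurable.integral_prod_right.measurable

lemma abs_clampedCov_le (hd : 3 ≤ d) (hf : IsIsotropicGRF P d κ f) (t : ℝ) :
    |clampedCov κ t| ≤ κ 1 := by
  obtain ⟨x, γ, -, h⟩ := exists_measurable_curve hd
  rw [clampedCov, ← h]
  exact hf.abs_cov_le x (γ t)

lemma cov_nonneg (hd : 3 ≤ d) (hf : IsIsotropicGRF P d κ f) : 0 ≤ κ 1 :=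
  (abs_nonneg _).trans (hf.abs_clampedCov_le hd 0)

/-- The eigenvalue of the covariance operator on the spherical harmonics of degree `k`. -/
lemma integral_cov_mul_harm (hd : 3 ≤ d) (hf : IsIsotropicGRF P d κ f) {k : ℕ} {h : C(Sph d, ℝ)}
    (hh : h ∈ harm d k) (x : Sph d) : ∫ y, κ (inner ℝ x.1 y.1) * h y ∂(unif d) =
      h x * (legendreCoeff d k κ / √(dimN k d)) := by
  have hN := one_le_dimN hd k
  have h1 := integral_comp_inner_mul_harm hd x hh (hf.measurable_clampedCov hd)
    (fun t _ => hf.abs_clampedCov_le hd t)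
  have e : ∀ y : Sph d, clampedCov κ (inner ℝ x.1 y.1) = κ (inner ℝ x.1 y.1) :=
    fun y => clampedCov_eq κ (innerMap_mem_Icc x y)
  simp only [zonal_apply] at h1
  rw [integral_comp_inner hd x (F := fun t => clampedCov κ t * legendreP d k t)
    ((hf.measurable_clampedCov hd).mul (continuous_legendreP k).measurable)] at h1
  simp only [e] at h1
  rw [h1]
  congr 1
  rw [eq_div_iff (by positivity), legendreCoeff, ← intervalIntegral.integral_mul_const]
  refine intervalIntegral.integral_congr fun t ht => ?_
  rw [Set.uIcc_of_le (by norm_num)] at ht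
  rw [clampedCov_eq κ ht, legendrePBar]
  ring

lemma lintegral_sq_mul_le (hd : 3 ≤ d) (hf : IsIsotropicGRF P d κ f) (h : C(Sph d, ℝ)) :
    ∫⁻ ω, ∫⁻ y, ENNReal.ofReal ((f ω y * h y) ^ 2) ∂(unif d) ∂P ≤ ENNReal.ofReal (‖h‖ ^ 2 * κ 1) := by
  have := isProbabilityMeasure_unif (d := d) (by omega)
  have hm : Measurable fun q : Ω × Sph d => ENNReal.ofReal ((f q.1 q.2 * h q.2) ^ 2) :=
    ((hf.measurable.mul (h.continuous.measurable.comp measurable_snd)).pow_const 2).ennreal_ofReal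
  rw [lintegral_lintegral_swap hm.aemeasurable]
  calc _ ≤ ∫⁻ _ : Sph d, ENNReal.ofReal (‖h‖ ^ 2 * κ 1) ∂(unif d) := by
        refine lintegral_mono fun y => ?_
        rw [← hf.integral_sq y, ← integral_const_mul, ofReal_integral_eq_lintegral_ofReal
          ((hf.memLp y).integrable_sq.const_mul _)
          (Filter.Eventually.of_forall fun ω => by positivity)]
        refine lintegral_mono fun ω => ENNReal.ofReal_le_ofReal ?_
        rw [mul_pow, mul_comm]
        refine mul_le_mul_of_nonneg_right ?_ (sq_nonneg _)
        rw [← sq_abs (h y)]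
        exact pow_le_pow_left₀ (abs_nonneg _) (h.norm_coe_le_norm y) 2
    _ = _ := by simp

lemma memLp_prod (hd : 3 ≤ d) (hf : IsIsotropicGRF P d κ f) (h : C(Sph d, ℝ)) :
    MemLp (fun q : Ω × Sph d => f q.1 q.2 * h q.2) 2 (P.prod (unif d)) := by
  have := isProbabilityMeasure_unif (d := d) (by omega)
  have hm : Measurable fun q : Ω × Sph d => f q.1 q.2 * h q.2 :=
    hf.measurable.mul (h.continuous.measurable.comp measurable_snd)
  refine (memLp_two_iff_integrable_sq hm.aestronglyMeasurable).mpr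
    ⟨(hm.pow_const 2).aestronglyMeasurable, ?_⟩
  rw [hasFiniteIntegral_iff_ofReal (Filter.Eventually.of_forall fun z => sq_nonneg _),
    lintegral_prod _ (hm.pow_const 2).ennreal_ofReal.aemeasurable]
  exact (hf.lintegral_sq_mul_le hd h).trans_lt ENNReal.ofReal_lt_top

lemma ae_memLp (hd : 3 ≤ d) (hf : IsIsotropicGRF P d κ f) : ∀ᵐ ω ∂P, MemLp (f ω) 2 (unif d) := by
  have := isProbabilityMeasure_unif (d := d) (by omega)
  have h := (hf.memLp_prod hd 1).integrable_sq.prod_right_ae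
  filter_upwards [h] with ω hω
  refine (memLp_two_iff_integrable_sq (hf.measurable_left ω).aestronglyMeasurable).mpr ?_
  simpa using hω

lemma memLp_fieldInt (hd : 3 ≤ d) (hf : IsIsotropicGRF P d κ f) (h : C(Sph d, ℝ)) :
    MemLp (fieldInt f h) 2 P := by
  have := isProbabilityMeasure_unif (d := d) (by omega)
  refine (memLp_two_iff_integrable_sq (hf.measurable_fieldInt h).aestronglyMeasurable).mpr ?_
  refine Integrable.mono' (hf.memLp_prod hd h).integrable_sq.integral_prod_left
    ((hf.measurable_fieldInt h).pow_const 2).aestronglyMeasurable ?_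
  filter_upwards [hf.ae_memLp hd] with ω hω
  have hL : MemLp (fun y => f ω y * h y) 2 (unif d) := by
    refine (memLp_two_iff_integrable_sq
      ((hf.measurable_left ω).mul h.continuous.measurable).aestronglyMeasurable).mpr ?_
    refine Integrable.congr ?_ (Filter.Eventually.of_forall fun y => (mul_pow (f ω y) (h y) 2).symm)
    exact hω.integrable_sq.mul_bdd (c := ‖h‖ ^ 2) (h.continuous.pow 2).aestronglyMeasurable
      (Filter.Eventually.of_forall fun y => by
        rw [norm_pow]; exact pow_le_pow_left₀ (norm_nonneg _) (h.norm_coe_le_norm y) 2)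
  have h1 := variance_eq_sub hL
  have h2 := variance_nonneg (fun y => f ω y * h y) (unif d)
  have h3 : ∫ y, ((fun y => f ω y * h y) ^ 2) y ∂(unif d) = ∫ y, (f ω y * h y) ^ 2 ∂(unif d) := rfl
  rw [Real.norm_eq_abs, abs_of_nonneg (sq_nonneg _)]
  rw [fieldInt]
  linarith

/-- By Fubini the left side is the covariance operator applied to `h`, and spherical harmonics are
its eigenfunctions by Funk-Hecke. -/
lemma integral_fieldInt_mul (hd : 3 ≤ d) (hf : IsIsotropicGRF P d κ f) {k : ℕ} {h : C(Sph d, ℝ)}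
    (hh : h ∈ harm d k) (y : Sph d) : ∫ ω, fieldInt f h ω * f ω y ∂P =
      h y * (legendreCoeff d k κ / √(dimN k d)) := by
  have := isProbabilityMeasure_unif (d := d) (by omega)
  have hI : Integrable (fun q : Ω × Sph d => (f q.1 q.2 * h q.2) * f q.1 y) (P.prod (unif d)) :=
    (hf.memLp_prod hd h).integrable_mul ((hf.memLp y).comp_fst (unif d))
  rw [← hf.integral_cov_mul_harm hd hh]
  simp only [fieldInt, ← integral_mul_const]
  rw [integral_integral_swap hI]
  refine integral_congr_ae (Filter.Eventually.of_forall fun z => ?_)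
  simp only
  rw [← hf.integral_mul y z, ← integral_mul_const]
  refine integral_congr_ae (Filter.Eventually.of_forall fun ω => ?_)
  simp only
  ring

lemma integral_fieldInt_sq (hd : 3 ≤ d) (hf : IsIsotropicGRF P d κ f) {k : ℕ} {h : C(Sph d, ℝ)}
    (hh : h ∈ harm d k) : ∫ ω, fieldInt f h ω ^ 2 ∂P =
      (legendreCoeff d k κ / √(dimN k d)) * ∫ y, h y ^ 2 ∂(unif d) := by
  have := isProbabilityMeasure_unif (d := d) (by omega)
  have hI : Integrable (fun q : Ω × Sph d => fieldInt f h q.1 * (f q.1 q.2 * h q.2))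
      (P.prod (unif d)) :=
    ((hf.memLp_fieldInt hd h).comp_fst (unif d)).integrable_mul (hf.memLp_prod hd h)
  have e : ∀ ω, fieldInt f h ω ^ 2 = ∫ y, fieldInt f h ω * (f ω y * h y) ∂(unif d) := fun ω => by
    rw [integral_const_mul, sq, fieldInt]
  simp only [e]
  rw [integral_integral_swap hI, ← integral_const_mul]
  refine integral_congr_ae (Filter.Eventually.of_forall fun y => ?_)
  simp only [← mul_assoc]
  rw [integral_mul_const, hf.integral_fieldInt_mul hd hh]
  ring

/-- Moments of the integral of the field against a spherical harmonic. -/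
lemma lintegral_fieldInt_pow_le (hd : 3 ≤ d) (hf : IsIsotropicGRF P d κ f) {h : C(Sph d, ℝ)}
    {w : ℝ} (hw : 0 < w) (hv : ∫ ω, fieldInt f h ω ^ 2 ∂P ≤ w) {p : ℕ} (hp : 1 ≤ p) :
    ∫⁻ ω, ENNReal.ofReal (fieldInt f h ω ^ (2 * p)) ∂P ≤ ENNReal.ofReal ((36 * p * w) ^ p) := by
  have := isProbabilityMeasure_unif (d := d) (by omega)
  set B := ‖h‖ ^ 2 * κ 1
  have hB : 0 ≤ B := mul_nonneg (sq_nonneg _) (hf.cov_nonneg hd)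
  have hm : Measurable (Function.uncurry fun ω y => f ω y * h y) :=
    hf.measurable.mul (h.continuous.measurable.comp measurable_snd)
  -- Samples of size `2^(J+j)` have mean-square error at most `w/2 * 2^(-j)`: below `w/2` from the
  -- start, and summable.
  obtain ⟨J, hJ⟩ : ∃ J : ℕ, 2 * B / w ≤ 2 ^ J := by
    obtain ⟨J, hJ⟩ := pow_unbounded_of_one_lt (2 * B / w) one_lt_two
    exact ⟨J, hJ.le⟩
  have hex : ∀ j : ℕ, ∃ y : Fin (2 ^ (J + j)) → Sph d, ∫⁻ ω, ENNReal.ofReal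
      ((((2 ^ (J + j) : ℕ) : ℝ)⁻¹ * ∑ i, f ω (y i) * h (y i) - fieldInt f h ω) ^ 2) ∂P ≤
      ENNReal.ofReal (1 / (2 ^ (J + j) : ℕ)) * ENNReal.ofReal B := fun j =>
    exists_average_approx hm (hf.lintegral_sq_mul_le hd h) (by positivity)
  choose y hy using hex
  set Sm : ℕ → Ω → ℝ := fun j ω => ((2 ^ (J + j) : ℕ) : ℝ)⁻¹ * ∑ i, f ω (y j i) * h (y j i)
  -- Only these finite linear combinations need to be Gaussian; the moment bound reaches the
  -- integral itself through Fatou's lemma.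
  have hSg : ∀ j, HasGaussianLaw (Sm j) P := by
    intro j
    have h1 := ((hf.gaussian.comp_right (y j)).smul fun i => h (y j i)).hasGaussianLaw_fun_sum
      (I := Finset.univ)
    have h2 := h1.fun_smul ((2 ^ (J + j) : ℕ) : ℝ)⁻¹
    simpa [Sm, mul_comm] using h2
  have hSm : ∀ j, Measurable (Sm j) := fun j =>
    (Finset.measurable_fun_sum _ fun i _ => (hf.measurable_right _).mul_const _).const_mul _
  have hS0 : ∀ j, ∫ ω, Sm j ω ∂P = 0 := by
    intro j
    simp only [Sm]
    rw [integral_const_mul, integral_finsetSum _ fun i _ =>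
      ((hf.memLp _).integrable (by norm_num)).mul_const _]
    simp [integral_mul_const, hf.mean]
  have hbound : ∀ j, ∫⁻ ω, ENNReal.ofReal ((Sm j ω - fieldInt f h ω) ^ 2) ∂P ≤
      ENNReal.ofReal (w / 2 * (1 / 2) ^ j) := by
    intro j
    refine (hy j).trans ?_
    rw [← ENNReal.ofReal_mul (by positivity)]
    refine ENNReal.ofReal_le_ofReal ?_
    push_cast
    rw [div_le_iff₀ hw] at hJ
    rw [pow_add, one_div_pow, one_div_mul_eq_div, div_le_iff₀ (by positivity)]
    field_simp
    linarith
  -- `3w = 2w + 2 (w/2)` comes from `(a + b)² ≤ 2a² + 2b²`; it turns the constant 12 into 36.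
  have hSv : ∀ j, ∫⁻ ω, ENNReal.ofReal (Sm j ω ^ 2) ∂P ≤ ENNReal.ofReal (3 * w) := by
    intro j
    have h1 : ∫⁻ ω, ENNReal.ofReal (fieldInt f h ω ^ 2) ∂P ≤ ENNReal.ofReal w := by
      rw [← ofReal_integral_eq_lintegral_ofReal (hf.memLp_fieldInt hd h).integrable_sq
        (Filter.Eventually.of_forall fun ω => sq_nonneg _)]
      exact ENNReal.ofReal_le_ofReal hv
    have h2 : ∫⁻ ω, ENNReal.ofReal ((Sm j ω - fieldInt f h ω) ^ 2) ∂P ≤ ENNReal.ofReal (w / 2) := by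
      refine (hbound j).trans (ENNReal.ofReal_le_ofReal ?_)
      exact mul_le_of_le_one_right (by positivity) (pow_le_one₀ (by norm_num) (by norm_num))
    calc ∫⁻ ω, ENNReal.ofReal (Sm j ω ^ 2) ∂P
        ≤ ∫⁻ ω, (ENNReal.ofReal 2 * ENNReal.ofReal (fieldInt f h ω ^ 2) +
            ENNReal.ofReal 2 * ENNReal.ofReal ((Sm j ω - fieldInt f h ω) ^ 2)) ∂P := by
          refine lintegral_mono fun ω => ?_
          rw [← ENNReal.ofReal_mul (by norm_num), ← ENNReal.ofReal_mul (by norm_num),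
            ← ENNReal.ofReal_add (by positivity) (by positivity)]
          refine ENNReal.ofReal_le_ofReal ?_
          nlinarith [sq_nonneg (Sm j ω - 2 * fieldInt f h ω)]
      _ ≤ ENNReal.ofReal 2 * ENNReal.ofReal w + ENNReal.ofReal 2 * ENNReal.ofReal (w / 2) := by
          rw [lintegral_add_left
            (((hf.measurable_fieldInt h).pow_const 2).ennreal_ofReal.const_mul _),
            lintegral_const_mul' _ _ ENNReal.ofReal_ne_top,
            lintegral_const_mul' _ _ ENNReal.ofReal_ne_top]
          gcongr
      _ = ENNReal.ofReal (3 * w) := by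
          rw [← ENNReal.ofReal_mul (by norm_num), ← ENNReal.ofReal_mul (by norm_num),
            ← ENNReal.ofReal_add (by positivity) (by positivity)]
          congr 1; ring
  have hlim : ∀ᵐ ω ∂P, Filter.Tendsto (fun j => Sm j ω) Filter.atTop (nhds (fieldInt f h ω)) := by
    have hmj : ∀ j, AEMeasurable (fun ω => ENNReal.ofReal ((Sm j ω - fieldInt f h ω) ^ 2)) P :=
      fun j => (((hSm j).sub (hf.measurable_fieldInt h)).pow_const 2).ennreal_ofReal.aemeasurable
    have hsum : ∫⁻ ω, ∑' j, ENNReal.ofReal ((Sm j ω - fieldInt f h ω) ^ 2) ∂P ≠ ⊤ := by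
      rw [lintegral_tsum hmj]
      refine ne_top_of_le_ne_top ?_ (ENNReal.tsum_le_tsum hbound)
      rw [← ENNReal.ofReal_tsum_of_nonneg (fun j => by positivity)
        ((summable_geometric_of_lt_one (by norm_num) (by norm_num)).mul_left _)]
      exact ENNReal.ofReal_ne_top
    have hae := ae_lt_top' (AEMeasurable.tsum hmj) hsum
    filter_upwards [hae] with ω hω
    have h1 := ENNReal.tendsto_atTop_zero_of_tsum_ne_top hω.ne
    have h2 := (ENNReal.tendsto_toReal ENNReal.zero_ne_top).comp h1
    have h3 : Filter.Tendsto (fun j => (Sm j ω - fieldInt f h ω) ^ 2) Filter.atTop (nhds 0) := by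
      refine h2.congr fun j => ?_
      simp [ENNReal.toReal_ofReal (sq_nonneg _)]
    have h4 := h3.sqrt
    simp only [Real.sqrt_sq_eq_abs, Real.sqrt_zero] at h4
    have h5 := (tendsto_zero_iff_abs_tendsto_zero _).mpr h4
    simpa using h5.add_const (fieldInt f h ω)
  calc ∫⁻ ω, ENNReal.ofReal (fieldInt f h ω ^ (2 * p)) ∂P
      = ∫⁻ ω, Filter.liminf (fun j => ENNReal.ofReal (Sm j ω ^ (2 * p))) Filter.atTop ∂P := by
        refine lintegral_congr_ae ?_
        filter_upwards [hlim] with ω hω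
        exact (ENNReal.tendsto_ofReal (hω.pow (2 * p))).liminf_eq.symm
    _ ≤ Filter.liminf (fun j => ∫⁻ ω, ENNReal.ofReal (Sm j ω ^ (2 * p)) ∂P) Filter.atTop :=
        lintegral_liminf_le fun j => ((hSm j).pow_const _).ennreal_ofReal
    _ ≤ Filter.liminf (fun _ : ℕ => ENNReal.ofReal ((12 * p * (3 * w)) ^ p)) Filter.atTop := by
        refine Filter.liminf_le_liminf (Filter.Eventually.of_forall fun j => ?_)
        exact lintegral_pow_le_of_hasGaussianLaw (hSg j) (hS0 j) (by positivity) (hSv j) hp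
    _ = ENNReal.ofReal ((36 * p * w) ^ p) := by
        rw [Filter.liminf_const]
        congr 2; ring

end IsIsotropicGRF
end

/-! ### From moments to uniform bounds -/

section
variable {d : ℕ}

lemma pow_mem_harmLE (hd : 1 ≤ d) {l : ℕ} {g : C(Sph d, ℝ)} (hg : g ∈ harm d l) (p : ℕ) :
    g ^ p ∈ harmLE d (l * p) := by
  obtain ⟨q, ⟨hq, -⟩, rfl⟩ := hg
  have e : restrictSph d q ^ p = restrictSph d (q ^ p) := by
    ext x
    simp [restrictSph_apply]
  rw [e]
  exact restrictSph_mem_harmLE hd _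
    (((MvPolynomial.mem_homogeneousSubmodule l q).mp hq).pow p)

lemma integral_sq_le_of_integral_pow_le (hd : 1 ≤ d) {g : C(Sph d, ℝ)} {p : ℕ} (hp : 1 ≤ p) {v : ℝ}
    (hv : 0 ≤ v) (h : ∫ x, g x ^ (2 * p) ∂(unif d) ≤ v ^ p) : ∫ x, g x ^ 2 ∂(unif d) ≤ v := by
  have := isProbabilityMeasure_unif hd
  refine le_of_pow_le_pow_left₀ (n := p) (by omega) hv (le_trans ?_ h)
  simp only [pow_mul]
  exact (convexOn_pow p).map_integral_le (continuous_pow p).continuousOn isClosed_Ici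
    (Filter.Eventually.of_forall fun x => sq_nonneg (g x))
    (continuous_integrable_unif (g ^ 2)) (continuous_integrable_unif ((g ^ 2) ^ p))

lemma natCast_le_exp_two_sqrt (n : ℕ) : (n : ℝ) ≤ Real.exp (2 * √n) := by
  have h1 : √(n : ℝ) ≤ Real.exp √n := by linarith [Real.add_one_le_exp √(n : ℝ)]
  calc (n : ℝ) = √n ^ 2 := (Real.sq_sqrt (Nat.cast_nonneg n)).symm
    _ ≤ Real.exp √n ^ 2 := pow_le_pow_left₀ (Real.sqrt_nonneg _) h1 2
    _ = Real.exp (2 * √n) := by rw [← Real.exp_nat_mul]; norm_num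

/-- From `n ≤ exp (2√n)` and `2 d √n ≤ d² + n`. The additive form is what makes `p` of order `d² +
l` sufficient below. -/
lemma natCast_pow_le_exp (d n : ℕ) : (n : ℝ) ^ d ≤ Real.exp (d ^ 2 + n) := by
  refine (pow_le_pow_left₀ (Nat.cast_nonneg n) (natCast_le_exp_two_sqrt n) d).trans ?_
  rw [← Real.exp_nat_mul, Real.exp_le_exp]
  nlinarith [sq_nonneg ((d : ℝ) - √n), Real.sq_sqrt (Nat.cast_nonneg (α := ℝ) n)]

lemma mul_add_one_pow_le {l p : ℕ} (hl : 1 ≤ l) (hp : d ^ 2 + l ≤ p) :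
    (((l * p : ℕ) : ℝ) + 1) ^ d ≤ Real.exp 4 ^ p := by
  have hl' : (1 : ℝ) ≤ l := by exact_mod_cast hl
  have hp' : (d : ℝ) ^ 2 + l ≤ p := by exact_mod_cast hp
  calc (((l * p : ℕ) : ℝ) + 1) ^ d ≤ ((l : ℝ) * (p + 1 : ℕ)) ^ d := by
        refine pow_le_pow_left₀ (by positivity) ?_ d
        push_cast
        linarith
    _ ≤ Real.exp (d ^ 2 + l) * Real.exp (d ^ 2 + (p + 1 : ℕ)) := by
        rw [mul_pow]
        gcongr <;> exact natCast_pow_le_exp _ _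
    _ ≤ Real.exp 4 ^ p := by
        rw [← Real.exp_add, ← Real.exp_nat_mul, Real.exp_le_exp]
        push_cast
        linarith

/-- The power `g^p` lies in a space of dimension at most `(l p + 1)^d ≤ exp (4p)`. Taking `p`-th
roots in `sup g^(2p) ≤ dim * ∫ g^(2p)` costs only `exp 4 ≤ 81`. -/
lemma sq_le_of_integral_pow_le (hd : 3 ≤ d) {l p : ℕ} (hl : 1 ≤ l) (hp : d ^ 2 + l ≤ p)
    {g : C(Sph d, ℝ)} (hg : g ∈ harm d l) {v : ℝ} (hv : 0 ≤ v)
    (h : ∫ x, g x ^ (2 * p) ∂(unif d) ≤ v ^ p) (x : Sph d) : g x ^ 2 ≤ 81 * v := by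
  have h1 := harmLE_sq_le hd (pow_mem_harmLE (by omega) hg p) x
  have h2 : ∀ y, (g ^ p) y ^ 2 = g y ^ (2 * p) := fun y => by
    rw [ContinuousMap.pow_apply, ← pow_mul, mul_comm]
  simp only [h2] at h1
  have h3 : g x ^ (2 * p) ≤ (Real.exp 4 * v) ^ p := by
    refine h1.trans ?_
    rw [mul_pow]
    refine mul_le_mul ?_ h (integral_nonneg fun y => (even_two_mul p).pow_nonneg _) (by positivity)
    exact (sum_dimN_le (by omega) _).trans (mul_add_one_pow_le hl hp)
  rw [pow_mul] at h3
  refine (le_of_pow_le_pow_left₀ (n := p) (by omega) (by positivity) h3).trans ?_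
  refine mul_le_mul_of_nonneg_right ?_ hv
  have h4 : Real.exp 4 = Real.exp 1 ^ 4 := by rw [← Real.exp_nat_mul]; norm_num
  rw [h4]
  calc Real.exp 1 ^ 4 ≤ 3 ^ 4 := pow_le_pow_left₀ (Real.exp_pos _).le Real.exp_one_lt_three.le 4
    _ = 81 := by norm_num

/-! ### Truncation of the expansion into spherical harmonics -/

/-- A square integrable function whose harmonic parts have summable sup norms beyond degree `m` is
uniformly close to the sum of its harmonic parts of degree less than `m`. -/
lemma ae_abs_sub_sum_harm_le (hd : 3 ≤ d) {u : Sph d → ℝ} (hu : MemLp u 2 (unif d))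
    {g : ℕ → C(Sph d, ℝ)} (hg : ∀ l, g l ∈ harm d l)
    (hgu : ∀ l, ∀ h ∈ harm d l, ∫ x, g l x * h x ∂(unif d) = ∫ x, u x * h x ∂(unif d))
    {m : ℕ} {b : ℕ → ℝ} (hb : ∀ l, m ≤ l → ∀ x, |g l x| ≤ b l) {e : ℝ}
    (hs : ∀ n, ∑ l ∈ Finset.Ico m n, b l ≤ e) :
    ∀ᵐ x ∂(unif d), |u x - ∑ l ∈ Finset.range m, g l x| ≤ e := by
  have := isProbabilityMeasure_unif (d := d) (by omega)
  have := nontrivial_euclidean (d := d) (by omega)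
  have hne : Nonempty (Sph d) := by
    by_contra h
    rw [not_nonempty_iff] at h
    have h1 := measure_univ (μ := unif d)
    rw [Set.univ_eq_empty_iff.mpr h, measure_empty] at h1
    exact zero_ne_one h1
  have hb0 : ∀ l, ‖g (l + m)‖ ≤ b (l + m) := fun l =>
    (ContinuousMap.norm_le_of_nonempty _).mpr fun x => hb _ (by omega) x
  have hsum : ∀ n, ∑ l ∈ Finset.range n, ‖g (l + m)‖ ≤ e := by
    intro n
    refine (Finset.sum_le_sum fun l _ => hb0 l).trans ?_
    have := hs (m + n)
    rw [Finset.sum_Ico_eq_sum_range, Nat.add_sub_cancel_left] at this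
    simpa only [add_comm m] using this
  have hsm : Summable fun l => ‖g (l + m)‖ :=
    summable_of_sum_range_le (fun l => norm_nonneg _) hsum
  set T := ∑' l, g (l + m)
  have hT : ‖T‖ ≤ e := (norm_tsum_le_tsum_norm hsm).trans
    (hsm.tsum_le_of_sum_range_le hsum)
  have hS : HasSum g (T + ∑ l ∈ Finset.range m, g l) :=
    (hasSum_nat_add_iff m).mp hsm.of_norm.hasSum
  set S := T + ∑ l ∈ Finset.range m, g l
  have hSL : MemLp (fun x => S x) 2 (unif d) := by
    refine MemLp.of_bound S.continuous.aestronglyMeasurable ‖S‖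
      (Filter.Eventually.of_forall fun x => S.norm_coe_le_norm x)
  -- `S` is the uniform limit of the expansion. Pairing with a harmonic of degree `k` keeps only the
  -- term `g k`, so `u - S` is orthogonal to all harmonics.
  have hzero := ae_eq_zero_of_forall_harm (by omega) (hu.sub hSL) fun k h hh => by
    have h1 := ((innerSL ℝ (toL2 d h)).comp (toL2 d)).hasSum hS
    have h2 : ∀ G, ((innerSL ℝ (toL2 d h)).comp (toL2 d)) G = ∫ x, G x * h x ∂(unif d) := by
      intro G
      rw [ContinuousLinearMap.comp_apply, innerSL_apply_apply, inner_toL2]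
      simp only [mul_comm]
    simp only [h2] at h1
    have h3 : HasSum (fun l => ∫ x, g l x * h x ∂(unif d)) (∫ x, g k x * h x ∂(unif d)) :=
      hasSum_single k fun l hl => integral_harm_mul_eq_zero (by omega) hl (hg l) hh
    have h4 := h1.unique h3
    have hhL : MemLp (fun x => h x) 2 (unif d) :=
      MemLp.of_bound h.continuous.aestronglyMeasurable ‖h‖
        (Filter.Eventually.of_forall fun x => h.norm_coe_le_norm x)
    simp only [Pi.sub_apply, sub_mul]
    refine (integral_sub (hu.integrable_mul hhL) (hSL.integrable_mul hhL)).trans ?_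
    exact sub_eq_zero.mpr ((hgu k h hh).symm.trans h4.symm)
  filter_upwards [hzero] with x hx
  have h1 : u x = S x := sub_eq_zero.mp hx
  have h2 : S x = T x + ∑ l ∈ Finset.range m, g l x := by
    simp [S]
  rw [h1, h2, add_sub_cancel_right]
  exact (T.norm_coe_le_norm x).trans hT

end

/-! ### The truncation threshold -/

section
variable {d : ℕ} {β : ℝ}

lemma LargeDim.rpow_mul_rpow_le (h : LargeDim d β) (hβ : 0 < β) (hβ1 : β ≤ 1) {m : ℕ} (hm : 1 ≤ m) :
    (m : ℝ) ^ (3 / 2 : ℝ) * (dimN m d : ℝ) ^ (-β / 2) ≤ 1 / m := by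
  have hd := h.three_le hβ hβ1
  have hm' : (0 : ℝ) < m := by exact_mod_cast (by omega : 0 < m)
  have h1 := h.antitone hβ hβ1 le_rfl hm
  have h2 : (dimN 1 d : ℝ) ^ (-β / 2) ≤ 1 :=
    Real.rpow_le_one_of_one_le_of_nonpos (one_le_dimN hd 1) (by linarith)
  rw [Nat.cast_one, Real.one_rpow, one_mul] at h1
  rw [le_div_iff₀ hm']
  calc (m : ℝ) ^ (3 / 2 : ℝ) * (dimN m d : ℝ) ^ (-β / 2) * m
      = (m : ℝ) ^ (5 / 2 : ℝ) * (dimN m d : ℝ) ^ (-β / 2) := by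
        rw [show (5 / 2 : ℝ) = 3 / 2 + 1 by norm_num, Real.rpow_add_one hm'.ne']
        ring
    _ ≤ 1 := h1.trans h2

variable {c₁ c₂ ε : ℝ}

/-- The infimum is attained because the defining set is nonempty: its left side is `O(1/(l + 1))` by
`rpow_mul_rpow_le`. -/
lemma LargeDim.threshold_spec (h : LargeDim d β) (hβ : 0 < β) (hβ1 : β ≤ 1) (hc₁ : 0 ≤ c₁)
    (hc₂ : 0 ≤ c₂) (hε : 0 < ε) :
    2 * c₁ * c₂ * (((threshold d β c₁ c₂ ε + 1 : ℕ) : ℝ) ^ (3 / 2 : ℝ) *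
      (dimN (threshold d β c₁ c₂ ε + 1) d : ℝ) ^ (-β / 2)) ≤ ε / 2 := by
  have hne : {l : ℕ | 2 * c₁ * c₂ * ((l : ℝ) + 1) ^ (3 / 2 : ℝ) *
      (dimN (l + 1) d : ℝ) ^ (-β / 2) ≤ ε / 2}.Nonempty := by
    obtain ⟨m, hm⟩ := exists_nat_ge (4 * c₁ * c₂ / ε)
    refine ⟨m, ?_⟩
    have h1 := h.rpow_mul_rpow_le hβ hβ1 (Nat.le_add_left 1 m)
    rw [Set.mem_ofPred_eq, mul_assoc]
    push_cast at h1
    refine (mul_le_mul_of_nonneg_left h1 (by positivity)).trans ?_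
    rw [div_le_iff₀ hε] at hm
    rw [mul_one_div, div_le_iff₀ (by positivity)]
    nlinarith
  have : threshold d β c₁ c₂ ε ∈ _ := Nat.sInf_mem hne
  rw [Set.mem_ofPred_eq, mul_assoc] at this
  exact_mod_cast this

/-- By minimality `k - 1` violates the defining inequality. With `X = 4 c₁ c₂ / ε` the decay of
`l^(3/2) N_l^(-β/2)` then forces `k ≤ X`, and feeding this back gives `N_k^(β/2) ≤ X k^(3/2) ≤
X^(5/2)`. -/
lemma LargeDim.threshold_bounds (h : LargeDim d β) (hβ : 0 < β) (hβ1 : β ≤ 1)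
    (hε : 0 < ε) (hk : 1 ≤ threshold d β c₁ c₂ ε) :
    (threshold d β c₁ c₂ ε : ℝ) ≤ 4 * c₁ * c₂ / ε ∧
      (dimN (threshold d β c₁ c₂ ε) d : ℝ) ≤ (4 * c₁ * c₂ / ε) ^ (5 / β) := by
  set k := threshold d β c₁ c₂ ε with hkdef
  have hd := h.three_le hβ hβ1
  have hk' : (0 : ℝ) < k := by exact_mod_cast (by omega : 0 < k)
  have hN : (0 : ℝ) < dimN k d := by linarith [one_le_dimN hd k]
  have hnot : ε / 2 < 2 * c₁ * c₂ * ((k : ℝ) ^ (3 / 2 : ℝ) * (dimN k d : ℝ) ^ (-β / 2)) := by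
    have h1 : k - 1 ∉ {l : ℕ | 2 * c₁ * c₂ * ((l : ℝ) + 1) ^ (3 / 2 : ℝ) *
        (dimN (l + 1) d : ℝ) ^ (-β / 2) ≤ ε / 2} := Nat.notMem_of_lt_sInf (by
      change k - 1 < k
      omega)
    rw [Set.mem_ofPred_eq, not_le, Nat.sub_add_cancel hk, Nat.cast_sub hk, Nat.cast_one,
      sub_add_cancel, mul_assoc] at h1
    exact h1
  have hpos : 0 < 2 * c₁ * c₂ := pos_of_mul_pos_left ((half_pos hε).trans hnot) (by positivity)
  have hX : (0 : ℝ) < 4 * c₁ * c₂ / ε := div_pos (by linarith) hε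
  have hkX : (k : ℝ) ≤ 4 * c₁ * c₂ / ε := by
    have h1 := hnot.le.trans (mul_le_mul_of_nonneg_left (h.rpow_mul_rpow_le hβ hβ1 hk) hpos.le)
    rw [mul_one_div, le_div_iff₀ hk'] at h1
    rw [le_div_iff₀ hε]
    linarith
  refine ⟨hkX, ?_⟩
  have h2 : (dimN k d : ℝ) ^ (β / 2) ≤ (4 * c₁ * c₂ / ε) ^ (5 / 2 : ℝ) := by
    have hNp : (0 : ℝ) < (dimN k d : ℝ) ^ (β / 2) := by positivity
    rw [neg_div, Real.rpow_neg hN.le, ← mul_assoc, ← div_eq_mul_inv, lt_div_iff₀ hNp] at hnot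
    calc (dimN k d : ℝ) ^ (β / 2) ≤ 4 * c₁ * c₂ / ε * (k : ℝ) ^ (3 / 2 : ℝ) := by
          rw [div_mul_eq_mul_div, le_div_iff₀ hε]
          linarith
      _ ≤ 4 * c₁ * c₂ / ε * (4 * c₁ * c₂ / ε) ^ (3 / 2 : ℝ) := by gcongr
      _ = _ := by
          rw [show (5 / 2 : ℝ) = 1 + 3 / 2 by norm_num, Real.rpow_add hX, Real.rpow_one]
  have h3 := Real.rpow_le_rpow (by positivity) h2 (show 0 ≤ 2 / β by positivity)
  rw [← Real.rpow_mul hN.le, ← Real.rpow_mul hX.le] at h3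
  rw [show β / 2 * (2 / β) = 1 by field_simp, Real.rpow_one] at h3
  rwa [show (5 / 2 : ℝ) * (2 / β) = 5 / β by field_simp] at h3
end

/-! ### Size of the harmonic parts of the field -/

section
variable {d : ℕ}

/-- The degree `l` part of the field. -/
def fieldPart {Ω : Type*} (f : Ω → Sph d → ℝ) (l : ℕ) (ω : Ω) : C(Sph d, ℝ) :=
  ∑ i, fieldInt f (harmBasis d l i) ω • harmBasis d l i

lemma fieldPart_apply {Ω : Type*} (f : Ω → Sph d → ℝ) (l : ℕ) (ω : Ω) (x : Sph d) :
    fieldPart f l ω x = ∑ i, fieldInt f (harmBasis d l i) ω * harmBasis d l i x := by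
  simp [fieldPart]

lemma fieldPart_mem (hd : 3 ≤ d) {Ω : Type*} (f : Ω → Sph d → ℝ) (l : ℕ) (ω : Ω) :
    fieldPart f l ω ∈ harm d l :=
  Submodule.sum_mem _ fun i _ => Submodule.smul_mem _ _ ((harmBasis_spec hd l).1 i)

lemma memLp_coe (hd : 1 ≤ d) (h : C(Sph d, ℝ)) (p : ENNReal) : MemLp (fun x => h x) p (unif d) := by
  have := isProbabilityMeasure_unif hd
  exact MemLp.of_bound h.continuous.aestronglyMeasurable ‖h‖
    (Filter.Eventually.of_forall fun x => h.norm_coe_le_norm x)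

lemma integrable_mul_coe (hd : 1 ≤ d) {u : Sph d → ℝ} (hu : MemLp u 2 (unif d)) (h : C(Sph d, ℝ)) :
    Integrable (fun x => u x * h x) (unif d) :=
  hu.integrable_mul (memLp_coe hd h 2)

lemma integral_sum_smul {u : Sph d → ℝ} (hd : 1 ≤ d) (hu : MemLp u 2 (unif d)) {ι : Type*}
    (s : Finset ι) (a : ι → ℝ) (e : ι → C(Sph d, ℝ)) :
    ∫ y, u y * (∑ i ∈ s, a i • e i) y ∂(unif d) = ∑ i ∈ s, a i * ∫ y, u y * e i y ∂(unif d) := by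
  simp only [ContinuousMap.coe_sum, Finset.sum_apply, ContinuousMap.smul_apply, smul_eq_mul,
    Finset.mul_sum, mul_left_comm (u _)]
  rw [integral_finsetSum _ fun i _ => (integrable_mul_coe hd hu (e i)).const_mul _]
  simp only [integral_const_mul]

variable {Ω : Type*} {f : Ω → Sph d → ℝ}

lemma integral_fieldPart_mul (hd : 3 ≤ d) {l : ℕ} {ω : Ω} (hω : MemLp (f ω) 2 (unif d))
    {h : C(Sph d, ℝ)} (hh : h ∈ harm d l) :
    ∫ x, fieldPart f l ω x * h x ∂(unif d) = ∫ x, f ω x * h x ∂(unif d) := by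
  conv_rhs => rw [(harmBasis_spec hd l).2.2 h hh]
  rw [integral_sum_smul (by omega) hω]
  have h1 := integral_sum_smul (by omega) (memLp_coe (d := d) (by omega) h 2) Finset.univ
    (fun i => fieldInt f (harmBasis d l i) ω) (harmBasis d l)
  simp only [mul_comm (h _)] at h1
  rw [fieldPart, h1]
  exact Finset.sum_congr rfl fun i _ => mul_comm _ _

/-- The addition formula makes each point value an integral of the field against one harmonic, so
the moment bounds for `fieldInt` apply pointwise. -/
lemma fieldPart_apply_eq (hd : 3 ≤ d) {ω : Ω} (hω : MemLp (f ω) 2 (unif d)) (l : ℕ) (x : Sph d) :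
    fieldPart f l ω x = fieldInt f ((dimN l d : ℝ) • zonal d l x) ω := by
  have e : (dimN l d : ℝ) • zonal d l x = ∑ i, harmBasis d l i x • harmBasis d l i := by
    ext y
    simp [← sum_harmBasis_mul hd l x y]
  rw [fieldPart_apply, fieldInt, e, integral_sum_smul (by omega) hω]
  exact Finset.sum_congr rfl fun i _ => mul_comm _ _

variable [MeasurableSpace Ω] {P : Measure Ω} {κ : ℝ → ℝ}

namespace IsIsotropicGRF

lemma measurable_fieldPart (hf : IsIsotropicGRF P d κ f) (l : ℕ) :
    Measurable fun q : Ω × Sph d => fieldPart f l q.1 q.2 := by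
  simp only [fieldPart_apply]
  exact Finset.measurable_fun_sum _ fun i _ => ((hf.measurable_fieldInt _).comp measurable_fst).mul
    ((harmBasis d l i).continuous.measurable.comp measurable_snd)

variable [IsProbabilityMeasure P]

lemma integral_fieldInt_zonal_sq (hd : 3 ≤ d) (hf : IsIsotropicGRF P d κ f) (l : ℕ) (x : Sph d) :
    ∫ ω, fieldInt f ((dimN l d : ℝ) • zonal d l x) ω ^ 2 ∂P = legendreCoeff d l κ * √(dimN l d) := by
  have hN := one_le_dimN hd l
  rw [hf.integral_fieldInt_sq hd (Submodule.smul_mem _ _ (zonal_mem_harm hd l x))]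
  have e : ∀ y, ((dimN l d : ℝ) • zonal d l x) y ^ 2 =
      (dimN l d : ℝ) ^ 2 * (zonal d l x y * zonal d l x y) := fun y => by
    simp only [ContinuousMap.smul_apply, smul_eq_mul]
    ring
  simp only [e]
  rw [integral_const_mul, integral_zonal_sq hd]
  have hs : √(dimN l d : ℝ) ≠ 0 := by positivity
  field_simp
  rw [Real.sq_sqrt (by positivity)]

lemma lintegral_fieldPart_pow_le (hd : 3 ≤ d) (hf : IsIsotropicGRF P d κ f) {l : ℕ} {w : ℝ}
    (hw : 0 < w) (hv : legendreCoeff d l κ * √(dimN l d) ≤ w) {p : ℕ} (hp : 1 ≤ p) :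
    ∫⁻ ω, ENNReal.ofReal (∫ x, fieldPart f l ω x ^ (2 * p) ∂(unif d)) ∂P
      ≤ ENNReal.ofReal ((36 * p * w) ^ p) := by
  have := isProbabilityMeasure_unif (d := d) (by omega)
  have h1 : ∀ ω, ENNReal.ofReal (∫ x, fieldPart f l ω x ^ (2 * p) ∂(unif d)) =
      ∫⁻ x, ENNReal.ofReal (fieldPart f l ω x ^ (2 * p)) ∂(unif d) := fun ω =>
    ofReal_integral_eq_lintegral_ofReal (continuous_integrable_unif (fieldPart f l ω ^ (2 * p)))
      (Filter.Eventually.of_forall fun x => (even_two_mul p).pow_nonneg _)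
  simp only [h1]
  rw [lintegral_lintegral_swap
    ((hf.measurable_fieldPart l).pow_const (2 * p)).ennreal_ofReal.aemeasurable]
  calc _ ≤ ∫⁻ _ : Sph d, ENNReal.ofReal ((36 * p * w) ^ p) ∂(unif d) := by
        refine lintegral_mono fun x => ?_
        refine le_of_eq_of_le (lintegral_congr_ae ?_) (hf.lintegral_fieldInt_pow_le hd hw
          (h := (dimN l d : ℝ) • zonal d l x)
          ((hf.integral_fieldInt_zonal_sq hd l x).trans_le hv) hp)
        filter_upwards [hf.ae_memLp hd] with ω hω
        rw [fieldPart_apply_eq hd hω]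
    _ = _ := by simp

/-- Markov's inequality at `3^p` times the moment bound; `108 = 3 * 36`. -/
lemma measure_integral_fieldPart_pow_gt (hd : 3 ≤ d) (hf : IsIsotropicGRF P d κ f) {l : ℕ} {w : ℝ}
    (hw : 0 < w) (hv : legendreCoeff d l κ * √(dimN l d) ≤ w) {p : ℕ} (hp : 1 ≤ p) :
    P {ω | ¬ ∫ x, fieldPart f l ω x ^ (2 * p) ∂(unif d) ≤ (108 * p * w) ^ p}
      ≤ ENNReal.ofReal ((1 / 3) ^ p) := by
  have hp' : (0 : ℝ) < p := by exact_mod_cast (by omega : 0 < p)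
  have := isProbabilityMeasure_unif (d := d) (by omega)
  have hm : Measurable fun ω => ENNReal.ofReal (∫ x, fieldPart f l ω x ^ (2 * p) ∂(unif d)) :=
    (((hf.measurable_fieldPart l).pow_const (2 * p)).stronglyMeasurable.integral_prod_right
      (ν := unif d)).measurable.ennreal_ofReal
  have h1 := mul_meas_ge_le_lintegral (μ := P) hm (ENNReal.ofReal ((108 * p * w) ^ p))
  have h2 := h1.trans (hf.lintegral_fieldPart_pow_le hd hw hv hp)
  have h3 : ENNReal.ofReal ((36 * p * w) ^ p) =
      ENNReal.ofReal ((108 * p * w) ^ p) * ENNReal.ofReal ((1 / 3) ^ p) := by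
    rw [← ENNReal.ofReal_mul (by positivity), ← mul_pow]
    congr 2
    ring
  rw [h3] at h2
  refine le_trans (measure_mono fun ω hω => ?_) ((ENNReal.mul_le_mul_iff_right
    (ENNReal.ofReal_pos.mpr (by positivity)).ne' ENNReal.ofReal_ne_top).mp h2)
  exact ENNReal.ofReal_le_ofReal (not_le.mp hω).le

/-- With high probability all the harmonic parts of the field are small, in the mean square and
uniformly. -/
lemma measure_fieldPart_large_le (hd : 3 ≤ d) (hf : IsIsotropicGRF P d κ f) {w : ℕ → ℝ}
    (hw : ∀ l, 0 < w l) (hv : ∀ l, legendreCoeff d l κ * √(dimN l d) ≤ w l) {L : ℝ} (hL : 0 ≤ L) :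
    P {ω | ¬ ∀ l, ∫ x, fieldPart f l ω x ^ 2 ∂(unif d) ≤ 108 * (L + l + 4) * w l ∧
      (1 ≤ l → ∀ x, fieldPart f l ω x ^ 2 ≤ 8748 * (d ^ 2 + L + l + 4) * w l)}
      ≤ ENNReal.ofReal (Real.exp (-L)) := by
  have hceil : (⌈L⌉₊ : ℝ) ≤ L + 1 := (Nat.ceil_lt_add_one hL).le
  -- In the failure probability `(1/3)^(q l)`, the part `⌈L⌉₊` yields `exp (-L)`, `l` makes the
  -- union bound summable, and 3 supplies the factor `1/4`. The uniform bound adds `d ^ 2` to the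
  -- exponent, as `sq_le_of_integral_pow_le` demands.
  set q : ℕ → ℕ := fun l => ⌈L⌉₊ + l + 3
  have hq : ∀ l, l + 3 ≤ q l := fun l => by simp only [q]; omega
  set bad : ℕ → ℕ → Set Ω := fun l p =>
    {ω | ¬ ∫ x, fieldPart f l ω x ^ (2 * p) ∂(unif d) ≤ (108 * p * w l) ^ p}
  have hsub : {ω | ¬ ∀ l, ∫ x, fieldPart f l ω x ^ 2 ∂(unif d) ≤ 108 * (L + l + 4) * w l ∧
      (1 ≤ l → ∀ x, fieldPart f l ω x ^ 2 ≤ 8748 * (d ^ 2 + L + l + 4) * w l)} ⊆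
      ⋃ l, (bad l (q l) ∪ bad l (d ^ 2 + q l)) := by
    intro ω hω
    by_contra hc
    simp only [Set.mem_iUnion, Set.mem_union, not_exists, not_or, bad, Set.mem_ofPred_eq,
      not_not] at hc
    refine hω fun l => ⟨?_, fun hl x => ?_⟩
    · refine (integral_sq_le_of_integral_pow_le (by omega) (by linarith [hq l])
        (by have := hw l; positivity) (hc l).1).trans ?_
      refine mul_le_mul_of_nonneg_right ?_ (hw l).le
      simp only [q]
      push_cast
      linarith
    · refine (sq_le_of_integral_pow_le hd hl (by linarith [hq l]) (fieldPart_mem hd f l ω)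
        (by have := hw l; positivity) (hc l).2 x).trans ?_
      rw [← mul_assoc]
      refine mul_le_mul_of_nonneg_right ?_ (hw l).le
      simp only [q]
      push_cast
      linarith
  have hthird : (1 / 3 : ℝ) ^ ⌈L⌉₊ ≤ Real.exp (-L) := by
    have h1 : (1 / 3 : ℝ) ≤ Real.exp (-1) := by
      rw [Real.exp_neg, one_div]
      exact inv_anti₀ (Real.exp_pos 1) Real.exp_one_lt_three.le
    calc (1 / 3 : ℝ) ^ ⌈L⌉₊ ≤ Real.exp (-1) ^ ⌈L⌉₊ := pow_le_pow_left₀ (by norm_num) h1 _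
      _ ≤ Real.exp (-L) := by
        rw [← Real.exp_nat_mul, Real.exp_le_exp]
        linarith [Nat.le_ceil L]
  have hbad : ∀ l p, q l ≤ p → P (bad l p) ≤ ENNReal.ofReal (Real.exp (-L) / 4 * (1 / 2) ^ l) := by
    intro l p hp
    refine (hf.measure_integral_fieldPart_pow_gt hd (hw l) (hv l) (by linarith [hq l])).trans
      (ENNReal.ofReal_le_ofReal ?_)
    calc (1 / 3 : ℝ) ^ p ≤ (1 / 3) ^ q l := pow_le_pow_of_le_one (by norm_num) (by norm_num) hp
      _ = (1 / 3) ^ ⌈L⌉₊ * (1 / 3) ^ 3 * (1 / 3) ^ l := by simp only [q]; ring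
      _ ≤ Real.exp (-L) * (1 / 4) * (1 / 2) ^ l := by
        gcongr <;> norm_num
      _ = _ := by ring
  calc _ ≤ ∑' l, P (bad l (q l) ∪ bad l (d ^ 2 + q l)) :=
        (measure_mono hsub).trans (measure_iUnion_le _)
    _ ≤ ∑' l, ENNReal.ofReal (Real.exp (-L) / 2 * (1 / 2) ^ l) := by
        refine ENNReal.tsum_le_tsum fun l => (measure_union_le _ _).trans ?_
        refine (add_le_add (hbad l _ le_rfl) (hbad l _ (Nat.le_add_left _ _))).trans_eq ?_
        rw [← ENNReal.ofReal_add (by positivity) (by positivity)]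
        congr 1; ring
    _ = ENNReal.ofReal (Real.exp (-L)) := by
        rw [← ENNReal.ofReal_tsum_of_nonneg (fun j => by positivity)
          ((summable_geometric_of_lt_one (by norm_num) (by norm_num)).mul_left _), tsum_mul_left,
          tsum_geometric_two]
        congr 1; ring

end IsIsotropicGRF
end

/-! ### Approximation of the field by its truncated expansion -/

section
variable {d : ℕ}

/-- The coefficients of a function with respect to the basis of `harmLE d k`. -/
def harmCoeff (k : ℕ) (u : Sph d → ℝ) (j : HarmIdx d k) : ℝ :=
  ∫ x, u x * harmLEBasis d k j x ∂(unif d)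

/-- The harmonic parts of `u` of degree at most `k` are bounded by `c₁` in the mean square, and
their sum is uniformly within `e` of `u`. -/
structure IsApproximable (d k : ℕ) (c₁ e : ℝ) (u : Sph d → ℝ) : Prop where
  memLp : MemLp u 2 (unif d)
  sum_sq_le : ∀ l : Fin (k + 1), ∑ i, harmCoeff k u ⟨l, i⟩ ^ 2 ≤ c₁ ^ 2
  close : ∀ᵐ x ∂(unif d), |u x - harmExpand (harmCoeff k u) x| ≤ e

lemma harmExpand_harmCoeff_apply {Ω : Type*} (f : Ω → Sph d → ℝ) (k : ℕ) (ω : Ω) (x : Sph d) :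
    harmExpand (harmCoeff k (f ω)) x = ∑ l ∈ Finset.range (k + 1), fieldPart f l ω x := by
  rw [harmExpand_eq_sum, ← Fin.sum_univ_eq_sum_range (fun l => fieldPart f l ω x),
    ContinuousMap.coe_sum, Finset.sum_apply]
  rfl

lemma sum_harmCoeff_sq (hd : 3 ≤ d) {Ω : Type*} (f : Ω → Sph d → ℝ) (k : ℕ) (ω : Ω)
    (l : Fin (k + 1)) : ∑ i, harmCoeff k (f ω) ⟨l, i⟩ ^ 2 = ∫ x, fieldPart f l ω x ^ 2 ∂(unif d) := by
  simp only [sq (fieldPart f l ω _)]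
  exact (integral_sum_harmBasis_sq hd l fun i => fieldInt f (harmBasis d l i) ω).symm

lemma coeff_mul_sqrt_le {α c : ℝ} {κ : ℝ → ℝ} (hd : 3 ≤ d) {l : ℕ}
    (h : legendreCoeff d l κ ≤ c ^ 2 * (dimN l d : ℝ) ^ (-(1 / 2) - α)) :
    legendreCoeff d l κ * √(dimN l d) ≤ c ^ 2 * (dimN l d : ℝ) ^ (-(min α 1)) := by
  have hN := one_le_dimN hd l
  refine (mul_le_mul_of_nonneg_right h (Real.sqrt_nonneg _)).trans ?_
  rw [mul_assoc, Real.sqrt_eq_rpow, ← Real.rpow_add (by linarith)]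
  refine mul_le_mul_of_nonneg_left (Real.rpow_le_rpow_of_exponent_le hN ?_) (sq_nonneg c)
  linarith [min_le_left α 1]

variable {β : ℝ}

/-- `l N_l^(-β)` is the square of `l^(5/2) N_l^(-β/2) / l²`. The decreasing factor may be evaluated
at `m`, and a summable `1/l²` remains. -/
lemma LargeDim.degree_mul_le (h : LargeDim d β) (hβ : 0 < β) (hβ1 : β ≤ 1) {m l : ℕ} (hm : 1 ≤ m)
    (hml : m ≤ l) : (l : ℝ) * (dimN l d : ℝ) ^ (-β) ≤
      ((m : ℝ) ^ (5 / 2 : ℝ) * (dimN m d : ℝ) ^ (-β / 2) * (1 / (l : ℝ) ^ 2)) ^ 2 := by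
  have hl : (0 : ℝ) < l := by exact_mod_cast (by omega : 0 < l)
  have hN : (0 : ℝ) < dimN l d := by linarith [one_le_dimN (h.three_le hβ hβ1) l]
  have h1 := pow_le_pow_left₀ (by positivity) (h.antitone hβ hβ1 hm hml) 2
  have h2 : ((l : ℝ) ^ (5 / 2 : ℝ) * (dimN l d : ℝ) ^ (-β / 2)) ^ 2 =
      (l : ℝ) ^ 5 * (dimN l d : ℝ) ^ (-β) := by
    rw [mul_pow, ← Real.rpow_mul_natCast hl.le, ← Real.rpow_mul_natCast hN.le,
      ← Real.rpow_natCast (l : ℝ) 5]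
    norm_num
  rw [h2] at h1
  rw [mul_pow, one_div, inv_pow, ← div_eq_mul_inv, le_div_iff₀ (by positivity)]
  calc _ = (l : ℝ) ^ 5 * (dimN l d : ℝ) ^ (-β) := by ring
    _ ≤ _ := h1

variable {Ω : Type*} [MeasurableSpace Ω] {P : Measure Ω} {κ : ℝ → ℝ}
  {f : Ω → Sph d → ℝ}

/-- With high probability the field is uniformly approximated by its truncated expansion, with
coefficients in the function class of the algorithm. -/
lemma IsIsotropicGRF.measure_not_isApproximable_le [IsProbabilityMeasure P] {α c ε δ : ℝ} (hα : 0 < α) (hc : 0 < c)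
    (hε : 0 < ε) (hδ : 0 < δ) (hδ1 : δ < 1) (hβd : LargeDim d (min α 1))
    (hκ : ∀ k : ℕ, legendreCoeff d k κ ≤ c ^ 2 * (dimN k d : ℝ) ^ (-(1 / 2) - α))
    (hf : IsIsotropicGRF P d κ f) :
    P {ω | ¬ IsApproximable d (threshold d (min α 1) (32 * c * √(Real.log (2 / δ)))
        (32 * √((d : ℝ) ^ 2 + Real.log (2 / δ))) ε)
        (32 * c * √(Real.log (2 / δ))) (ε / 2) (f ω)} ≤ ENNReal.ofReal (δ / 2) := by
  set β := min α 1 with hβdef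
  have hβ : 0 < β := lt_min hα one_pos
  have hβ1 : β ≤ 1 := min_le_right _ _
  have hd := hβd.three_le hβ hβ1
  have hd' : (3 : ℝ) ≤ d := by exact_mod_cast hd
  set L := Real.log (2 / δ) with hLdef
  -- This lower bound absorbs additive constants: it gives `108 (L + 5) ≤ 1024 L` for the class
  -- radius and `√L ≥ 1/2` for the tail.
  have hL : 69 / 100 ≤ L := by
    have h1 : Real.log 2 ≤ L := Real.log_le_log (by norm_num) (by
      rw [le_div_iff₀ hδ]
      linarith)
    linarith [Real.log_two_gt_d9]
  have hexp : Real.exp (-L) = δ / 2 := by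
    rw [Real.exp_neg, Real.exp_log (by positivity), inv_div]
  have hL4 : 1 / 2 ≤ √L := Real.le_sqrt_of_sq_le (by linarith)
  set c₁ := 32 * c * √L
  set c₂ := 32 * √((d : ℝ) ^ 2 + L)
  set k := threshold d β c₁ c₂ ε
  have hN : ∀ l, (0 : ℝ) < dimN l d := fun l => by linarith [one_le_dimN hd l]
  have hw : ∀ l, 0 < c ^ 2 * (dimN l d : ℝ) ^ (-β) := fun l => by
    have := hN l
    positivity
  rw [← hexp]
  refine le_trans (measure_mono_ae ?_) (hf.measure_fieldPart_large_le hd hw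
    (fun l => coeff_mul_sqrt_le hd (hκ l)) (by linarith : 0 ≤ L))
  filter_upwards [hf.ae_memLp hd] with ω hω hbad hgood
  refine hbad ⟨hω, fun l => ?_, ?_⟩
  · rw [sum_harmCoeff_sq hd]
    refine (hgood l).1.trans ?_
    have h1 : c₁ ^ 2 = 1024 * c ^ 2 * L := by
      simp only [c₁]
      rw [mul_pow, mul_pow, Real.sq_sqrt (by linarith)]
      norm_num
    rw [h1]
    have h2 : (L + (l : ℕ) + 4) * (dimN l d : ℝ) ^ (-β) ≤ L + 5 := by
      rcases Nat.eq_zero_or_pos (l : ℕ) with hl | hl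
      · rw [hl, dimN_zero hd]
        simp
        linarith
      · have hl' : (1 : ℝ) ≤ (l : ℕ) := by exact_mod_cast hl
        have h3 := hβd.pow_five_le hβ hβ1 hl
        have hpos : (0 : ℝ) < (dimN l d : ℝ) ^ β := by have := hN l; positivity
        have h4 : ((l : ℕ) : ℝ) ≤ ((l : ℕ) : ℝ) ^ 5 := le_self_pow₀ hl' (by norm_num)
        rw [Real.rpow_neg (hN l).le, ← div_eq_mul_inv, div_le_iff₀ hpos]
        nlinarith
    have hc2 : 0 < c ^ 2 := by positivity
    nlinarith
  · simp only [harmExpand_harmCoeff_apply f k ω]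
    set m := k + 1
    have hm : (0 : ℝ) < (m : ℕ) := by positivity
    have hthr : 2 * c₁ * c₂ * ((m : ℝ) ^ (3 / 2 : ℝ) * (dimN m d : ℝ) ^ (-β / 2)) ≤ ε / 2 :=
      hβd.threshold_spec hβ hβ1 (by positivity) (by positivity) hε
    set Y := (m : ℝ) ^ (3 / 2 : ℝ) * (dimN m d : ℝ) ^ (-β / 2) with hY
    have hYpos : 0 < Y := by have := hN m; positivity
    have hY' : (m : ℝ) ^ (5 / 2 : ℝ) * (dimN m d : ℝ) ^ (-β / 2) = m * Y := by
      rw [hY, show (5 / 2 : ℝ) = 3 / 2 + 1 by norm_num, Real.rpow_add_one hm.ne']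
      ring
    -- The constant 133 is chosen so that `133² ≥ 2 * 8748`. Summing `1/l²` from `m` gives at most
    -- `2/m`, which cancels the factor `m`, and `266 ≤ 2 * 32 * 32 * √L` then matches the threshold
    -- inequality.
    refine ae_abs_sub_sum_harm_le hd hω (fun l => fieldPart_mem hd f l ω)
      (fun l h hh => integral_fieldPart_mul hd hω hh) (m := m)
      (b := fun l => 133 * c * √((d : ℝ) ^ 2 + L) * (m * Y) * (1 / (l : ℝ) ^ 2)) ?_ ?_
    · intro l hl x
      have hl1 : 1 ≤ l := by omega
      have hl' : (1 : ℝ) ≤ l := by exact_mod_cast hl1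
      refine abs_le_of_sq_le_sq ?_ (by positivity)
      refine ((hgood l).2 hl1 x).trans ?_
      have h1 := hβd.degree_mul_le hβ hβ1 (show 1 ≤ m by omega) hl
      rw [hY'] at h1
      have h2 : (133 * c * √((d : ℝ) ^ 2 + L) * (m * Y) * (1 / (l : ℝ) ^ 2)) ^ 2 =
          17689 * c ^ 2 * ((d : ℝ) ^ 2 + L) * ((m * Y) * (1 / (l : ℝ) ^ 2)) ^ 2 := by
        rw [mul_assoc _ (m * Y : ℝ), mul_pow, mul_pow, mul_pow, Real.sq_sqrt (by positivity)]
        norm_num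
      have h3 : (d : ℝ) ^ 2 + L + l + 4 ≤ 2 * l * ((d : ℝ) ^ 2 + L) := by nlinarith
      rw [h2]
      calc 8748 * ((d : ℝ) ^ 2 + L + l + 4) * (c ^ 2 * (dimN l d : ℝ) ^ (-β))
          ≤ 8748 * (2 * l * ((d : ℝ) ^ 2 + L)) * (c ^ 2 * (dimN l d : ℝ) ^ (-β)) := by
            gcongr
        _ = 17496 * c ^ 2 * ((d : ℝ) ^ 2 + L) * (l * (dimN l d : ℝ) ^ (-β)) := by ring
        _ ≤ _ := by
            gcongr
            norm_num
    · intro n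
      rw [← Finset.mul_sum]
      have h4 : 0 ≤ c * √((d : ℝ) ^ 2 + L) := by positivity
      calc _ ≤ 133 * c * √((d : ℝ) ^ 2 + L) * (m * Y) * (2 / (m : ℝ)) :=
            mul_le_mul_of_nonneg_left (sum_inv_sq_le n (show 1 ≤ m by omega)) (by positivity)
        _ = 266 * (c * √((d : ℝ) ^ 2 + L)) * Y := by
            field_simp
            norm_num
        _ ≤ 2 * c₁ * c₂ * Y := by
            refine mul_le_mul_of_nonneg_right ?_ hYpos.le
            simp only [c₁, c₂]
            nlinarith
        _ ≤ ε / 2 := hthr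

end

/-! ### Concentration of sums of independent variables -/

section
open scoped NNReal

lemma measure_abs_sum_ge_le {ι S : Type*} [Fintype ι] [MeasurableSpace S] {s : Measure S}
    [IsProbabilityMeasure s] {g : ι → S → ℝ} {c : ι → ℝ≥0}
    (hg : ∀ i, HasSubgaussianMGF (g i) (c i) s) {C : ℝ} (hC : 0 < C)
    (hcC : (∑ i, (c i : ℝ)) ≤ C) {t : ℝ} (ht : 0 ≤ t) :
    Measure.pi (fun _ : ι => s) {y | t ≤ |∑ i, g i (y i)|}
      ≤ ENNReal.ofReal (2 * Real.exp (-t ^ 2 / (2 * C))) := by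
  have key : ∀ h : ι → S → ℝ, (∀ i, HasSubgaussianMGF (h i) (c i) s) →
      Measure.pi (fun _ : ι => s) {y | t ≤ ∑ i, h i (y i)}
        ≤ ENNReal.ofReal (Real.exp (-t ^ 2 / (2 * C))) := by
    intro h hh
    have hind := iIndepFun_pi (μ := fun _ : ι => s) (X := h) fun i => (hh i).aemeasurable
    have hsub : HasSubgaussianMGF (fun y : ι → S => ∑ i, h i (y i)) (∑ i, c i)
        (Measure.pi fun _ : ι => s) := by
      refine HasSubgaussianMGF.sum_of_iIndepFun hind fun i _ => ?_
      refine HasSubgaussianMGF.of_map (Y := fun y : ι → S => y i) (measurable_pi_apply i).aemeasurable ?_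
      rw [(measurePreserving_eval (fun _ : ι => s) i).map_eq]
      exact hh i
    have hsub' : HasSubgaussianMGF (fun y : ι → S => ∑ i, h i (y i)) C.toNNReal
        (Measure.pi fun _ : ι => s) := by
      refine ⟨hsub.integrable_exp_mul, fun u => (hsub.mgf_le u).trans (Real.exp_le_exp.mpr ?_)⟩
      have : ((∑ i, c i : ℝ≥0) : ℝ) ≤ C.toNNReal := by
        rw [Real.coe_toNNReal _ hC.le]
        exact_mod_cast hcC
      gcongr
    have h1 := hsub'.measure_ge_le ht
    rw [Real.coe_toNNReal _ hC.le] at h1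
    rw [← ofReal_measureReal]
    exact ENNReal.ofReal_le_ofReal h1
  have hsub : {y : ι → S | t ≤ |∑ i, g i (y i)|} ⊆
      {y | t ≤ ∑ i, g i (y i)} ∪ {y | t ≤ ∑ i, (-g i) (y i)} := by
    intro y hy
    rcases le_abs.mp (Set.mem_ofPred_eq ▸ hy) with h | h
    · exact Or.inl h
    · refine Or.inr ?_
      simpa using h
  refine (measure_mono hsub).trans ((measure_union_le _ _).trans
    ((add_le_add (key g hg) (key (fun i => -g i) fun i => (hg i).neg)).trans_eq ?_))
  rw [← ENNReal.ofReal_add (by positivity) (by positivity), ← two_mul (Real.exp _)]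

lemma measure_abs_sum_ge_le_of_bound {S : Type*} [MeasurableSpace S] {s : Measure S}
    [IsProbabilityMeasure s] {g : S → ℝ} (hg : AEMeasurable g s) {M : ℝ} (hM : 0 < M)
    (hgM : ∀ᵐ z ∂s, |g z| ≤ M) (h0 : ∫ z, g z ∂s = 0) {n : ℕ} (hn : 0 < n) {t : ℝ} (ht : 0 ≤ t) :
    Measure.pi (fun _ : Fin n => s) {y | n * t ≤ |∑ i, g (y i)|}
      ≤ ENNReal.ofReal (2 * Real.exp (-(n * t ^ 2 / (2 * M ^ 2)))) := by
  have hn' : (0 : ℝ) < n := by exact_mod_cast hn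
  have h1 := hasSubgaussianMGF_of_mem_Icc_of_integral_eq_zero hg
    (hgM.mono fun z hz => Set.mem_Icc.mpr (abs_le.mp hz)) h0
  refine (measure_abs_sum_ge_le (g := fun _ : Fin n => g) (fun _ => h1) (C := n * M ^ 2)
    (by positivity) (le_of_eq ?_) (by positivity)).trans_eq ?_
  · have e : |M + M| / 2 = M := by
      rw [abs_of_pos (by linarith)]
      ring
    simp [e]
  · congr 3
    field_simp

lemma hasSubgaussianMGF_mul_gaussianReal (a : ℝ) :
    HasSubgaussianMGF (fun z => a * z) (⟨a ^ 2, sq_nonneg a⟩) (gaussianReal 0 1) := by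
  have h1 : HasSubgaussianMGF (fun z : ℝ => z) 1 (gaussianReal 0 1) :=
    ⟨fun t => integrable_exp_mul_gaussianReal t, fun t => by
      have := congrFun (mgf_id_gaussianReal (μ := 0) (v := 1)) t
      simp only [zero_mul, zero_add] at this
      exact this.le⟩
  exact (mul_one (⟨a ^ 2, sq_nonneg a⟩ : ℝ≥0)) ▸ h1.const_mul a

lemma measure_abs_sum_mul_gaussian_ge_le {n : ℕ} (hn : 0 < n) {a : Fin n → ℝ} {M : ℝ} (hM : 0 < M)
    (ha : ∀ i, a i ^ 2 ≤ M) {t : ℝ} (ht : 0 ≤ t) :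
    Measure.pi (fun _ : Fin n => gaussianReal 0 1) {z | n * t ≤ |∑ i, a i * z i|}
      ≤ ENNReal.ofReal (2 * Real.exp (-(n * t ^ 2 / (2 * M)))) := by
  have hn' : (0 : ℝ) < n := by exact_mod_cast hn
  refine (measure_abs_sum_ge_le (g := fun i z => a i * z)
    (fun i => hasSubgaussianMGF_mul_gaussianReal (a i)) (C := n * M)
    (by positivity) ?_ (by positivity)).trans_eq ?_
  · refine (Finset.sum_le_sum fun i _ => ha i).trans_eq ?_
    simp
  · congr 3
    field_simp
end

/-! ### Least squares -/

/-- Let `D` be the number of coefficients, `s = ∑ b_j²` and `T = ∑ |b_j|`. Minimality bounds the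
empirical quadratic form by twice the linear term, so the entrywise hypotheses give `s D - T²/2 ≤
(ε/4) T`. With `T² ≤ D s` this yields `s D ≤ (ε/2) T`, then `T ≤ ε/2`, then the claim. -/
lemma sum_sq_le_of_isMin {ι : Type*} [Fintype ι] [DecidableEq ι] {n : ℕ} (hn : 0 < n)
    {Φ : Fin n → ι → ℝ} {e : Fin n → ℝ} {b : ι → ℝ} {ε : ℝ} (hε : 0 < ε)
    (hG : ∀ i j, |∑ t, (Φ t i * Φ t j - if i = j then 1 else 0)|
      ≤ n * (1 / (2 * (Fintype.card ι : ℝ))))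
    (hv : ∀ j, |∑ t, Φ t j * e t| ≤ n * (ε / (8 * (Fintype.card ι : ℝ))))
    (hmin : ∑ t, (∑ j, b j * Φ t j - e t) ^ 2 ≤ ∑ t, e t ^ 2) :
    (∑ j, b j ^ 2) * Fintype.card ι ≤ (ε / 2) ^ 2 := by
  rcases Nat.eq_zero_or_pos (Fintype.card ι) with hD0 | hD0
  · rw [hD0]
    simp
    positivity
  have hD : (0 : ℝ) < Fintype.card ι := by exact_mod_cast hD0
  have hTs : (∑ j, |b j|) ^ 2 ≤ Fintype.card ι * ∑ j, b j ^ 2 := by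
    have := sq_sum_le_card_mul_sum_sq (s := Finset.univ) (f := fun j => |b j|)
    simpa only [sq_abs, Finset.card_univ] using this
  set D : ℝ := (Fintype.card ι : ℝ)
  have hn' : (0 : ℝ) < n := by exact_mod_cast hn
  set s := ∑ j, b j ^ 2
  set T := ∑ j, |b j|
  have hs0 : 0 ≤ s := Finset.sum_nonneg fun j _ => sq_nonneg _
  have hT0 : 0 ≤ T := Finset.sum_nonneg fun j _ => abs_nonneg _
  have hquad : n * s - n * (1 / (2 * D)) * T ^ 2 ≤ ∑ t, (∑ j, b j * Φ t j) ^ 2 := by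
    have h1 : ∑ t, (∑ j, b j * Φ t j) ^ 2 = n * s +
        ∑ i, ∑ j, b i * b j * ∑ t, (Φ t i * Φ t j - if i = j then 1 else 0) := by
      have h2 : ∀ i j, b i * b j * ∑ t, (Φ t i * Φ t j - if i = j then 1 else 0) =
          ∑ t, (b i * Φ t i) * (b j * Φ t j) - n * (if i = j then b i * b j else 0) := by
        intro i j
        rw [Finset.sum_sub_distrib, mul_sub, Finset.mul_sum]
        congr 1
        · exact Finset.sum_congr rfl fun t _ => by ring
        · split_ifs <;> simp [mul_comm]
      have h3 : ∑ i, ∑ j, (n : ℝ) * (if i = j then b i * b j else 0) = n * s := by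
        simp [← Finset.mul_sum, s, sq]
      rw [Finset.sum_congr rfl fun i _ => Finset.sum_congr rfl fun j _ => h2 i j]
      simp only [Finset.sum_sub_distrib]
      have h4 : ∑ i, ∑ j, ∑ t, (b i * Φ t i) * (b j * Φ t j) = ∑ t, (∑ j, b j * Φ t j) ^ 2 := by
        simp only [sq, Finset.sum_mul_sum]
        refine Eq.trans ?_ Finset.sum_comm
        exact Finset.sum_congr rfl fun i _ => Finset.sum_comm
      rw [h3, h4]
      ring
    have h5 : |∑ i, ∑ j, b i * b j * ∑ t, (Φ t i * Φ t j - if i = j then 1 else 0)| ≤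
        n * (1 / (2 * D)) * T ^ 2 := by
      calc _ ≤ ∑ i, ∑ j, |b i| * |b j| * (n * (1 / (2 * D))) := by
            refine (Finset.abs_sum_le_sum_abs _ _).trans (Finset.sum_le_sum fun i _ => ?_)
            refine (Finset.abs_sum_le_sum_abs _ _).trans (Finset.sum_le_sum fun j _ => ?_)
            rw [abs_mul, abs_mul]
            exact mul_le_mul_of_nonneg_left (hG i j) (by positivity)
        _ = _ := by
            simp only [← Finset.sum_mul, ← Finset.sum_mul_sum]
            simp only [T]
            ring
    rw [h1]
    linarith [(abs_le.mp h5).1]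
  have hlin : ∑ t, (∑ j, b j * Φ t j) * e t ≤ n * (ε / (8 * D)) * T := by
    have h1 : ∑ t, (∑ j, b j * Φ t j) * e t = ∑ j, b j * ∑ t, Φ t j * e t := by
      simp only [Finset.sum_mul, Finset.mul_sum, mul_assoc]
      exact Finset.sum_comm
    rw [h1]
    calc _ ≤ ∑ j, |b j| * (n * (ε / (8 * D))) := by
          refine Finset.sum_le_sum fun j _ => ?_
          refine (le_abs_self _).trans ?_
          rw [abs_mul]
          exact mul_le_mul_of_nonneg_left (hv j) (abs_nonneg _)
      _ = _ := by rw [← Finset.sum_mul, mul_comm]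
  have hopt : ∑ t, (∑ j, b j * Φ t j) ^ 2 ≤ 2 * ∑ t, (∑ j, b j * Φ t j) * e t := by
    have h1 : ∑ t, (∑ j, b j * Φ t j - e t) ^ 2 = ∑ t, (∑ j, b j * Φ t j) ^ 2
        - 2 * (∑ t, (∑ j, b j * Φ t j) * e t) + ∑ t, e t ^ 2 := by
      rw [Finset.mul_sum, ← Finset.sum_sub_distrib, ← Finset.sum_add_distrib]
      exact Finset.sum_congr rfl fun t _ => by ring
    linarith
  have h1 : n * s - n * (1 / (2 * D)) * T ^ 2 ≤ 2 * (n * (ε / (8 * D)) * T) := by linarith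
  have h2 : s * D - T ^ 2 / 2 ≤ ε / 4 * T := by
    have e1 : n * s - n * (1 / (2 * D)) * T ^ 2 = n / D * (s * D - T ^ 2 / 2) := by
      field_simp
    have e2 : 2 * (n * (ε / (8 * D)) * T) = n / D * (ε / 4 * T) := by
      field_simp
      ring
    rw [e1, e2] at h1
    exact le_of_mul_le_mul_left h1 (by positivity)
  have h3 : s * D ≤ ε / 2 * T := by linarith
  have h4 : T ≤ ε / 2 := by
    by_contra hc
    push Not at hc
    nlinarith
  nlinarith

/-! ### Concentration over the sample -/

section
variable {d : ℕ}

lemma sq_harmLEBasis_le (hd : 3 ≤ d) {k : ℕ} (j : HarmIdx d k) (x : Sph d) :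
    harmLEBasis d k j x ^ 2 ≤ Fintype.card (HarmIdx d k) := by
  rw [card_harmIdx, ← sum_harmLEBasis_sq hd k x]
  exact Finset.single_le_sum (f := fun j => harmLEBasis d k j x ^ 2) (fun i _ => sq_nonneg _)
    (Finset.mem_univ j)

lemma one_le_card_harmIdx (hd : 3 ≤ d) (k : ℕ) : (1 : ℝ) ≤ Fintype.card (HarmIdx d k) := by
  rw [card_harmIdx]
  exact (one_le_dimN hd 0).trans (Finset.single_le_sum (f := fun l => (dimN l d : ℝ))
    (fun i _ => Nat.cast_nonneg _) (by simp))

/-- The sample behaves well: the empirical Gram matrix of the basis is close to the identity, and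
the approximation error `r` and the noise are almost orthogonal to the basis. -/
def SampleGood (d k : ℕ) (ε : ℝ) {n : ℕ} (r : Sph d → ℝ) (z : (Fin n → Sph d) × (Fin n → ℝ)) : Prop :=
  (∀ i j : HarmIdx d k, |∑ t, (harmLEBasis d k i (z.1 t) * harmLEBasis d k j (z.1 t) -
      if i = j then 1 else 0)| ≤ n * (1 / (2 * (Fintype.card (HarmIdx d k) : ℝ)))) ∧
    (∀ j : HarmIdx d k, |∑ t, harmLEBasis d k j (z.1 t) * r (z.1 t)|
      ≤ n * (ε / (16 * (Fintype.card (HarmIdx d k) : ℝ)))) ∧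
    ∀ j : HarmIdx d k, |∑ t, harmLEBasis d k j (z.1 t) * z.2 t|
      ≤ n * (ε / (16 * (Fintype.card (HarmIdx d k) : ℝ)))

lemma measurableSet_sampleGood {Ω : Type*} [MeasurableSpace Ω] {r : Ω → Sph d → ℝ}
    (hr : Measurable (Function.uncurry r)) (k : ℕ) (ε : ℝ) (n : ℕ) :
    MeasurableSet {q : Ω × (Fin n → Sph d) × (Fin n → ℝ) | SampleGood d k ε (r q.1) q.2} := by
  have hx : ∀ t, Measurable fun q : Ω × (Fin n → Sph d) × (Fin n → ℝ) => q.2.1 t := fun t =>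
    (measurable_pi_apply t).comp (measurable_fst.comp measurable_snd)
  have hξ : ∀ t, Measurable fun q : Ω × (Fin n → Sph d) × (Fin n → ℝ) => q.2.2 t := fun t =>
    (measurable_pi_apply t).comp (measurable_snd.comp measurable_snd)
  have hφ : ∀ (j : HarmIdx d k) t, Measurable fun q : Ω × (Fin n → Sph d) × (Fin n → ℝ) =>
      harmLEBasis d k j (q.2.1 t) := fun j t => (harmLEBasis d k j).continuous.measurable.comp (hx t)
  have hrx : ∀ t, Measurable fun q : Ω × (Fin n → Sph d) × (Fin n → ℝ) => r q.1 (q.2.1 t) :=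
    fun t => hr.comp (measurable_fst.prodMk (hx t))
  refine MeasurableSet.inter ?_ (MeasurableSet.inter ?_ ?_)
  · refine MeasurableSet.congr (MeasurableSet.iInter fun i : HarmIdx d k =>
      MeasurableSet.iInter fun j : HarmIdx d k => measurableSet_le
        (Finset.measurable_fun_sum Finset.univ fun t _ =>
          ((hφ i t).mul (hφ j t)).sub_const (if i = j then 1 else 0)).abs
        (measurable_const (a := n * (1 / (2 * (Fintype.card (HarmIdx d k) : ℝ)))))) ?_
    ext q
    simp only [Set.mem_iInter]
    rfl
  · refine MeasurableSet.congr (MeasurableSet.iInter fun j : HarmIdx d k => measurableSet_le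
        (Finset.measurable_fun_sum Finset.univ fun t _ => (hφ j t).mul (hrx t)).abs
        (measurable_const (a := n * (ε / (16 * (Fintype.card (HarmIdx d k) : ℝ)))))) ?_
    ext q
    simp only [Set.mem_iInter]
    rfl
  · refine MeasurableSet.congr (MeasurableSet.iInter fun j : HarmIdx d k => measurableSet_le
        (Finset.measurable_fun_sum Finset.univ fun t _ => (hφ j t).mul (hξ t)).abs
        (measurable_const (a := n * (ε / (16 * (Fintype.card (HarmIdx d k) : ℝ)))))) ?_
    ext q
    simp only [Set.mem_iInter]
    rfl

/-- Gram entries and residual correlations are sums of bounded centred variables, so Hoeffding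
applies; the noise sums are sub-Gaussian once the points are fixed. There are `D² + 2D ≤ 3D²`
events, each of probability at most `2 exp (-K)`. -/
lemma measure_not_sampleGood_le (hd : 3 ≤ d) (k : ℕ) {ε : ℝ} (hε : 0 < ε) {r : Sph d → ℝ}
    (hr : Measurable r) (hrε : ∀ᵐ x ∂(unif d), |r x| ≤ ε / 2)
    (hr0 : ∀ j, ∫ x, harmLEBasis d k j x * r x ∂(unif d) = 0) {n : ℕ} (hn : 0 < n) :
    ((Measure.pi fun _ : Fin n => unif d).prod (Measure.pi fun _ => gaussianReal 0 1))
      {z | ¬ SampleGood d k ε r z} ≤ ENNReal.ofReal (6 * (Fintype.card (HarmIdx d k) : ℝ) ^ 2 *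
        Real.exp (-(n * min 1 (ε ^ 2) / (512 * (Fintype.card (HarmIdx d k) : ℝ) ^ 4)))) := by
  have := isProbabilityMeasure_unif (d := d) (by omega)
  have hD1 := one_le_card_harmIdx hd k
  have hφ := fun j x => sq_harmLEBasis_le hd (k := k) j x
  have hcard : (Finset.univ : Finset (HarmIdx d k)).card = Fintype.card (HarmIdx d k) := rfl
  set D : ℝ := (Fintype.card (HarmIdx d k) : ℝ) with hD
  have hn' : (0 : ℝ) < n := by exact_mod_cast hn
  -- A common lower bound for the three exponents `16 n / (512 D⁴)`, `4 n / (512 D³)` and `n ε² /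
  -- (512 D³)`.
  set K := n * min 1 (ε ^ 2) / (512 * D ^ 4) with hK
  set ν₁ := Measure.pi fun _ : Fin n => unif d
  set ν₂ := Measure.pi fun _ : Fin n => gaussianReal 0 1
  have hmin1 : min 1 (ε ^ 2) ≤ 1 := min_le_left _ _
  have hmin2 : min 1 (ε ^ 2) ≤ ε ^ 2 := min_le_right _ _
  have hD34 : D ^ 3 ≤ D ^ 4 := pow_le_pow_right₀ hD1 (by norm_num)
  have hexp : ∀ {a : ℝ}, K ≤ a → ENNReal.ofReal (2 * Real.exp (-a)) ≤
      ENNReal.ofReal (2 * Real.exp (-K)) := fun h =>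
    ENNReal.ofReal_le_ofReal (by
      have := Real.exp_le_exp.mpr (neg_le_neg h)
      linarith)
  let A : HarmIdx d k → HarmIdx d k → Set (Fin n → Sph d) := fun i j =>
    {x | n * (1 / (2 * D)) ≤ |∑ t, (harmLEBasis d k i (x t) * harmLEBasis d k j (x t) -
      if i = j then 1 else 0)|}
  let B : HarmIdx d k → Set (Fin n → Sph d) := fun j =>
    {x | n * (ε / (16 * D)) ≤ |∑ t, harmLEBasis d k j (x t) * r (x t)|}
  let C : HarmIdx d k → Set ((Fin n → Sph d) × (Fin n → ℝ)) := fun j =>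
    {z | n * (ε / (16 * D)) ≤ |∑ t, harmLEBasis d k j (z.1 t) * z.2 t|}
  have hA : ∀ i j, ν₁ (A i j) ≤ ENNReal.ofReal (2 * Real.exp (-K)) := by
    intro i j
    refine (measure_abs_sum_ge_le_of_bound (s := unif d)
      (g := fun x => harmLEBasis d k i x * harmLEBasis d k j x - if i = j then 1 else 0)
      (M := 2 * D) ?_ (by positivity) (Filter.Eventually.of_forall fun x => ?_) ?_ hn
      (by positivity)).trans (hexp ?_)
    · exact ((((harmLEBasis d k i).continuous.mul (harmLEBasis d k j).continuous).measurable).sub_const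
        _).aemeasurable
    · have h1 := hφ i x
      have h2 := hφ j x
      have h3 : |harmLEBasis d k i x * harmLEBasis d k j x| ≤ D := by
        rw [abs_le]
        constructor <;> nlinarith [sq_nonneg (harmLEBasis d k i x + harmLEBasis d k j x),
          sq_nonneg (harmLEBasis d k i x - harmLEBasis d k j x)]
      have h4 : |(if i = j then 1 else 0 : ℝ)| ≤ 1 := by split_ifs <;> simp
      linarith [abs_sub (harmLEBasis d k i x * harmLEBasis d k j x) (if i = j then 1 else 0 : ℝ)]
    · rw [integral_sub (integrable_coe_mul _ _) (integrable_const _), integral_harmLEBasis_mul hd]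
      simp
    · rw [hK]
      have e : n * (1 / (2 * D)) ^ 2 / (2 * (2 * D) ^ 2) = n * 16 / (512 * D ^ 4) := by
        field_simp
        norm_num
      rw [e]
      gcongr
      linarith
  have hB : ∀ j, ν₁ (B j) ≤ ENNReal.ofReal (2 * Real.exp (-K)) := by
    intro j
    refine (measure_abs_sum_ge_le_of_bound (s := unif d)
      (g := fun x => harmLEBasis d k j x * r x)
      (M := √D * (ε / 2)) ?_ (by positivity) ?_ (hr0 j) hn (by positivity)).trans (hexp ?_)
    · exact ((harmLEBasis d k j).continuous.measurable.mul hr).aemeasurable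
    · filter_upwards [hrε] with x hx
      rw [abs_mul]
      exact mul_le_mul (Real.abs_le_sqrt (hφ j x)) hx (abs_nonneg _) (Real.sqrt_nonneg _)
    · rw [hK]
      have e : n * (ε / (16 * D)) ^ 2 / (2 * (√D * (ε / 2)) ^ 2) = n * 4 / (512 * D ^ 3) := by
        rw [mul_pow, Real.sq_sqrt (by positivity)]
        field_simp
        norm_num
      rw [e]
      gcongr
      linarith
  have hC : ∀ j, (ν₁.prod ν₂) (C j) ≤ ENNReal.ofReal (2 * Real.exp (-K)) := by
    intro j
    have hm : MeasurableSet (C j) := by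
      refine measurableSet_le measurable_const (Finset.measurable_fun_sum _ fun t _ => ?_).abs
      exact ((harmLEBasis d k j).continuous.measurable.comp
        ((measurable_pi_apply t).comp measurable_fst)).mul
        ((measurable_pi_apply t).comp measurable_snd)
    rw [Measure.prod_apply hm]
    calc _ ≤ ∫⁻ _, ENNReal.ofReal (2 * Real.exp (-K)) ∂ν₁ := by
          refine lintegral_mono fun x => ?_
          refine (measure_abs_sum_mul_gaussian_ge_le hn (a := fun t => harmLEBasis d k j (x t))
            (M := D) (by positivity) (fun t => hφ j (x t)) (by positivity)).trans (hexp ?_)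
          rw [hK]
          have e : n * (ε / (16 * D)) ^ 2 / (2 * D) = n * ε ^ 2 / (512 * D ^ 3) := by
            field_simp
            norm_num
          rw [e]
          gcongr
      _ = _ := by simp [ν₁]
  have hsub : {z | ¬ SampleGood d k ε r z} ⊆ (⋃ i, ⋃ j, A i j ×ˢ Set.univ) ∪
      ((⋃ j, B j ×ˢ Set.univ) ∪ ⋃ j, C j) := by
    intro z hz
    by_contra hc
    simp only [Set.mem_union, Set.mem_iUnion, not_or, not_exists, Set.mem_prod, Set.mem_univ,
      and_true, A, B, C, Set.mem_ofPred_eq, not_le] at hc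
    exact hz ⟨fun i j => (hc.1 i j).le, fun j => (hc.2.1 j).le, fun j => (hc.2.2 j).le⟩
  have hprod : ∀ S : Set (Fin n → Sph d), (ν₁.prod ν₂) (S ×ˢ Set.univ) = ν₁ S := fun S => by
    rw [Measure.prod_prod]
    simp [ν₂]
  set E := ENNReal.ofReal (2 * Real.exp (-K))
  have hsumE : ∀ g : HarmIdx d k → Set ((Fin n → Sph d) × (Fin n → ℝ)), ∀ b,
      (∀ j, (ν₁.prod ν₂) (g j) ≤ b) → (ν₁.prod ν₂) (⋃ j, g j) ≤ ENNReal.ofReal D * b := by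
    intro g b hg
    refine (measure_iUnion_fintype_le _ _).trans ((Finset.sum_le_sum fun j _ => hg j).trans_eq ?_)
    rw [Finset.sum_const, hcard, nsmul_eq_mul, hD, ENNReal.ofReal_natCast]
  calc _ ≤ ENNReal.ofReal D * (ENNReal.ofReal D * E) + (ENNReal.ofReal D * E + ENNReal.ofReal D * E) := by
        refine (measure_mono hsub).trans ((measure_union_le _ _).trans (add_le_add ?_
          ((measure_union_le _ _).trans (add_le_add ?_ ?_))))
        · exact hsumE _ _ fun i => hsumE _ _ fun j => (hprod _).trans_le (hA i j)
        · exact hsumE _ _ fun j => (hprod _).trans_le (hB j)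
        · exact hsumE _ _ hC
    _ ≤ _ := by
        simp only [E]
        rw [← ENNReal.ofReal_mul (by positivity), ← ENNReal.ofReal_mul (by positivity),
          ← ENNReal.ofReal_add (by positivity) (by positivity),
          ← ENNReal.ofReal_add (by positivity) (by positivity)]
        refine ENNReal.ofReal_le_ofReal ?_
        have hDD : D ≤ D ^ 2 := by nlinarith
        nlinarith [Real.exp_pos (-K)]

/-! ### Success of the algorithm -/

lemma harmExpand_sub {k : ℕ} (a b : HarmIdx d k → ℝ) :
    harmExpand (a - b) = harmExpand a - harmExpand b := by
  simp [harmExpand, sub_smul]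

/-- In coefficients the function class is a product of balls, which is compact, and the loss is
continuous. -/
lemma exists_isOutput (hd : 3 ≤ d) {β c₁ c₂ ε : ℝ} (hc₁ : 0 ≤ c₁) {n : ℕ} (x : Fin n → Sph d)
    (y : Fin n → ℝ) : ∃ g, IsOutput d β c₁ c₂ ε x y g := by
  set k := threshold d β c₁ c₂ ε with hk
  let K : Set (HarmIdx d k → ℝ) := {a | ∀ l : Fin (k + 1), ∑ i, a ⟨l, i⟩ ^ 2 ≤ c₁ ^ 2}
  have hclosed : IsClosed K := by
    have : K = ⋂ l : Fin (k + 1), {a | ∑ i, a ⟨l, i⟩ ^ 2 ≤ c₁ ^ 2} := by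
      ext a
      simp only [Set.mem_iInter]
      rfl
    rw [this]
    exact isClosed_iInter fun l => isClosed_le (by fun_prop) continuous_const
  have hcompact : IsCompact K := by
    refine Metric.isCompact_of_isClosed_isBounded hclosed
      (Metric.isBounded_closedBall (x := 0) (r := c₁) |>.subset fun a ha => ?_)
    rw [mem_closedBall_zero_iff, pi_norm_le_iff_of_nonneg hc₁]
    rintro ⟨l, i⟩
    refine abs_le_of_sq_le_sq (le_trans ?_ (ha l)) hc₁
    exact Finset.single_le_sum (f := fun i => a ⟨l, i⟩ ^ 2) (fun i _ => sq_nonneg _)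
      (Finset.mem_univ i)
  have hcont : Continuous fun a : HarmIdx d k → ℝ => ∑ t, (harmExpand a (x t) - y t) ^ 2 := by
    simp only [harmExpand_apply]
    fun_prop
  obtain ⟨a, ha, hmin⟩ := hcompact.exists_isMinOn
    ⟨0, fun l => by simpa using sq_nonneg c₁⟩ hcont.continuousOn
  refine ⟨harmExpand a, (mem_funClass_iff hd hc₁).mpr ⟨a, rfl, ha⟩, fun h hh => ?_⟩
  obtain ⟨b, rfl, hb⟩ := (mem_funClass_iff hd hc₁).mp hh
  exact isMinOn_iff.mp hmin b hb

/-- The truncation of `u` lies in the function class, so the output must fit at least as well.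
`sum_sq_le_of_isMin` applies to the coefficient difference, with residual plus noise as the error
vector. -/
lemma IsApproximable.abs_output_sub_le (hd : 3 ≤ d) {β c₁ c₂ ε : ℝ} (hc₁ : 0 ≤ c₁) (hε : 0 < ε) {n : ℕ}
    (hn : 0 < n) {u : Sph d → ℝ} (hu : IsApproximable d (threshold d β c₁ c₂ ε) c₁ (ε / 2) u)
    {z : (Fin n → Sph d) × (Fin n → ℝ)} (hz : SampleGood d (threshold d β c₁ c₂ ε) ε
      (fun x => u x - harmExpand (harmCoeff (threshold d β c₁ c₂ ε) u) x) z)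
    {g : C(Sph d, ℝ)} (hg : IsOutput d β c₁ c₂ ε z.1 (labels u z.1 z.2) g) (x : Sph d) :
    |g x - harmExpand (harmCoeff (threshold d β c₁ c₂ ε) u) x| ≤ ε / 2 := by
  obtain ⟨hgF, hgmin⟩ := hg
  set k := threshold d β c₁ c₂ ε
  obtain ⟨a, rfl, ha⟩ := (mem_funClass_iff hd hc₁).mp hgF
  have h1 := hgmin _ ((mem_funClass_iff hd hc₁).mpr ⟨harmCoeff k u, rfl, hu.sum_sq_le⟩)
  set a₀ := harmCoeff k u
  have hD := one_le_card_harmIdx hd k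
  have h2 := sum_sq_le_of_isMin hn (Φ := fun t j => harmLEBasis d k j (z.1 t))
    (e := fun t => (u (z.1 t) - harmExpand a₀ (z.1 t)) + z.2 t) (b := a - a₀) hε hz.1 ?_ ?_
  · have h3 := (harmExpand_sq_le hd (a - a₀) x).trans h2
    rw [harmExpand_sub] at h3
    exact abs_le_of_sq_le_sq h3 (by positivity)
  · intro j
    simp only [mul_add, Finset.sum_add_distrib]
    refine (abs_add_le _ _).trans ((add_le_add (hz.2.1 j) (hz.2.2 j)).trans_eq ?_)
    field_simp
    norm_num
  · refine le_of_eq_of_le (Finset.sum_congr rfl fun t _ => ?_) (h1.trans_eq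
      (Finset.sum_congr rfl fun t _ => ?_))
    · simp only [labels]
      rw [← harmExpand_apply (a - a₀) (z.1 t), harmExpand_sub, ContinuousMap.sub_apply]
      ring
    · simp only [labels]
      ring

lemma IsApproximable.succeeds (hd : 3 ≤ d) {β c₁ c₂ ε : ℝ} (hc₁ : 0 ≤ c₁) (hε : 0 < ε) {n : ℕ}
    (hn : 0 < n) {u : Sph d → ℝ} (hu : IsApproximable d (threshold d β c₁ c₂ ε) c₁ (ε / 2) u)
    {z : (Fin n → Sph d) × (Fin n → ℝ)} (hz : SampleGood d (threshold d β c₁ c₂ ε) ε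
      (fun x => u x - harmExpand (harmCoeff (threshold d β c₁ c₂ ε) u) x) z) :
    Succeeds d β c₁ c₂ ε u z.1 z.2 := by
  have := nontrivial_euclidean (d := d) (by omega)
  have := isOpenPosMeasure_unif (d := d)
  refine ⟨exists_isOutput hd hc₁ _ _, fun g hg => ?_⟩
  have h1 : ∀ᵐ x ∂(unif d), |g x - u x| ≤ ε := by
    filter_upwards [hu.close] with x hx
    have h2 := hu.abs_output_sub_le hd hc₁ hε hn hz hg x
    rw [abs_le] at *
    constructor <;> linarith [hx.1, hx.2, h2.1, h2.2]
  refine ⟨?_, fun hcont x => ?_⟩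
  · rw [eLpNorm_exponent_top]
    exact eLpNormEssSup_le_of_ae_bound h1
  · have hcl : IsClosed {x | |g x - u x| ≤ ε} :=
      isClosed_le (by fun_prop) continuous_const
    -- The uniform measure charges every nonempty open set, so a closed condition that holds almost
    -- everywhere holds everywhere.
    have hdense := Measure.dense_of_ae h1
    have : x ∈ closure {x | |g x - u x| ≤ ε} := hdense x
    rwa [hcl.closure_eq] at this

end

section
variable {d : ℕ}

/-! ### The number of samples -/

/-- Since `(1 + ε⁻²) min(1, ε²) ≥ 1`, the exponent is at least `12 D² + ℓ`. The first summand beats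
the prefactor because `y exp (-y) ≤ 1`. -/
lemma exp_bound_of_sample_size {D ε ℓ n : ℝ} (hD : 1 ≤ D) (hε : 0 < ε) (hℓ : 0 ≤ ℓ)
    (hn : 6144 * D ^ 6 * ((1 + (1 / ε) ^ 2) * (1 + ℓ)) ≤ n) :
    6 * D ^ 2 * Real.exp (-(n * min 1 (ε ^ 2) / (512 * D ^ 4))) ≤ Real.exp (-ℓ) / 2 := by
  have hmin : 1 ≤ (1 + (1 / ε) ^ 2) * min 1 (ε ^ 2) := by
    rcases le_total 1 (ε ^ 2) with h | h
    · rw [min_eq_left h]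
      linarith [sq_nonneg (1 / ε)]
    · rw [min_eq_right h, add_mul, ← mul_pow, one_div_mul_cancel hε.ne']
      linarith [sq_nonneg ε]
  have hDD : 1 ≤ D ^ 2 := one_le_pow₀ hD
  have h1 : 12 * D ^ 2 + ℓ ≤ n * min 1 (ε ^ 2) / (512 * D ^ 4) := by
    rw [le_div_iff₀ (by positivity)]
    have h2 : 0 ≤ min 1 (ε ^ 2) := le_min zero_le_one (sq_nonneg ε)
    calc (12 * D ^ 2 + ℓ) * (512 * D ^ 4) ≤ 12 * D ^ 2 * (1 + ℓ) * (512 * D ^ 4) := by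
          gcongr
          nlinarith
      _ = 6144 * D ^ 6 * (1 + ℓ) * 1 := by ring
      _ ≤ 6144 * D ^ 6 * (1 + ℓ) * ((1 + (1 / ε) ^ 2) * min 1 (ε ^ 2)) := by gcongr
      _ = 6144 * D ^ 6 * ((1 + (1 / ε) ^ 2) * (1 + ℓ)) * min 1 (ε ^ 2) := by ring
      _ ≤ n * min 1 (ε ^ 2) := by gcongr
  have h3 : 12 * D ^ 2 * Real.exp (-(12 * D ^ 2)) ≤ 1 := by
    rw [Real.exp_neg, ← div_eq_mul_inv, div_le_one (Real.exp_pos _)]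
    linarith [Real.add_one_le_exp (12 * D ^ 2)]
  calc 6 * D ^ 2 * Real.exp (-(n * min 1 (ε ^ 2) / (512 * D ^ 4)))
      ≤ 6 * D ^ 2 * Real.exp (-(12 * D ^ 2 + ℓ)) := by gcongr
    _ = (12 * D ^ 2 * Real.exp (-(12 * D ^ 2))) * (Real.exp (-ℓ) / 2) := by
        rw [neg_add, Real.exp_add]
        ring
    _ ≤ 1 * (Real.exp (-ℓ) / 2) := by gcongr
    _ = _ := one_mul _

/-- The dimension of the function class of the algorithm. -/
lemma LargeDim.card_harmIdx_threshold_le {β c₁ c₂ ε B : ℝ} (h : LargeDim d β) (hβ : 0 < β)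
    (hβ1 : β ≤ 1) (hε : 0 < ε) (hB : 1 ≤ B) (hcB : 4 * c₁ * c₂ / ε ≤ B) :
    (Fintype.card (HarmIdx d (threshold d β c₁ c₂ ε)) : ℝ) ≤ 2 * B ^ (10 / β) := by
  have hd := h.three_le hβ hβ1
  set k := threshold d β c₁ c₂ ε with hk
  -- At threshold 0 there is no violated inequality to exploit, but then the class consists of
  -- constants and has dimension 1.
  rcases Nat.eq_zero_or_pos k with h0 | hpos
  · have h1 : (Fintype.card (HarmIdx d k) : ℝ) = 1 := by
      rw [card_harmIdx, h0]
      simp [dimN_zero hd]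
    rw [h1]
    linarith [Real.one_le_rpow hB (show 0 ≤ 10 / β by positivity)]
  · obtain ⟨hkB, hNB⟩ := h.threshold_bounds hβ hβ1 hε hpos
    rw [← hk] at hkB hNB
    have hk1 : (1 : ℝ) ≤ k := by exact_mod_cast hpos
    have hX : 0 ≤ 4 * c₁ * c₂ / ε := by linarith
    have h5 : 1 ≤ 5 / β := by rw [le_div_iff₀ hβ]; linarith
    calc (Fintype.card (HarmIdx d k) : ℝ) = ∑ l ∈ Finset.range (k + 1), (dimN l d : ℝ) :=
          card_harmIdx k
      _ ≤ ∑ l ∈ Finset.range (k + 1), (dimN k d : ℝ) := by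
          refine Finset.sum_le_sum fun l hl => ?_
          exact_mod_cast dimN_mono hd (Nat.le_of_lt_succ (Finset.mem_range.mp hl))
      _ = (k + 1) * (dimN k d : ℝ) := by simp
      _ ≤ 2 * B ^ (5 / β) * B ^ (5 / β) := by
          gcongr
          · calc (k : ℝ) + 1 ≤ 2 * B := by linarith
              _ = 2 * B ^ (1 : ℝ) := by rw [Real.rpow_one]
              _ ≤ 2 * B ^ (5 / β) := by gcongr
          · exact hNB.trans (Real.rpow_le_rpow hX hcB (by positivity))
      _ = 2 * B ^ (10 / β) := by
          rw [mul_assoc, ← Real.rpow_add (by linarith)]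
          congr 2
          ring

/-- As `R ≥ 1` and `1/β ≥ 1`, the prefactor can be moved inside the power, which gives the sample
size the form `p ^ (1/β)`. -/
lemma mul_rpow_le_rpow {β B R : ℝ} (hβ : 0 < β) (hβ1 : β ≤ 1) (hB : 1 ≤ B) (hR : 1 ≤ R) :
    R * B ^ (60 / β) ≤ (R * B ^ 60) ^ (1 / β) := by
  rw [Real.mul_rpow (by linarith) (by positivity), ← Real.rpow_natCast B 60,
    ← Real.rpow_mul (by linarith)]
  have h1 : 1 ≤ 1 / β := by rw [le_div_iff₀ hβ]; linarith
  have h2 := Real.rpow_le_rpow_of_exponent_le hR h1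
  rw [Real.rpow_one] at h2
  have e : ((60 : ℕ) : ℝ) * (1 / β) = 60 / β := by
    push_cast
    ring
  rw [e]
  gcongr

/-- The number of samples which suffices, as a polynomial in `c`, `1/ε`, `d` and `ln (1/δ)`. -/
def sampleSizePoly : MvPolynomial (Fin 4) ℕ :=
  -- The dimension bound `D ≤ 2 B^(10/β)` enters to the sixth power: `393216 = 6144 * 2⁶` and `60 =
  -- 6 * 10`. Inside `B`, `4096 = 4 * 32²` comes from `4 c₁ c₂ / ε`.
  393216 * ((1 + MvPolynomial.X 1 ^ 2) * (1 + MvPolynomial.X 3)) *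
    (1 + 4096 * MvPolynomial.X 0 * MvPolynomial.X 1 * (MvPolynomial.X 2 ^ 2 + 1 + MvPolynomial.X 3)) ^ 60

lemma aeval_sampleSizePoly (c e d l : ℝ) : (MvPolynomial.aeval ![c, e, d, l] sampleSizePoly : ℝ) =
    393216 * ((1 + e ^ 2) * (1 + l)) * (1 + 4096 * c * e * (d ^ 2 + 1 + l)) ^ 60 := by
  simp [sampleSizePoly]

/-- The field and the sample behave well simultaneously with high probability. -/
lemma jointLaw_le_of_isApproximable {Ω : Type*} [MeasurableSpace Ω] {P : Measure Ω}
    [IsProbabilityMeasure P] {κ : ℝ → ℝ} {f : Ω → Sph d → ℝ} (hd : 3 ≤ d)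
    (hf : IsIsotropicGRF P d κ f) {k n : ℕ} {c₁ ε η : ℝ} (hε : 0 < ε) (hη : 0 ≤ η) (hn : 0 < n)
    (hP : P {ω | ¬ IsApproximable d k c₁ (ε / 2) (f ω)} ≤ ENNReal.ofReal η)
    (hbound : 6 * (Fintype.card (HarmIdx d k) : ℝ) ^ 2 *
      Real.exp (-(n * min 1 (ε ^ 2) / (512 * (Fintype.card (HarmIdx d k) : ℝ) ^ 4))) ≤ η) :
    jointLaw P d n {ω | ¬ (IsApproximable d k c₁ (ε / 2) (f ω.1) ∧
      SampleGood d k ε (fun x => f ω.1 x - harmExpand (harmCoeff k (f ω.1)) x) ω.2)}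
      ≤ ENNReal.ofReal (2 * η) := by
  have := isProbabilityMeasure_unif (d := d) (by omega)
  -- Passing to a measurable hull avoids proving that the approximability event is measurable before
  -- Fubini is applied.
  set bad := toMeasurable P {ω | ¬ IsApproximable d k c₁ (ε / 2) (f ω)}
  have hbadm : MeasurableSet bad := measurableSet_toMeasurable _ _
  have hbad : P bad ≤ ENNReal.ofReal η := (measure_toMeasurable _).trans_le hP
  let r : Ω → Sph d → ℝ := fun ω x => f ω x - harmExpand (harmCoeff k (f ω)) x
  have hr : Measurable (Function.uncurry r) := by
    have e : Function.uncurry r = fun q : Ω × Sph d =>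
        f q.1 q.2 - ∑ l ∈ Finset.range (k + 1), fieldPart f l q.1 q.2 := by
      ext q
      simp only [Function.uncurry, r, harmExpand_harmCoeff_apply]
    rw [e]
    exact hf.measurable.sub (Finset.measurable_fun_sum _ fun l _ => hf.measurable_fieldPart l)
  set ν := (Measure.pi fun _ : Fin n => unif d).prod (Measure.pi fun _ : Fin n => gaussianReal 0 1)
  let G : Set (Ω × (Fin n → Sph d) × (Fin n → ℝ)) := {q | SampleGood d k ε (r q.1) q.2}
  have hG : MeasurableSet G := measurableSet_sampleGood hr k ε n
  have hsub : {ω : Ω × (Fin n → Sph d) × (Fin n → ℝ) | ¬ (IsApproximable d k c₁ (ε / 2) (f ω.1) ∧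
      SampleGood d k ε (fun x => f ω.1 x - harmExpand (harmCoeff k (f ω.1)) x) ω.2)} ⊆
      bad ×ˢ Set.univ ∪ (Gᶜ ∩ badᶜ ×ˢ Set.univ) := by
    intro q hq
    by_cases h : q.1 ∈ bad
    · exact Or.inl ⟨h, trivial⟩
    · refine Or.inr ⟨fun hg => hq ⟨?_, hg⟩, h, trivial⟩
      by_contra hc
      exact h (subset_toMeasurable _ _ hc)
  have hm : MeasurableSet (Gᶜ ∩ badᶜ ×ˢ (Set.univ : Set ((Fin n → Sph d) × (Fin n → ℝ)))) :=
    hG.compl.inter (hbadm.compl.prod MeasurableSet.univ)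
  have h1 : (P.prod ν) (bad ×ˢ Set.univ) ≤ ENNReal.ofReal η := by
    rw [Measure.prod_prod, measure_univ, mul_one]
    exact hbad
  have h2 : (P.prod ν) (Gᶜ ∩ badᶜ ×ˢ Set.univ) ≤ ENNReal.ofReal η := by
    rw [Measure.prod_apply hm]
    calc _ ≤ ∫⁻ _, ENNReal.ofReal η ∂P := by
          refine lintegral_mono fun ω => ?_
          by_cases h : ω ∈ bad
          · have : Prod.mk ω ⁻¹' (Gᶜ ∩ badᶜ ×ˢ Set.univ) = ∅ := by
              ext z
              simp [h]
            rw [this, measure_empty]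
            exact zero_le
          · have happ : IsApproximable d k c₁ (ε / 2) (f ω) := by
              by_contra hc
              exact h (subset_toMeasurable _ _ hc)
            refine (measure_mono fun z hz => ?_).trans ((measure_not_sampleGood_le hd k hε
              (r := r ω) (hr.comp measurable_prodMk_left) happ.close (fun j => ?_) hn).trans
              (ENNReal.ofReal_le_ofReal hbound))
            · exact hz.1
            -- The residual is orthogonal to the basis because the truncation uses exactly the
            -- Fourier coefficients of `f ω`.
            · simp only [r, mul_sub]
              have hi := integrable_mul_coe (by omega) happ.memLp (harmLEBasis d k j)
              simp only [mul_comm (f ω _)] at hi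
              rw [integral_sub hi (integrable_coe_mul _ _),
                integral_harmLEBasis_mul_harmExpand hd, harmCoeff, sub_eq_zero]
              simp only [mul_comm]
    _ = _ := by simp
  refine (measure_mono hsub).trans ((measure_union_le _ _).trans ((add_le_add h1 h2).trans_eq ?_))
  rw [← ENNReal.ofReal_add hη hη, two_mul]

end

end SphereRecovery

end

/-- With absolute constants `A` and `p`: for an isotropic Gaussian random field whose Legendre
coefficients satisfy the decay condition, the algorithm, run with any number
`n ≥ p(c, 1/ε, d, ln(1/δ))^{1/min(α,1)}` of samples, fails with probability at most `δ`. -/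
theorem theorem2 :
    ∃ (A : ℝ) (p : MvPolynomial (Fin 4) ℕ), 0 < A ∧
      ∀ (α c ε δ : ℝ), 0 < α → 0 < c → 0 < ε → 0 < δ → δ < 1 →
      ∀ d : ℕ, 10 * (min α 1)⁻¹ * (2 : ℝ) ^ (5 / min α 1) + 2 ≤ (d : ℝ) →
      ∀ (κ : ℝ → ℝ),
        (∀ k : ℕ, SphereRecovery.legendreCoeff d k κ
          ≤ c ^ 2 * (SphereRecovery.dimN k d : ℝ) ^ (-(1 / 2) - α)) →
      ∀ (Ω : Type*) [MeasurableSpace Ω] (P : MeasureTheory.Measure Ω)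
        [MeasureTheory.IsProbabilityMeasure P] (f : Ω → SphereRecovery.Sph d → ℝ),
        SphereRecovery.IsIsotropicGRF P d κ f →
      ∀ n : ℕ,
        (MvPolynomial.aeval ![c, 1 / ε, (d : ℝ), Real.log (1 / δ)] p : ℝ) ^ (1 / min α 1)
          ≤ (n : ℝ) →
        SphereRecovery.jointLaw P d n
          {ω | ¬ SphereRecovery.Succeeds d (min α 1)
              (A * c * √(Real.log (2 / δ))) (A * √((d : ℝ) ^ 2 + Real.log (2 / δ))) ε
              (f ω.1) ω.2.1 ω.2.2}
          ≤ ENNReal.ofReal δ := by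
  refine ⟨32, SphereRecovery.sampleSizePoly, by norm_num, ?_⟩
  intro α c ε δ hα hc hε hδ hδ1 d hβd κ hκ Ω _ P _ f hf n hn
  have hbad := hf.measure_not_isApproximable_le hα hc hε hδ hδ1 hβd hκ
  replace hβd : SphereRecovery.LargeDim d (min α 1) := hβd
  set β := min α 1
  have hβ : 0 < β := lt_min hα one_pos
  have hβ1 : β ≤ 1 := min_le_right _ _
  have hd := hβd.three_le hβ hβ1
  set ℓ := Real.log (1 / δ) with hℓdef
  have hℓ : 0 ≤ ℓ := Real.log_nonneg (by rw [le_div_iff₀ hδ]; linarith)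
  have hexp : Real.exp (-ℓ) = δ := by
    rw [Real.exp_neg, Real.exp_log (by positivity), one_div, inv_inv]
  set L := Real.log (2 / δ) with hLdef
  have hLℓ : L = Real.log 2 + ℓ := by
    rw [hLdef, hℓdef, ← Real.log_mul (by norm_num) (by positivity), mul_one_div]
  have hL0 : 0 ≤ L := by rw [hLℓ]; linarith [Real.log_two_gt_d9]
  have hL1 : L ≤ 1 + ℓ := by rw [hLℓ]; linarith [Real.log_two_lt_d9]
  set c₁ := 32 * c * √L
  set c₂ := 32 * √((d : ℝ) ^ 2 + L)
  have hc₁ : 0 ≤ c₁ := by positivity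
  set k := SphereRecovery.threshold d β c₁ c₂ ε
  set B := 1 + 4096 * c * (1 / ε) * ((d : ℝ) ^ 2 + 1 + ℓ) with hB
  have hB1 : 1 ≤ B := le_add_of_nonneg_right (by positivity)
  have hcB : 4 * c₁ * c₂ / ε ≤ B := by
    have h1 : √L * √((d : ℝ) ^ 2 + L) ≤ (d : ℝ) ^ 2 + 1 + ℓ := by
      calc √L * √((d : ℝ) ^ 2 + L) ≤ √((d : ℝ) ^ 2 + L) * √((d : ℝ) ^ 2 + L) := by
            gcongr
            linarith [sq_nonneg (d : ℝ)]
        _ = (d : ℝ) ^ 2 + L := Real.mul_self_sqrt (by positivity)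
        _ ≤ _ := by linarith
    calc 4 * c₁ * c₂ / ε = 4096 * c * (1 / ε) * (√L * √((d : ℝ) ^ 2 + L)) := by
          simp only [c₁, c₂]
          ring
      _ ≤ 4096 * c * (1 / ε) * ((d : ℝ) ^ 2 + 1 + ℓ) := by gcongr
      _ ≤ B := by rw [hB]; linarith
  have hD := hβd.card_harmIdx_threshold_le hβ hβ1 hε hB1 hcB
  have hD1 := SphereRecovery.one_le_card_harmIdx hd k
  set R := (1 + (1 / ε) ^ 2) * (1 + ℓ)
  have hR : 1 ≤ R := by
    have h1 := sq_nonneg (1 / ε)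
    nlinarith
  rw [SphereRecovery.aeval_sampleSizePoly] at hn
  have hn' := (SphereRecovery.mul_rpow_le_rpow hβ hβ1 hB1 (show 1 ≤ 393216 * R by linarith)).trans hn
  have hB60 : B ^ (60 / β) = (B ^ (10 / β)) ^ 6 := by
    rw [← Real.rpow_mul_natCast (by linarith)]
    congr 1
    push_cast
    ring
  have hsize : 6144 * (Fintype.card (SphereRecovery.HarmIdx d k) : ℝ) ^ 6 * R ≤ n := by
    calc 6144 * (Fintype.card (SphereRecovery.HarmIdx d k) : ℝ) ^ 6 * R
        ≤ 6144 * (2 * B ^ (10 / β)) ^ 6 * R := by gcongr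
      _ = 393216 * R * B ^ (60 / β) := by rw [hB60]; ring
      _ ≤ n := hn'
  have hnpos : 0 < n := by
    have h1 : (1 : ℝ) ≤ (Fintype.card (SphereRecovery.HarmIdx d k) : ℝ) ^ 6 := one_le_pow₀ hD1
    have h2 : (0 : ℝ) < n := by nlinarith
    exact_mod_cast h2
  have hbound := SphereRecovery.exp_bound_of_sample_size hD1 hε hℓ hsize
  rw [hexp] at hbound
  have hfinal := SphereRecovery.jointLaw_le_of_isApproximable hd hf hε (by positivity) hnpos hbad hbound
  rw [mul_div_cancel₀ δ two_ne_zero] at hfinal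
  -- Monotonicity holds for the outer measure, so the failure set need not be measurable.
  refine (measure_mono fun ω hω => ?_).trans hfinal
  exact fun h => hω (h.1.succeeds hd hc₁ hε hnpos h.2)
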